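/- Let $S$ be an algebraic complex K3 surface with $NS(S)=\mathbb{Z}H$, $H$ ample, $(H,H)=2n>0$. (The surface enters only through its marked period: a class $\omega\in\Lambda_{K3}\otimes\mathbb{C}$, $\Lambda_{K3}=E_8^2\oplus U^3$ with $E_8$ negative definite, such that $(\omega,\omega)=0$, $(\omega,\bar\omega)>0$, together with an ample class; $NS(S)=\omega^\perp\cap\Lambda_{K3}$.) Let $L=\widetilde{NS}(S)=H^0(S,\mathbb{Z})\oplus NS(S)\oplus H^4(S,\mathbb{Z})$ carry the Mukai pairing $((r,D,s),(r',D',s'))=(D,D')-rs'-r's$, let $T$ be its orthogonal complement in $\widetilde H(S,\mathbb{Z})=H^0\oplus H^2\oplus H^4$, and let $\lambda\colon D_{L}\simeq D_T$ be the natural isomorphism of the discriminant groups $D_M=M^\vee/M$. Let $\Gamma(S)\subset O(L)$ be the group of isometries whose action on $D_{L}$ corresponds under $\lambda$ to the action on $D_T$ of a Hodge isometry of $T$. Let $\Omega^+$ be the connected component of $$\{\mathbb{C}v\in\mathbb{P}(L_{\mathbb{C}}) : (v,v)=0,\ (v,\bar v)>0\}$$ containing $\mathbb{C}(1,\tfrac{i}{\sqrt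 n}H,-1)$, i.e. the component for which $\mathbb{R}(1,0,-1)\oplus\mathbb{R}(0,H,0)$ is positively oriented. Let $\Gamma(S)^+\subset\Gamma(S)$ be the subgroup preserving $\Omega^+$, and let $\mathcal{K}(S)=\Gamma(S)^+\backslash\Omega^+$. Let $\mathcal{O}'=\{\begin{pmatrix}a&b\\nc&d\end{pmatrix} : a,b,c,d\in\mathbb{Z}\}$ be the Eichler order of level $n$, and $N(\mathcal{O}')\subset GL_2(\mathbb{Q})$ its normalizer. Let $\Gamma_0(n)^+\subset SL_2(\mathbb{R})$ be the Fricke group, generated by $\Gamma_0(n)$ and $\begin{pmatrix}0&-1/\sqrt n\\ \sqrt n&0\end{pmatrix}$. Identify the complex $2\times2$ matrices of trace zero with $L_{\mathbb{C}}$ by $$a\begin{pmatrix}0&0\\-2n&0\end{pmatrix}+b\begin{pmatrix}-1&0\\0&1\end{pmatrix}+c\begin{pmatrix}0&2\\0&0\end{pmatrix}\mapsto\Bigl(a,\,b\tfrac{H}{2n},\,c\Bigr),$$ and let $\mathrm{Ad}_\gamma$ denote conjugation by $\gamma$, transported to $L_{\mathbb{C}}$. Put $\mathbb{H}^*=\mathbb{H}\cup\mathbb{Q}\cup\{\infty\}$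 and $(\Omega^+)^*=\Omega^+\cup\{\mathbb{C}l : 0\neq l\in L,\ (l,l)=0\}$, both with the horoball topology: besides the open sets of $\mathbb{H}$, resp. $\Omega^+$, basic punctured neighbourhoods are $\{\mathrm{Im}\,\tau>M\}$ at $\infty$, open disks in $\mathbb{H}$ tangent to the real axis at $q\in\mathbb{Q}$, and $\{\mathbb{C}v\in\Omega^+ : (v,\bar v)>M|(v,l)|^2\}$ at $\mathbb{C}l$. The compactifications of $\Gamma_0(n)^+\backslash\mathbb{H}$ and $\mathcal{K}(S)$ (the latter being that of Baily-Borel) are $\Gamma_0(n)^+\backslash\mathbb{H}^*$ and $\Gamma(S)^+\backslash(\Omega^+)^*$, with the quotient topology and the sheaf of continuous functions whose pullback to $\mathbb{H}$, resp. $\Omega^+$, is holomorphic. An isomorphism of such spaces is a homeomorphism identifying the sheaves of holomorphic functions. Then: 1. $(\gamma,\varepsilon)\mapsto\varepsilon\,\mathrm{Ad}_\gamma$ is a surjective homomorphism $N(\mathcal{O}')\times\{\pm1\}\to O(L)$ with kernel $\mathbb{Q}^\times\times\{1\}$, and $\varepsilon\,\mathrm{Ad}_\gamma\in\Gamma(S)^+$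 if and only if $\gamma$ lies in the group generated by $\mathbb{Q}^\times$, $\Gamma_0(n)$ and $\begin{pmatrix}0&-1\\n&0\end{pmatrix}$. 2. $(\gamma,\varepsilon)\mapsto\varepsilon\,\mathrm{Ad}_\gamma$ is a surjective homomorphism $\Gamma_0(n)^+\times\{\pm1\}\to\Gamma(S)^+$ with kernel $\{\pm I\}\times\{1\}$, so that $\Gamma(S)^+\simeq(\Gamma_0(n)^+/\{\pm I\})\times\{\pm\mathrm{id}\}$. The map $t(\tau)=\mathbb{C}(1,\tau H,n\tau^2)$, $t(\infty)=\mathbb{C}(0,0,1)$, satisfies $t(\gamma x)=\varepsilon\,\mathrm{Ad}_\gamma\,t(x)$ for all $x\in\mathbb{P}^1(\mathbb{C})$, $\gamma\in\Gamma_0(n)^+$, $\varepsilon=\pm1$. 3. $t$ restricts to an isomorphism of complex manifolds $\mathbb{H}\simeq\Omega^+$, which extends to an isomorphism $\mathbb{H}^*\simeq(\Omega^+)^*$, again given by $t$, under which $\mathbb{Q}\cup\{\infty\}$ corresponds to the set of isotropic lines $\mathbb{C}l$. 4. $t$ induces an isomorphism $\Gamma_0(n)^+\backslash\mathbb{H}\simeq\mathcal{K}(S)=\Gamma(S)^+\backslash\Omega^+$,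 and the extension of $t$ induces an isomorphism of the compactifications $\Gamma_0(n)^+\backslash\mathbb{H}^*\simeq\Gamma(S)^+\backslash(\Omega^+)^*$ extending it. -/

import Mathlib

open scoped MatrixGroups UpperHalfPlane LinearAlgebra.Projectivization TensorProduct

noncomputable section

/-! ### Lattices given by a Gram matrix, their complexifications and discriminant groups -/

section Lattices

variable {κ : Type}

/-- The symmetric bilinear form with integral Gram matrix `G`, with coefficients in `R`. -/
def latticeForm [Fintype κ] {R : Type} [CommRing R] (G : Matrix κ κ ℤ) (x y : κ → R) : R :=
  x ⬝ᵥ ((G.map (Int.cast : ℤ → R)).mulVec y)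

/-- The inclusion of `ℤ^κ` in `ℂ^κ`. -/
def castVec : (κ → ℤ) →ₗ[ℤ] (κ → ℂ) where
  toFun x i := (x i : ℂ)
  map_add' x y := by ext i; simp
  map_smul' c x := by ext i; simp

/-- The complexification `L_ℂ` of a sublattice `L` of `ℤ^κ`, as a subspace of `ℂ^κ`. -/
def cplx (L : Submodule ℤ (κ → ℤ)) : Submodule ℂ (κ → ℂ) :=
  Submodule.span ℂ (castVec '' (L : Set (κ → ℤ)))

/-- The inclusion `L → L_ℂ`. -/
def toCplx (L : Submodule ℤ (κ → ℤ)) : L →ₗ[ℤ] cplx L where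
  toFun x := ⟨castVec (x : κ → ℤ), Submodule.subset_span ⟨x, x.2, rfl⟩⟩
  map_add' x y := by ext i; simp
  map_smul' c x := by ext i; simp [castVec]

/-- The natural map `ℂ ⊗ L → L_ℂ`, `c ⊗ x ↦ c • x`. -/
def tensorToCplx (L : Submodule ℤ (κ → ℤ)) : ℂ ⊗[ℤ] L →ₗ[ℂ] cplx L :=
  TensorProduct.AlgebraTensorModule.lift
    (LinearMap.toSpanSingleton ℂ (L →ₗ[ℤ] cplx L) (toCplx L))

theorem tensorToCplx_tmul (L : Submodule ℤ (κ → ℤ)) (c : ℂ) (x : L) :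
    tensorToCplx L (c ⊗ₜ x) = c • toCplx L x := by
  simp [tensorToCplx]

theorem tensorToCplx_injective [Fintype κ] (L : Submodule ℤ (κ → ℤ)) :
    Function.Injective (tensorToCplx L) := by
  classical
  have h1 : Function.Injective (LinearMap.lTensor ℂ L.subtype) :=
    Module.Flat.lTensor_preserves_injective_linearMap _ L.injective_subtype
  have h2 : Function.Injective
      (fun z : ℂ ⊗[ℤ] L => TensorProduct.piScalarRight ℤ ℂ ℂ κ (LinearMap.lTensor ℂ L.subtype z)) :=
    (TensorProduct.piScalarRight ℤ ℂ ℂ κ).injective.comp h1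
  have h3 : ∀ z : ℂ ⊗[ℤ] L, ((tensorToCplx L z : cplx L) : κ → ℂ) =
      TensorProduct.piScalarRight ℤ ℂ ℂ κ (LinearMap.lTensor ℂ L.subtype z) := by
    intro z
    induction z with
    | zero => simp
    | add a b ha hb => simp [ha, hb]
    | tmul c x =>
      rw [tensorToCplx_tmul]
      ext i
      simp [toCplx, castVec, mul_comm]
  intro a b hab
  apply h2
  simp only [← h3, hab]

theorem tensorToCplx_surjective (L : Submodule ℤ (κ → ℤ)) :
    Function.Surjective (tensorToCplx L) := by
  rintro ⟨v, hv⟩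
  induction hv using Submodule.span_induction with
  | mem x h =>
    obtain ⟨y, hy, rfl⟩ := h
    exact ⟨(1 : ℂ) ⊗ₜ ⟨y, hy⟩, by rw [tensorToCplx_tmul]; ext i; simp [toCplx]⟩
  | zero => exact ⟨0, by ext i; simp⟩
  | add x y hx hy ihx ihy =>
    obtain ⟨a, ha⟩ := ihx
    obtain ⟨b, hb⟩ := ihy
    exact ⟨a + b, by rw [map_add, ha, hb]; rfl⟩
  | smul c x hx ih =>
    obtain ⟨a, ha⟩ := ih
    exact ⟨c • a, by rw [map_smul, ha]; rfl⟩

variable [Fintype κ]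

/-- The isomorphism `ℂ ⊗ L ≃ L_ℂ`. -/
def cplxEquiv (L : Submodule ℤ (κ → ℤ)) : ℂ ⊗[ℤ] L ≃ₗ[ℂ] cplx L :=
  LinearEquiv.ofBijective (tensorToCplx L)
    (And.intro (tensorToCplx_injective L) (tensorToCplx_surjective L) :
      Function.Bijective (tensorToCplx L))

/-- The `ℂ`-linear extension of an automorphism of `L` to `L_ℂ`. -/
def cplxAut (L : Submodule ℤ (κ → ℤ)) : (L ≃ₗ[ℤ] L) →* (cplx L ≃ₗ[ℂ] cplx L) where
  toFun γ := ((cplxEquiv L).symm.trans (γ.baseChange ℤ ℂ L L)).trans (cplxEquiv L)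
  map_one' := by
    ext v
    obtain ⟨z, rfl⟩ := (cplxEquiv L).surjective v
    induction z with
    | zero => simp
    | add a b ha hb => simp_all
    | tmul c x => simp
  map_mul' γ δ := by
    ext v
    obtain ⟨z, rfl⟩ := (cplxEquiv L).surjective v
    induction z with
    | zero => simp
    | add a b ha hb => simp_all
    | tmul c x => simp

theorem cplxAut_toCplx (L : Submodule ℤ (κ → ℤ)) (γ : L ≃ₗ[ℤ] L) (x : L) :
    cplxAut L γ (toCplx L x) = toCplx L (γ x) := by
  have h : ∀ y : L, toCplx L y = cplxEquiv L ((1 : ℂ) ⊗ₜ y) := fun y =>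
    ((tensorToCplx_tmul L 1 y).trans (one_smul _ _)).symm
  rw [h, h]
  simp [cplxAut]

/-- The isometry group `O(L)`. -/
def isometryGroup (G : Matrix κ κ ℤ) (L : Submodule ℤ (κ → ℤ)) : Subgroup (L ≃ₗ[ℤ] L) where
  carrier := {γ | ∀ x y : L, latticeForm G (γ x : κ → ℤ) (γ y : κ → ℤ) =
    latticeForm G (x : κ → ℤ) (y : κ → ℤ)}
  mul_mem' {a b} ha hb x y := (ha (b x) (b y)).trans (hb x y)
  one_mem' _ _ := rfl
  inv_mem' {a} ha x y := by
    have h := ha (a⁻¹ x) (a⁻¹ y)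
    have e : ∀ z : L, a (a⁻¹ z) = z := fun z => a.apply_symm_apply z
    rw [e, e] at h
    exact h.symm

/-- The functional `(v, ·)` on `L`, for a vector `v` of the ambient lattice `ℤ^κ`. -/
def pairingWith (G : Matrix κ κ ℤ) (L : Submodule ℤ (κ → ℤ)) :
    (κ → ℤ) →ₗ[ℤ] Module.Dual ℤ L where
  toFun v :=
    { toFun := fun x => latticeForm G v (x : κ → ℤ)
      map_add' := fun x y => by simp [latticeForm, Matrix.mulVec_add]
      map_smul' := fun c x => by
        simp only [latticeForm, Submodule.coe_smul, Matrix.mulVec_smul, dotProduct_smul]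
        rfl }
  map_add' v w := by ext x; simp [latticeForm]
  map_smul' c v := by
    ext x
    simp only [latticeForm, smul_dotProduct, LinearMap.coe_mk, AddHom.coe_mk]
    rfl

/-- The image of `L` in `L^∨ = Hom(L, ℤ)`. -/
def latticeInDual (G : Matrix κ κ ℤ) (L : Submodule ℤ (κ → ℤ)) :
    Submodule ℤ (Module.Dual ℤ L) :=
  L.map (pairingWith G L)

/-- The discriminant group `D_L = L^∨ / L`. -/
abbrev DiscGroup (G : Matrix κ κ ℤ) (L : Submodule ℤ (κ → ℤ)) : Type :=
  Module.Dual ℤ L ⧸ latticeInDual G L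

theorem latticeInDual_le_comap (G : Matrix κ κ ℤ) (L : Submodule ℤ (κ → ℤ))
    (γ : isometryGroup G L) :
    latticeInDual G L ≤ (latticeInDual G L).comap
      (LinearMap.lcomp ℤ ℤ ((γ⁻¹ : isometryGroup G L) : L ≃ₗ[ℤ] L).toLinearMap) := by
  rintro _ ⟨x, hx, rfl⟩
  refine ⟨(γ : L ≃ₗ[ℤ] L) ⟨x, hx⟩, Subtype.coe_prop _, ?_⟩
  ext y
  have h := γ.2 ⟨x, hx⟩ ((γ : L ≃ₗ[ℤ] L)⁻¹ y)
  have e : (γ : L ≃ₗ[ℤ] L) ((γ : L ≃ₗ[ℤ] L)⁻¹ y) = y := (γ : L ≃ₗ[ℤ] L).apply_symm_apply y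
  rw [e] at h
  exact h

/-- The natural homomorphism `r_L` from `O(L)` to the endomorphisms of `D_L`; an isometry `γ`
acts on `L^∨ = Hom(L, ℤ)` by `φ ↦ φ ∘ γ⁻¹`. -/
def discRep (G : Matrix κ κ ℤ) (L : Submodule ℤ (κ → ℤ)) :
    isometryGroup G L →* Module.End ℤ (DiscGroup G L) where
  toFun γ := Submodule.mapQ _ _
    (LinearMap.lcomp ℤ ℤ ((γ⁻¹ : isometryGroup G L) : L ≃ₗ[ℤ] L).toLinearMap)
    (latticeInDual_le_comap G L γ)
  map_one' := by ext φ; rfl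
  map_mul' γ δ := by ext φ; simp only [mul_inv_rev]; rfl

/-- For two sublattices `M`, `N` of `ℤ^κ`: the pairs `([x], [y])`, `x ∈ M^∨`, `y ∈ N^∨`, such that
`x + y` lies in `ℤ^κ`. If `ℤ^κ` is unimodular, `M` is primitive and `N` is its orthogonal
complement, this is the graph of the natural isomorphism `λ : D_M → D_N`. -/
def glueGraph (G : Matrix κ κ ℤ) (M N : Submodule ℤ (κ → ℤ)) :
    Set (DiscGroup G M × DiscGroup G N) :=
  Set.range fun v : κ → ℤ =>
    (Submodule.Quotient.mk (pairingWith G M v), Submodule.Quotient.mk (pairingWith G N v))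

/-- The points of `ℙ(L_ℂ)` given by the lines `ℂω` with `(ω, ω) = 0` and `(ω, ω̄) > 0`. -/
def periodDomain (G : Matrix κ κ ℤ) (L : Submodule ℤ (κ → ℤ)) : Set (ℙ ℂ (cplx L)) :=
  {p | ∃ (v : cplx L) (hv : v ≠ 0), p = Projectivization.mk ℂ v hv ∧
    latticeForm G (v : κ → ℂ) (v : κ → ℂ) = 0 ∧
    0 < (latticeForm G (v : κ → ℂ) (star (v : κ → ℂ))).re}

end Lattices

/-- The quotient topology on the projectivization of a complex topological vector space. -/
instance projectivizationTopology {V : Type} [AddCommGroup V] [Module ℂ V] [TopologicalSpace V] :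
    TopologicalSpace (ℙ ℂ V) :=
  TopologicalSpace.coinduced (Projectivization.mk' ℂ) inferInstance

/-! ### K3 surfaces through their periods -/

/-- The Gram matrix of the hyperbolic plane `U`. -/
def hyperbolicGram : Matrix (Fin 2) (Fin 2) ℤ := !![0, 1; 1, 0]

/-- Index set of a basis of the K3 lattice. -/
abbrev K3Index : Type := Fin 8 ⊕ Fin 8 ⊕ Fin 2 ⊕ Fin 2 ⊕ Fin 2

/-- The Gram matrix of the K3 lattice `E₈² ⊕ U³`, with `E₈` negative definite. -/
def k3Gram : Matrix K3Index K3Index ℤ :=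
  Matrix.fromBlocks (-CartanMatrix.E₈) 0 0
    (Matrix.fromBlocks (-CartanMatrix.E₈) 0 0
      (Matrix.fromBlocks hyperbolicGram 0 0
        (Matrix.fromBlocks hyperbolicGram 0 0 hyperbolicGram)))

/-- Index set of a basis of the Mukai lattice: `H²` together with `H⁰` and `H⁴`. -/
abbrev MukaiIndex : Type := K3Index ⊕ Fin 2

/-- The vector `(r, D, s)` of `H⁰ ⊕ H² ⊕ H⁴`. -/
def mukaiVec {R : Type} (r : R) (D : K3Index → R) (s : R) : MukaiIndex → R :=
  Sum.elim D ![r, s]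

/-- The Gram matrix of the Mukai pairing `((r, D, s), (r', D', s')) = (D, D') - r s' - r' s`. -/
def mukaiGram : Matrix MukaiIndex MukaiIndex ℤ :=
  Matrix.fromBlocks k3Gram 0 0 (-hyperbolicGram)

/-- An algebraic K3 surface `S`, given by its period: a marking `H²(S, ℤ) ≃ E₈² ⊕ U³` turns the
Hodge structure of `S` into a line `ℂω` with `(ω, ω) = 0`, `(ω, ω̄) > 0`, and an ample class into
an integral class `h` with `(h, ω) = 0`, `(h, h) > 0` that is orthogonal to no `(-2)`-class of
`ω^⊥`. By the Torelli theorem and the surjectivity of the period map these are exactly the periods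
`(ω, h)` of marked K3 surfaces with an ample class. -/
structure MarkedK3 where
  period : K3Index → ℂ
  ample : K3Index → ℤ
  period_isotropic : latticeForm k3Gram period period = 0
  period_positive : 0 < (latticeForm k3Gram period (star period)).re
  ample_algebraic : latticeForm k3Gram (castVec ample) period = 0
  ample_positive : 0 < latticeForm k3Gram ample ample
  ample_root : ∀ δ : K3Index → ℤ, latticeForm k3Gram (castVec δ) period = 0 →
    latticeForm k3Gram δ δ = -2 → latticeForm k3Gram ample δ ≠ 0

namespace MarkedK3

variable (S : MarkedK3)

/-- The Néron-Severi lattice `NS(S) = ω^⊥ ∩ H²(S, ℤ)`. -/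
def NS : Submodule ℤ (K3Index → ℤ) where
  carrier := {x | latticeForm k3Gram (castVec x) S.period = 0}
  add_mem' {a b} ha hb := by
    simp only [Set.mem_ofPred_eq, latticeForm, map_add, add_dotProduct] at *
    rw [ha, hb, add_zero]
  zero_mem' := by simp [latticeForm]
  smul_mem' c x hx := by
    simp only [Set.mem_ofPred_eq, latticeForm, map_smul, smul_dotProduct] at *
    rw [hx, smul_zero]

/-- The extended Néron-Severi lattice `H⁰ ⊕ NS(S) ⊕ H⁴` in the Mukai lattice. -/
def extNS : Submodule ℤ (MukaiIndex → ℤ) :=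
  S.NS.comap (LinearMap.funLeft ℤ ℤ Sum.inl)

/-- The transcendental lattice, as the orthogonal complement of the extended Néron-Severi lattice
in the Mukai lattice. -/
def transc : Submodule ℤ (MukaiIndex → ℤ) where
  carrier := {y | ∀ x ∈ S.extNS, latticeForm mukaiGram x y = 0}
  add_mem' {a b} ha hb x hx := by
    have h1 := ha x hx
    have h2 := hb x hx
    simp only [latticeForm, Matrix.mulVec_add, dotProduct_add] at *
    rw [h1, h2, add_zero]
  zero_mem' x _ := by simp [latticeForm]
  smul_mem' c y hy x hx := by
    have h := hy x hx
    simp only [latticeForm, Matrix.mulVec_smul, dotProduct_smul] at *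
    rw [h, smul_zero]

/-- The line `H^{2,0} = ℂω` in `H⁰ ⊕ H² ⊕ H⁴` with complex coefficients. -/
def hodgeLine : Submodule ℂ (MukaiIndex → ℂ) :=
  Submodule.span ℂ {mukaiVec 0 S.period 0}

/-- The group of Hodge isometries of the transcendental lattice: the isometries whose complex
linear extension preserves `H^{2,0}` (and hence `H^{0,2}` and `H^{1,1}`, which are its complex
conjugate and the orthogonal complement of the two). -/
def hodgeIsometries : Subgroup (isometryGroup mukaiGram S.transc) where
  carrier := {g | ∀ v : cplx S.transc, ((v : MukaiIndex → ℂ) ∈ S.hodgeLine ↔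
    ((cplxAut S.transc g v : cplx S.transc) : MukaiIndex → ℂ) ∈ S.hodgeLine)}
  mul_mem' {a b} ha hb v := by
    simp only [Subgroup.coe_mul, map_mul]
    exact (hb v).trans (ha _)
  one_mem' v := by simp
  inv_mem' {a} ha v := by
    have h := ha (cplxAut S.transc (a⁻¹ : isometryGroup mukaiGram S.transc) v)
    rw [← LinearEquiv.mul_apply, ← map_mul, ← Subgroup.coe_mul, mul_inv_cancel] at h
    simpa using h.symm

/-- The group `Γ(S)`: the isometries of the extended Néron-Severi lattice whose action on the
discriminant group corresponds, under `λ`, to that of a Hodge isometry of the transcendental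
lattice. -/
def Gam : Subgroup (isometryGroup mukaiGram S.extNS) where
  carrier := {γ | ∃ g ∈ S.hodgeIsometries, ∀ a b,
    ((a, b) ∈ glueGraph mukaiGram S.extNS S.transc ↔
      (discRep mukaiGram S.extNS γ a, discRep mukaiGram S.transc g b) ∈
        glueGraph mukaiGram S.extNS S.transc)}
  mul_mem' {γ δ} := by
    rintro ⟨g, hg, h⟩ ⟨k, hk, h'⟩
    refine ⟨g * k, mul_mem hg hk, fun a b => ?_⟩
    simp only [map_mul, Module.End.mul_apply]
    exact (h' a b).trans (h _ _)
  one_mem' := ⟨1, one_mem _, fun a b => by simp⟩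
  inv_mem' {γ} := by
    rintro ⟨g, hg, h⟩
    refine ⟨g⁻¹, inv_mem hg, fun a b => ?_⟩
    have := h (discRep mukaiGram S.extNS γ⁻¹ a) (discRep mukaiGram S.transc g⁻¹ b)
    simp only [← Module.End.mul_apply, ← map_mul, mul_inv_cancel] at this
    simpa using this.symm

/-- The period domain in `ℙ(L_ℂ)`, for `L` the extended Néron-Severi lattice. -/
abbrev Omega : Set (ℙ ℂ (cplx S.extNS)) := periodDomain mukaiGram S.extNS

theorem mukaiVec_mem_extNS {D : K3Index → ℤ} (hD : D ∈ S.NS) (r s : ℤ) :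
    mukaiVec r D s ∈ S.extNS := by
  have h : LinearMap.funLeft ℤ ℤ Sum.inl (mukaiVec r D s) = D := by
    ext i
    simp [LinearMap.funLeft, mukaiVec]
  simpa only [extNS, Submodule.mem_comap, h] using hD

theorem mukaiVec_mem (D : S.NS) (r c s : ℂ) :
    mukaiVec r (c • castVec (D : K3Index → ℤ)) s ∈ cplx S.extNS := by
  have h1 : castVec (mukaiVec 1 0 0) ∈ cplx S.extNS :=
    Submodule.subset_span ⟨_, S.mukaiVec_mem_extNS S.NS.zero_mem _ _, rfl⟩
  have h2 : castVec (mukaiVec 0 (D : K3Index → ℤ) 0) ∈ cplx S.extNS :=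
    Submodule.subset_span ⟨_, S.mukaiVec_mem_extNS D.2 _ _, rfl⟩
  have h3 : castVec (mukaiVec 0 0 1) ∈ cplx S.extNS :=
    Submodule.subset_span ⟨_, S.mukaiVec_mem_extNS S.NS.zero_mem _ _, rfl⟩
  have h := add_mem (add_mem (Submodule.smul_mem _ r h1) (Submodule.smul_mem _ c h2))
    (Submodule.smul_mem _ s h3)
  convert h using 1
  ext i
  rcases i with i | i
  · simp [mukaiVec, castVec]
  · fin_cases i <;> simp [mukaiVec, castVec]

/-- The vector `(r, cD, s)` of `L_ℂ`, for `D ∈ NS(S)` and complex numbers `r`, `c`, `s`. -/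
def extVec (D : S.NS) (r c s : ℂ) : cplx S.extNS :=
  ⟨mukaiVec r (c • castVec (D : K3Index → ℤ)) s, S.mukaiVec_mem D r c s⟩

theorem extVec_ne_zero_left (D : S.NS) {r : ℂ} (hr : r ≠ 0) (c s : ℂ) :
    S.extVec D r c s ≠ 0 := fun h => hr <| by
  simpa [extVec, mukaiVec] using
    congrFun (congrArg (Subtype.val : cplx S.extNS → MukaiIndex → ℂ) h) (Sum.inr 0)

theorem extVec_ne_zero_right (D : S.NS) {s : ℂ} (hs : s ≠ 0) (r c : ℂ) :
    S.extVec D r c s ≠ 0 := fun h => hs <| by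
  simpa [extVec, mukaiVec] using
    congrFun (congrArg (Subtype.val : cplx S.extNS → MukaiIndex → ℂ) h) (Sum.inr 1)

/-- The ample class as an element of `NS(S)`. -/
def ampleNS : S.NS := ⟨S.ample, S.ample_algebraic⟩

/-- The line `ℂ(x + iy)`, where `x = (1, 0, -1)` and `y` is the positive multiple of `(0, h, 0)`,
`h` ample, with `(y, y) = (x, x) = 2`: the positive two-plane `ℝ(1, 0, -1) ⊕ ℝ(0, h, 0)` with the
orientation given by this ordered basis. -/
def basePoint : ℙ ℂ (cplx S.extNS) :=
  Projectivization.mk ℂ (S.extVec S.ampleNS 1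
    ((Real.sqrt (2 / (latticeForm k3Gram S.ample S.ample : ℤ)) : ℝ) * Complex.I) (-1))
    (S.extVec_ne_zero_left _ one_ne_zero _ _)

/-- The component `Ω⁺` of the period domain singled out by the orientation for which
`ℝ(1, 0, -1) ⊕ ℝ(0, h, 0)`, `h` ample, is positively oriented. -/
def OmegaPlus : Set (ℙ ℂ (cplx S.extNS)) := connectedComponentIn S.Omega S.basePoint

/-- The action of an automorphism of the extended Néron-Severi lattice on `ℙ(L_ℂ)`. -/
def act (γ : isometryGroup mukaiGram S.extNS) (p : ℙ ℂ (cplx S.extNS)) : ℙ ℂ (cplx S.extNS) :=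
  cplxAut S.extNS (γ : S.extNS ≃ₗ[ℤ] S.extNS) • p

theorem act_one (p : ℙ ℂ (cplx S.extNS)) : S.act 1 p = p := by
  simp [act]

theorem act_mul (γ δ : isometryGroup mukaiGram S.extNS) (p : ℙ ℂ (cplx S.extNS)) :
    S.act (γ * δ) p = S.act γ (S.act δ p) := by
  simp [act, mul_smul]

/-- The group `Γ(S)⁺` of orientation-preserving elements of `Γ(S)`. -/
def GamPlus : Subgroup (isometryGroup mukaiGram S.extNS) where
  carrier := {γ | γ ∈ S.Gam ∧ ∀ p, (p ∈ S.OmegaPlus ↔ S.act γ p ∈ S.OmegaPlus)}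
  mul_mem' {a b} ha hb := ⟨mul_mem ha.1 hb.1, fun p => by
    rw [act_mul]; exact (hb.2 p).trans (ha.2 _)⟩
  one_mem' := ⟨one_mem _, fun p => by rw [act_one]⟩
  inv_mem' {a} ha := ⟨inv_mem ha.1, fun p => by
    have h := ha.2 (S.act a⁻¹ p)
    rw [← act_mul, mul_inv_cancel, act_one] at h
    exact h.symm⟩

/-- The line of `L_ℂ` spanned by a nonzero vector of the lattice `L`. -/
def latticeLine (l : S.extNS) (hl : l ≠ 0) : ℙ ℂ (cplx S.extNS) :=
  Projectivization.mk ℂ (toCplx S.extNS l) (fun h => hl <| by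
    ext i
    have := congrFun (congrArg (Subtype.val : cplx S.extNS → MukaiIndex → ℂ) h) i
    simpa [toCplx, castVec] using this)

/-- The rational isotropic lines of `L_ℂ`. -/
def isotropicLines : Set (ℙ ℂ (cplx S.extNS)) :=
  {p | ∃ (l : S.extNS) (hl : l ≠ 0),
    latticeForm mukaiGram (l : MukaiIndex → ℤ) (l : MukaiIndex → ℤ) = 0 ∧
    p = S.latticeLine l hl}

end MarkedK3

/-! ### Complex spaces as spaces with a sheaf of holomorphic functions -/

/-- A space with, for each open set `U`, a set of complex-valued functions called holomorphic on
`U`; functions are extended arbitrarily outside `U`. -/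
structure HolSpace where
  Carrier : Type
  top : TopologicalSpace Carrier
  IsHol : Set Carrier → (Carrier → ℂ) → Prop

attribute [instance] HolSpace.top

/-- An isomorphism: a homeomorphism identifying the sheaves of holomorphic functions. -/
structure HolSpace.Iso (X Y : HolSpace) where
  toHomeo : X.Carrier ≃ₜ Y.Carrier
  hol_iff : ∀ U : Set Y.Carrier, IsOpen U → ∀ f : Y.Carrier → ℂ,
    (Y.IsHol U f ↔ X.IsHol (toHomeo ⁻¹' U) (f ∘ toHomeo))

/-- The quotient by an equivalence relation: the quotient topology, and the functions with
holomorphic pullback. -/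
def HolSpace.quotient (X : HolSpace) (r : Setoid X.Carrier) : HolSpace where
  Carrier := Quotient r
  top := inferInstance
  IsHol U f := X.IsHol (Quotient.mk r ⁻¹' U) (f ∘ Quotient.mk r)

/-! ### The Fricke modular curve and its compactification -/

/-- The Fricke modular group `Γ₀(n)⁺ ⊆ SL(2, ℝ)`, generated by `Γ₀(n)` and the Fricke involution. -/
def frickeGroup (n : ℕ) : Subgroup SL(2, ℝ) :=
  Subgroup.closure
    ((CongruenceSubgroup.Gamma0 n).map
      (Matrix.SpecialLinearGroup.map (Int.castRingHom ℝ)) ∪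
    {w : SL(2, ℝ) | (w : Matrix (Fin 2) (Fin 2) ℝ) = !![0, -(√n)⁻¹; √n, 0]})

/-- The inclusion of `SL(2, ℝ)` in `GL(2, ℂ)`. -/
def slToGL : SL(2, ℝ) →* GL (Fin 2) ℂ :=
  Matrix.SpecialLinearGroup.toGL.comp (Matrix.SpecialLinearGroup.map (algebraMap ℝ ℂ))

/-- The upper half plane. -/
def upperHol : HolSpace where
  Carrier := ℍ
  top := inferInstance
  IsHol U f := DifferentiableOn ℂ (f ∘ UpperHalfPlane.ofComplex) ((↑) '' U)

/-- The extended upper half plane `ℍ ∪ ℚ ∪ {∞}`, as a subset of the Riemann sphere. -/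
def HStar : Type :=
  {x : OnePoint ℂ // (∃ τ : ℍ, x = ((τ : ℂ) : OnePoint ℂ)) ∨
    (∃ q : ℚ, x = ((q : ℂ) : OnePoint ℂ)) ∨ x = OnePoint.infty}

namespace HStar

/-- A point of the upper half plane as a point of `ℍ ∪ ℚ ∪ {∞}`. -/
def ofUpper (τ : ℍ) : HStar := ⟨((τ : ℂ) : OnePoint ℂ), Or.inl ⟨τ, rfl⟩⟩

/-- A rational number as a point of `ℍ ∪ ℚ ∪ {∞}`. -/
def ofRat (q : ℚ) : HStar := ⟨((q : ℂ) : OnePoint ℂ), Or.inr (Or.inl ⟨q, rfl⟩)⟩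

/-- The point at infinity of `ℍ ∪ ℚ ∪ {∞}`. -/
def inf : HStar := ⟨OnePoint.infty, Or.inr (Or.inr rfl)⟩

/-- The horoball topology: neighbourhoods of `∞` contain a half plane `Im τ > M`, and
neighbourhoods of a rational number `q` contain an open disk in `ℍ` tangent to the real axis
at `q`. -/
instance : TopologicalSpace HStar where
  IsOpen U := IsOpen (ofUpper ⁻¹' U) ∧
    (inf ∈ U → ∃ M : ℝ, ∀ τ : ℍ, M < τ.im → ofUpper τ ∈ U) ∧
    ∀ q : ℚ, ofRat q ∈ U → ∃ r : ℝ, 0 < r ∧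
      ∀ τ : ℍ, dist (τ : ℂ) ((q : ℂ) + r * Complex.I) < r → ofUpper τ ∈ U
  isOpen_univ := ⟨isOpen_univ, fun _ => ⟨0, fun _ _ => trivial⟩,
    fun _ _ => ⟨1, one_pos, fun _ _ => trivial⟩⟩
  isOpen_inter U V hU hV := by
    refine ⟨hU.1.inter hV.1, fun h => ?_, fun q h => ?_⟩
    · obtain ⟨M, hM⟩ := hU.2.1 h.1
      obtain ⟨N, hN⟩ := hV.2.1 h.2
      exact ⟨max M N, fun τ hτ => ⟨hM τ (lt_of_le_of_lt (le_max_left _ _) hτ),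
        hN τ (lt_of_le_of_lt (le_max_right _ _) hτ)⟩⟩
    · obtain ⟨r, hr, hr'⟩ := hU.2.2 q h.1
      obtain ⟨s, hs, hs'⟩ := hV.2.2 q h.2
      have key : ∀ a b : ℝ, a ≤ b → ∀ τ : ℍ,
          dist (τ : ℂ) ((q : ℂ) + a * Complex.I) < a →
          dist (τ : ℂ) ((q : ℂ) + b * Complex.I) < b := by
        intro a b hab τ h
        have h1 : dist ((q : ℂ) + a * Complex.I) ((q : ℂ) + b * Complex.I) = b - a := by
          rw [dist_add_left, dist_eq_norm, ← sub_mul, norm_mul, Complex.norm_I, mul_one,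
            ← Complex.ofReal_sub, Complex.norm_real, Real.norm_eq_abs, abs_sub_comm,
            abs_of_nonneg (by linarith)]
        have h2 := dist_triangle (τ : ℂ) ((q : ℂ) + a * Complex.I) ((q : ℂ) + b * Complex.I)
        linarith
      exact ⟨min r s, lt_min hr hs, fun τ hτ =>
        ⟨hr' τ (key _ _ (min_le_left _ _) τ hτ), hs' τ (key _ _ (min_le_right _ _) τ hτ)⟩⟩
  isOpen_sUnion A hA := by
    refine ⟨?_, ?_, ?_⟩
    · rw [Set.preimage_sUnion]
      exact isOpen_biUnion fun U hU => (hA U hU).1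
    · rintro ⟨U, hU, h⟩
      obtain ⟨M, hM⟩ := (hA U hU).2.1 h
      exact ⟨M, fun τ hτ => ⟨U, hU, hM τ hτ⟩⟩
    · rintro q ⟨U, hU, h⟩
      obtain ⟨r, hr, hr'⟩ := (hA U hU).2.2 q h
      exact ⟨r, hr, fun τ hτ => ⟨U, hU, hr' τ hτ⟩⟩

/-- The functions on `ℍ ∪ ℚ ∪ {∞}` that are continuous, and holomorphic on `ℍ`. -/
def hol : HolSpace where
  Carrier := HStar
  top := inferInstance
  IsHol U f := ContinuousOn f U ∧ upperHol.IsHol (ofUpper ⁻¹' U) (f ∘ ofUpper)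

/-- The orbit relation of the Fricke group, acting by Möbius transformations. -/
def frickeSetoid (n : ℕ) : Setoid HStar where
  r x y := ∃ γ ∈ frickeGroup n, slToGL γ • x.1 = y.1
  iseqv :=
    { refl := fun x => ⟨1, one_mem _, by simp⟩
      symm := by
        rintro x y ⟨γ, hγ, h⟩
        exact ⟨γ⁻¹, inv_mem hγ, by rw [← h, map_inv, inv_smul_smul]⟩
      trans := by
        rintro x y z ⟨γ, hγ, h⟩ ⟨δ, hδ, h'⟩
        exact ⟨δ * γ, mul_mem hδ hγ, by rw [map_mul, mul_smul, h, h']⟩ }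

end HStar

/-- The Fricke modular curve `Γ₀(n)⁺ \ ℍ`. -/
def frickeCurve (n : ℕ) : HolSpace :=
  upperHol.quotient (MulAction.orbitRel (frickeGroup n) ℍ)

/-- The compactified Fricke modular curve `Γ₀(n)⁺ \ (ℍ ∪ ℚ ∪ {∞})`. -/
def frickeCurveCpt (n : ℕ) : HolSpace :=
  HStar.hol.quotient (HStar.frickeSetoid n)

/-! ### The Kähler moduli and its Baily-Borel compactification -/

namespace MarkedK3

variable (S : MarkedK3)

/-- The complex manifold `Ω⁺`: functions on an open set are holomorphic if, on the cone over it,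
they are locally restrictions of holomorphic functions on open subsets of `L_ℂ`. -/
def omegaHol : HolSpace where
  Carrier := S.OmegaPlus
  top := inferInstance
  IsHol U f := ∀ (v : cplx S.extNS) (hv : v ≠ 0)
    (hp : Projectivization.mk ℂ v hv ∈ S.OmegaPlus), (⟨_, hp⟩ : S.OmegaPlus) ∈ U →
    ∃ (N : Set (cplx S.extNS)) (F : cplx S.extNS → ℂ), IsOpen N ∧ v ∈ N ∧
      DifferentiableOn ℂ F N ∧
      ∀ w ∈ N, ∀ (hw : w ≠ 0) (hq : Projectivization.mk ℂ w hw ∈ S.OmegaPlus),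
        (⟨_, hq⟩ : S.OmegaPlus) ∈ U → F w = f ⟨_, hq⟩

/-- The rational closure `(Ω⁺)*` of `Ω⁺`: the union of `Ω⁺` and the rational isotropic lines. -/
def OmegaStar : Type := {p : ℙ ℂ (cplx S.extNS) // p ∈ S.OmegaPlus ∨ p ∈ S.isotropicLines}

/-- A point of `Ω⁺` as a point of `(Ω⁺)*`. -/
def ofOmega (p : S.OmegaPlus) : S.OmegaStar := ⟨p.1, Or.inl p.2⟩

/-- The horoball (Satake) topology on `(Ω⁺)*`: neighbourhoods of the line spanned by a nonzero
isotropic lattice vector `l` contain the set of all `ℂω ∈ Ω⁺` with `(ω, ω̄) > M |(ω, l)|²`, for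
some `M`. -/
instance : TopologicalSpace S.OmegaStar where
  IsOpen U := IsOpen (S.ofOmega ⁻¹' U) ∧
    ∀ x ∈ U, ∀ (l : S.extNS) (hl : l ≠ 0),
      latticeForm mukaiGram (l : MukaiIndex → ℤ) (l : MukaiIndex → ℤ) = 0 →
      x.1 = S.latticeLine l hl →
      ∃ M : ℝ, ∀ (v : cplx S.extNS) (hv : v ≠ 0)
        (hp : Projectivization.mk ℂ v hv ∈ S.OmegaPlus),
        M * ‖latticeForm mukaiGram (v : MukaiIndex → ℂ) (castVec (l : MukaiIndex → ℤ))‖ ^ 2 <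
          (latticeForm mukaiGram (v : MukaiIndex → ℂ) (star (v : MukaiIndex → ℂ))).re →
        S.ofOmega ⟨_, hp⟩ ∈ U
  isOpen_univ := ⟨isOpen_univ, fun _ _ _ _ _ _ => ⟨0, fun _ _ _ _ => trivial⟩⟩
  isOpen_inter U V hU hV := by
    refine ⟨hU.1.inter hV.1, fun x hx l hl h0 h => ?_⟩
    obtain ⟨M, hM⟩ := hU.2 x hx.1 l hl h0 h
    obtain ⟨N, hN⟩ := hV.2 x hx.2 l hl h0 h
    refine ⟨max M N, fun v hv hp hlt => ⟨hM v hv hp (lt_of_le_of_lt ?_ hlt),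
      hN v hv hp (lt_of_le_of_lt ?_ hlt)⟩⟩
    · exact mul_le_mul_of_nonneg_right (le_max_left _ _) (sq_nonneg _)
    · exact mul_le_mul_of_nonneg_right (le_max_right _ _) (sq_nonneg _)
  isOpen_sUnion A hA := by
    refine ⟨?_, ?_⟩
    · rw [Set.preimage_sUnion]
      exact isOpen_biUnion fun U hU => (hA U hU).1
    · rintro x ⟨U, hU, hx⟩ l hl h0 h
      obtain ⟨M, hM⟩ := (hA U hU).2 x hx l hl h0 h
      exact ⟨M, fun v hv hp hlt => ⟨U, hU, hM v hv hp hlt⟩⟩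

/-- The functions on `(Ω⁺)*` that are continuous, and holomorphic on `Ω⁺`. -/
def omegaStarHol : HolSpace where
  Carrier := S.OmegaStar
  top := inferInstance
  IsHol U f := ContinuousOn f U ∧ S.omegaHol.IsHol (S.ofOmega ⁻¹' U) (f ∘ S.ofOmega)

/-- The orbit relation of `Γ(S)⁺` on a set of points of `ℙ(L_ℂ)`. -/
def orbitSetoid (P : ℙ ℂ (cplx S.extNS) → Prop) : Setoid {p // P p} where
  r x y := ∃ γ ∈ S.GamPlus, S.act γ x.1 = y.1
  iseqv :=
    { refl := fun x => ⟨1, one_mem _, S.act_one _⟩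
      symm := by
        rintro x y ⟨γ, hγ, h⟩
        exact ⟨γ⁻¹, inv_mem hγ, by rw [← h, ← act_mul, inv_mul_cancel, act_one]⟩
      trans := by
        rintro x y z ⟨γ, hγ, h⟩ ⟨δ, hδ, h'⟩
        exact ⟨δ * γ, mul_mem hδ hγ, by rw [act_mul, h, h']⟩ }

/-- The orbit relation of `Γ(S)⁺` on `Ω⁺`. -/
def omegaSetoid : Setoid S.omegaHol.Carrier := S.orbitSetoid _

/-- The orbit relation of `Γ(S)⁺` on `(Ω⁺)*`. -/
def omegaStarSetoid : Setoid S.omegaStarHol.Carrier := S.orbitSetoid _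

/-- The Kähler moduli `𝒦(S) = Γ(S)⁺ \ Ω⁺`. -/
def kahlerModuli : HolSpace := S.omegaHol.quotient S.omegaSetoid

/-- The Baily-Borel compactification of `𝒦(S)` when the Picard number is one: the quotient of
`(Ω⁺)*` by `Γ(S)⁺`, with the sheaf of continuous functions that are holomorphic on `𝒦(S)`. -/
def kahlerModuliCpt : HolSpace := S.omegaStarHol.quotient S.omegaStarSetoid

/-- The tube domain map `τ ↦ ℂ(1, τH, nτ²)`, `∞ ↦ ℂ(0, 0, 1)`, on the Riemann sphere. -/
def tube (n : ℕ) (H : S.NS) (x : OnePoint ℂ) : ℙ ℂ (cplx S.extNS) :=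
  x.elim
    (Projectivization.mk ℂ (S.extVec H 0 0 1) (S.extVec_ne_zero_right H one_ne_zero _ _))
    (fun τ : ℂ => Projectivization.mk ℂ (S.extVec H 1 τ (n * τ ^ 2))
      (S.extVec_ne_zero_left H one_ne_zero _ _))

/-- The linear map from matrices of trace zero to `L_ℂ` sending
`a (0, 0; -2n, 0) + b (-1, 0; 0, 1) + c (0, 2; 0, 0)` to `(a, b H / (2n), c)`. -/
def ofTraceless (n : ℕ) (H : S.NS) (A : Matrix (Fin 2) (Fin 2) ℂ) : cplx S.extNS :=
  S.extVec H (-(A 1 0) / (2 * n)) (A 1 1 / (2 * n)) (A 0 1 / 2)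

/-- The isometry `g` is `ε • Ad(γ)`, where `Ad(γ)` is conjugation by `γ` on the matrices of trace
zero, transported to `L_ℂ`. -/
def IsAdjoint (n : ℕ) (H : S.NS) (γ : GL (Fin 2) ℂ) (ε : ℤˣ)
    (g : isometryGroup mukaiGram S.extNS) : Prop :=
  ∀ A : Matrix (Fin 2) (Fin 2) ℂ, A.trace = 0 →
    cplxAut S.extNS (g : S.extNS ≃ₗ[ℤ] S.extNS) (S.ofTraceless n H A) =
      (ε : ℤ) • S.ofTraceless n H
        ((γ : Matrix (Fin 2) (Fin 2) ℂ) * A * ((γ⁻¹ : GL (Fin 2) ℂ) : Matrix (Fin 2) (Fin 2) ℂ))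

end MarkedK3

/-! ### The Eichler order -/

/-- The Eichler order of level `n`: integral matrices whose lower left entry is divisible
by `n`. -/
def eichlerOrder (n : ℕ) : Subring (Matrix (Fin 2) (Fin 2) ℚ) where
  carrier := {A | ∃ a b c d : ℤ, A = !![(a : ℚ), b; n * c, d]}
  mul_mem' := by
    rintro _ _ ⟨a, b, c, d, rfl⟩ ⟨a', b', c', d', rfl⟩
    refine ⟨a * a' + b * (n * c'), a * b' + b * d', c * a' + d * c', n * c * b' + d * d', ?_⟩
    ext i j
    fin_cases i <;> fin_cases j <;>
      (simp [Matrix.mul_apply, Fin.sum_univ_two]; try ring)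
  one_mem' := ⟨1, 0, 0, 1, by ext i j; fin_cases i <;> fin_cases j <;> simp⟩
  add_mem' := by
    rintro _ _ ⟨a, b, c, d, rfl⟩ ⟨a', b', c', d', rfl⟩
    refine ⟨a + a', b + b', c + c', d + d', ?_⟩
    ext i j
    fin_cases i <;> fin_cases j <;> (simp; try ring)
  zero_mem' := ⟨0, 0, 0, 0, by ext i j; fin_cases i <;> fin_cases j <;> simp⟩
  neg_mem' := by
    rintro _ ⟨a, b, c, d, rfl⟩
    refine ⟨-a, -b, -c, -d, ?_⟩
    ext i j
    fin_cases i <;> fin_cases j <;> simp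

/-- The normalizer of the Eichler order in `GL(2, ℚ)`. -/
def eichlerNormalizer (n : ℕ) : Subgroup (GL (Fin 2) ℚ) where
  carrier := {γ | ∀ A : Matrix (Fin 2) (Fin 2) ℚ, (A ∈ eichlerOrder n ↔
    (γ : Matrix (Fin 2) (Fin 2) ℚ) * A * ((γ⁻¹ : GL (Fin 2) ℚ) : Matrix (Fin 2) (Fin 2) ℚ) ∈
      eichlerOrder n)}
  mul_mem' {γ δ} hγ hδ A := by
    refine ((hδ A).trans (hγ _)).trans ?_
    simp only [mul_inv_rev, Units.val_mul, mul_assoc]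
  one_mem' A := by simp
  inv_mem' {γ} hγ A := by
    refine Iff.trans ?_ (hγ _).symm
    simp only [inv_inv, mul_assoc, Units.mul_inv, mul_one, Units.mul_inv_cancel_left]

/-- The subgroup of `GL(2, ℚ)` generated by the scalars, `Γ₀(n)` and `(0, -1; n, 0)`. -/
def frickeGroupRat (n : ℕ) : Subgroup (GL (Fin 2) ℚ) :=
  Subgroup.closure
    ({γ | ∃ c : ℚ, (γ : Matrix (Fin 2) (Fin 2) ℚ) = c • 1} ∪
     {γ | ∃ g ∈ CongruenceSubgroup.Gamma0 n, (γ : Matrix (Fin 2) (Fin 2) ℚ) =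
        (g : Matrix (Fin 2) (Fin 2) ℤ).map (Int.cast : ℤ → ℚ)} ∪
     {γ | (γ : Matrix (Fin 2) (Fin 2) ℚ) = !![0, -1; (n : ℚ), 0]})

end

/-! Write `e = (1, 0, 0)`, `m = (0, H, 0)`, `f = (0, 0, 1)`. These form a basis of `L` with `(m, m)
= 2n`, `(e, f) = -1` and all other products zero. The vector `re + bm + sf` becomes the traceless
matrix `X = (-nb, s; -nr, nb)`, and these matrices satisfy the Clifford relation `XY + YX = n(x,
y)·1`. Hence conjugation by any matrix preserving this lattice is an isometry.

The lattice is the trace dual, up to the factor `n`, of the Eichler order inside the traceless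
matrices. Conversely, the order is spanned by lattice elements and the products `XY/n`. So a matrix
normalizes the order exactly when it and its inverse preserve the lattice. Every isometry of `L`
arises in this way up to sign: the images of `e` and `f` satisfy the relations of a pair of
elementary matrices, so they are conjugate to that pair, and the relations then determine the image
of `m` up to sign (`exists_conj_elementary`, `exists_eichlerNormalizer`).

For `Γ(S)` two facts are needed. First, a Hodge isometry of `T` is `±1`: `T` has odd rank 21, so an
isometry has an integral eigenvector with eigenvalue `±1`, and pairing with the period is injective
on `T` because `T ∩ L = 0`. Second, `L` and `T` are mutual orthogonal complements in a unimodular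
lattice, and `D_L` is generated by the class of `m / 2n`. Hence `γ ∈ Γ(S)` means `γ m ≡ ±m` modulo
`2nL` (`mem_Gam_iff`).

The arithmetic core is `mem_frickeGroupRat_of_actsBySign_one`. Scale a normalizing matrix of
positive determinant to a primitive integral one with determinant `D`. If it acts as `+1` on the
discriminant, then all products of two of its entries are divisible by `D`; a Bezout relation gives
`D = 1`, and the lower left entry is divisible by `n`. The sign `-1` is reduced to this case by the
Fricke involution, which sends `m` to `-m`.

For the geometry, `t(τ)` is the line of nilpotent matrices whose kernel is spanned by `(τ, 1)`, so
conjugation acts on it by Möbius transformations (`tube_smul`). Since `(v, v̄) = 4n (Im τ)²` on the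
section `v = (1, τH, nτ²)`, the period domain is the image of the two half planes, and the sign of
the determinant decides whether an isometry preserves `Ω⁺`. An integral isotropic vector `(a, bH,
c)` with `a ≠ 0` spans `t(b/a)`, and its pairing with the section is `-an(τ - b/a)²`. This turns the
horoballs of `Ω⁺` into disks tangent to the real axis, and everything descends to the quotients by
equivariance. -/

noncomputable section

/-! ### Bilinear forms with integral Gram matrix and their complexification -/

section Forms

variable {κ : Type} [Fintype κ] {R : Type} [CommRing R] (G : Matrix κ κ ℤ)

theorem latticeForm_add_left (x y z : κ → R) :
    latticeForm G (x + y) z = latticeForm G x z + latticeForm G y z := by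
  simp [latticeForm]

theorem latticeForm_add_right (x y z : κ → R) :
    latticeForm G x (y + z) = latticeForm G x y + latticeForm G x z := by
  simp [latticeForm, Matrix.mulVec_add]

theorem latticeForm_smul_left (c : R) (x y : κ → R) :
    latticeForm G (c • x) y = c * latticeForm G x y := by
  simp [latticeForm]

theorem latticeForm_smul_right (c : R) (x y : κ → R) :
    latticeForm G x (c • y) = c * latticeForm G x y := by
  simp [latticeForm, Matrix.mulVec_smul]

theorem latticeForm_zero_left (y : κ → R) : latticeForm G 0 y = 0 := by
  simp [latticeForm]

theorem latticeForm_zero_right (x : κ → R) : latticeForm G x 0 = 0 := by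
  simp [latticeForm]

theorem latticeForm_sub_left (x y z : κ → R) :
    latticeForm G (x - y) z = latticeForm G x z - latticeForm G y z := by
  simp [latticeForm]

theorem latticeForm_sub_right (x y z : κ → R) :
    latticeForm G x (y - z) = latticeForm G x y - latticeForm G x z := by
  simp [latticeForm, Matrix.mulVec_sub]

theorem latticeForm_comm {G : Matrix κ κ ℤ} (hG : G.IsSymm) (x y : κ → R) :
    latticeForm G x y = latticeForm G y x := by
  have h : (G.map (Int.cast : ℤ → R)).transpose = G.map (Int.cast : ℤ → R) := by
    rw [← Matrix.transpose_map, hG]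
  rw [latticeForm, latticeForm, Matrix.dotProduct_mulVec, ← Matrix.mulVec_transpose, h,
    dotProduct_comm]

theorem latticeForm_castVec (x y : κ → ℤ) :
    latticeForm G (castVec x) (castVec y) = ((latticeForm G x y : ℤ) : ℂ) := by
  simp [latticeForm, castVec, dotProduct, Matrix.mulVec]

/-- The form as a linear functional in the second variable. -/
def latticeFunctional (x : κ → R) : (κ → R) →ₗ[R] R where
  toFun y := latticeForm G x y
  map_add' y z := latticeForm_add_right G x y z
  map_smul' c y := latticeForm_smul_right G c x y

variable {G} in
theorem eq_zero_of_latticeForm_eq_zero [DecidableEq κ] (hG : IsUnit G.det) {x : κ → ℤ}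
    (h : ∀ y, latticeForm G y x = 0) : x = 0 := by
  have h1 : G.mulVec x = 0 := by
    ext i
    have := h (Pi.single i 1)
    simpa [latticeForm, show G.map (Int.cast : ℤ → ℤ) = G from by ext; simp] using this
  have h2 : G⁻¹.mulVec (G.mulVec x) = x := by
    rw [Matrix.mulVec_mulVec, Matrix.nonsing_inv_mul _ hG, Matrix.one_mulVec]
  rw [← h2, h1, Matrix.mulVec_zero]

/-- Both sides are bilinear over `ℂ`, and `L` spans `L_ℂ`, so it suffices to compare them on lattice
vectors. -/
theorem latticeForm_cplxAut (L : Submodule ℤ (κ → ℤ)) (g : isometryGroup G L) (v w : cplx L) :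
    latticeForm G (cplxAut L (g : L ≃ₗ[ℤ] L) v : κ → ℂ) (cplxAut L (g : L ≃ₗ[ℤ] L) w : κ → ℂ) =
      latticeForm G (v : κ → ℂ) (w : κ → ℂ) := by
  obtain ⟨z, rfl⟩ := (cplxEquiv L).surjective v
  obtain ⟨z', rfl⟩ := (cplxEquiv L).surjective w
  have e : ∀ (c : ℂ) (x : L), cplxEquiv L (c ⊗ₜ x) = c • toCplx L x := tensorToCplx_tmul L
  induction z with
  | zero => simp [latticeForm_zero_left]
  | add a b ha hb => simp only [map_add, Submodule.coe_add, latticeForm_add_left, ha, hb]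
  | tmul c x =>
    induction z' with
    | zero => simp [latticeForm_zero_right]
    | add a b ha hb => simp only [map_add, Submodule.coe_add, latticeForm_add_right, ha, hb]
    | tmul d y =>
      simp only [e, map_smul, cplxAut_toCplx, Submodule.coe_smul, latticeForm_smul_left,
        latticeForm_smul_right]
      have h : ∀ x : L, (toCplx L x : κ → ℂ) = castVec (x : κ → ℤ) := fun _ => rfl
      rw [h, h, h, h, latticeForm_castVec, latticeForm_castVec, g.2 x y]

theorem cplx_ext {L : Submodule ℤ (κ → ℤ)} {V : Type} [AddCommGroup V] [Module ℂ V]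
    {f g : cplx L →ₗ[ℂ] V} (h : ∀ x : L, f (toCplx L x) = g (toCplx L x)) : f = g := by
  ext v
  obtain ⟨z, rfl⟩ := (cplxEquiv L).surjective v
  have e : ∀ (c : ℂ) (x : L), cplxEquiv L (c ⊗ₜ x) = c • toCplx L x := tensorToCplx_tmul L
  induction z with
  | zero => simp
  | add a b ha hb => simp only [map_add, ha, hb]
  | tmul c x => simp only [e, map_smul, h]

end Forms

/-! ### Symmetry and unimodularity of the K3 and Mukai lattices -/

theorem k3Gram_isSymm : k3Gram.IsSymm := by
  have h : hyperbolicGram.IsSymm := by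
    unfold Matrix.IsSymm; decide
  have e : (-CartanMatrix.E₈).IsSymm := CartanMatrix.E₈_isSymm.neg
  have z : ∀ {m n : Type}, (0 : Matrix m n ℤ).transpose = 0 := Matrix.transpose_zero
  exact e.fromBlocks z (e.fromBlocks z (h.fromBlocks z (h.fromBlocks z h)))

theorem mukaiGram_isSymm : mukaiGram.IsSymm := by
  have h : (-hyperbolicGram).IsSymm := by
    unfold Matrix.IsSymm; decide
  exact k3Gram_isSymm.fromBlocks Matrix.transpose_zero h

theorem isUnit_det_k3Gram : IsUnit k3Gram.det := by
  have h : hyperbolicGram.det = -1 := by decide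
  have e : (-CartanMatrix.E₈).det = 1 := by
    rw [Matrix.det_neg, CartanMatrix.E₈_det]; decide
  simp [k3Gram, Matrix.det_fromBlocks_zero₂₁, h, e]

theorem isUnit_det_mukaiGram : IsUnit mukaiGram.det := by
  have h : (-hyperbolicGram).det = -1 := by decide
  rw [mukaiGram, Matrix.det_fromBlocks_zero₂₁, h]
  exact isUnit_det_k3Gram.mul isUnit_one.neg

theorem latticeForm_mukaiVec {R : Type} [CommRing R] (r s r' s' : R) (D D' : K3Index → R) :
    latticeForm mukaiGram (mukaiVec r D s) (mukaiVec r' D' s') =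
      latticeForm k3Gram D D' - r * s' - s * r' := by
  have h : (mukaiGram.map (Int.cast : ℤ → R)) = Matrix.fromBlocks
      (k3Gram.map (Int.cast : ℤ → R)) 0 0 !![0, -1; -1, 0] := by
    rw [mukaiGram, Matrix.fromBlocks_map]
    congr 1
    · ext; simp
    · ext; simp
    · ext i j; fin_cases i <;> fin_cases j <;> simp [hyperbolicGram]
  rw [latticeForm, h, mukaiVec, mukaiVec, Matrix.fromBlocks_mulVec, sumElim_dotProduct_sumElim]
  simp [latticeForm, Matrix.mulVec, dotProduct, Fin.sum_univ_two]
  ring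

theorem mukaiVec_eta {R : Type} (v : MukaiIndex → R) :
    mukaiVec (v (Sum.inr 0)) (v ∘ Sum.inl) (v (Sum.inr 1)) = v := by
  ext i
  rcases i with i | i
  · rfl
  · fin_cases i <;> rfl

/-! ### The extended Néron-Severi lattice in coordinates -/

namespace MarkedK3

/-- The class `H` generates the Néron-Severi lattice, has degree `2n` and is positive on the ample
class. -/
structure IsPolarization (S : MarkedK3) (n : ℕ) (H : S.NS) : Prop where
  span_eq_top : Submodule.span ℤ {H} = ⊤
  degree : latticeForm k3Gram (H : K3Index → ℤ) (H : K3Index → ℤ) = 2 * n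
  pos : 0 < latticeForm k3Gram (H : K3Index → ℤ) S.ample

/-- The vector `(r, bH, s)` of the extended Néron-Severi lattice. -/
def latVec (S : MarkedK3) (H : S.NS) (r b s : ℤ) : S.extNS :=
  ⟨mukaiVec r (b • (H : K3Index → ℤ)) s, S.mukaiVec_mem_extNS (S.NS.smul_mem b H.2) r s⟩

variable {S : MarkedK3} {n : ℕ} {H : S.NS}

/-- `NS(S)` is saturated, being the kernel of a homomorphism to the torsion-free group `ℂ`. -/
theorem mem_NS_of_smul_mem {d : ℤ} (hd : d ≠ 0) {x : K3Index → ℤ} (h : d • x ∈ S.NS) :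
    x ∈ S.NS := by
  have h' : latticeForm k3Gram (castVec (d • x)) S.period = 0 := h
  have e : castVec (d • x) = (d : ℂ) • castVec x := by ext i; simp [castVec]
  rw [e, latticeForm_smul_left] at h'
  exact (mul_eq_zero.1 h').resolve_left (by exact_mod_cast hd)

theorem toCplx_latVec (r b s : ℤ) :
    toCplx S.extNS (S.latVec H r b s) = S.extVec H r b s := by
  ext i
  rcases i with i | i
  · simp [toCplx, castVec, latVec, extVec, mukaiVec]
  · fin_cases i <;> simp [toCplx, castVec, latVec, extVec, mukaiVec]

theorem latVec_add (r b s r' b' s' : ℤ) :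
    S.latVec H r b s + S.latVec H r' b' s' = S.latVec H (r + r') (b + b') (s + s') := by
  ext i
  rcases i with i | i
  · simp [latVec, mukaiVec, add_mul]
  · fin_cases i <;> simp [latVec, mukaiVec]

theorem latVec_smul (k r b s : ℤ) :
    k • S.latVec H r b s = S.latVec H (k * r) (k * b) (k * s) := by
  ext i
  rcases i with i | i
  · simp [latVec, mukaiVec, mul_assoc]
  · fin_cases i <;> simp [latVec, mukaiVec]

theorem extVec_add (r c s r' c' s' : ℂ) :
    S.extVec H r c s + S.extVec H r' c' s' = S.extVec H (r + r') (c + c') (s + s') := by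
  ext i
  rcases i with i | i
  · simp [extVec, mukaiVec, add_mul]
  · fin_cases i <;> simp [extVec, mukaiVec]

theorem extVec_smul (k r c s : ℂ) :
    k • S.extVec H r c s = S.extVec H (k * r) (k * c) (k * s) := by
  ext i
  rcases i with i | i
  · simp [extVec, mukaiVec, mul_assoc]
  · fin_cases i <;> simp [extVec, mukaiVec]

theorem star_extVec (r c s : ℂ) :
    star (S.extVec H r c s : MukaiIndex → ℂ) = S.extVec H (star r) (star c) (star s) := by
  ext i
  rcases i with i | i
  · simp [extVec, mukaiVec, castVec]
  · fin_cases i <;> simp [extVec, mukaiVec]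

namespace IsPolarization

theorem exists_smul (h : S.IsPolarization n H) {x : K3Index → ℤ} (hx : x ∈ S.NS) :
    ∃ b : ℤ, x = b • (H : K3Index → ℤ) := by
  have : (⟨x, hx⟩ : S.NS) ∈ Submodule.span ℤ {H} := h.span_eq_top ▸ Submodule.mem_top
  obtain ⟨b, hb⟩ := Submodule.mem_span_singleton.1 this
  exact ⟨b, (congrArg Subtype.val hb).symm⟩

/-- With `h = kH` for the ample class, `(H, h) = 2nk` and `(h, h) = 2nk²` are both positive, which
forces `n` and `k` to be positive. -/
theorem exists_ample_eq (h : S.IsPolarization n H) :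
    ∃ k : ℤ, 0 < k ∧ 0 < n ∧ S.ample = k • (H : K3Index → ℤ) := by
  obtain ⟨k, hk⟩ := h.exists_smul S.ample_algebraic
  have h1 := h.pos
  have h2 := S.ample_positive
  rw [hk, latticeForm_smul_right] at h1
  rw [hk, latticeForm_smul_right, latticeForm_smul_left] at h2
  rw [h.degree] at h1 h2
  have hn : n ≠ 0 := by rintro rfl; simp at h1
  refine ⟨k, ?_, Nat.pos_of_ne_zero hn, hk⟩
  by_contra hk'
  have : (0 : ℤ) ≤ 2 * n := by positivity
  nlinarith

theorem n_pos (h : S.IsPolarization n H) : 0 < n := by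
  obtain ⟨_, _, hn, _⟩ := h.exists_ample_eq
  exact hn

theorem ne_zero (h : S.IsPolarization n H) : (H : K3Index → ℤ) ≠ 0 := by
  intro h0
  have := h.pos
  rw [h0, latticeForm_zero_left] at this
  exact this.false

theorem exists_latVec (h : S.IsPolarization n H) (x : S.extNS) :
    ∃ r b s : ℤ, x = S.latVec H r b s := by
  obtain ⟨b, hb⟩ := h.exists_smul (show (x : MukaiIndex → ℤ) ∘ Sum.inl ∈ S.NS from x.2)
  refine ⟨(x : MukaiIndex → ℤ) (Sum.inr 0), b, (x : MukaiIndex → ℤ) (Sum.inr 1), ?_⟩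
  refine Subtype.ext (Eq.trans (mukaiVec_eta _).symm ?_)
  rw [hb]
  rfl

theorem exists_extVec (h : S.IsPolarization n H) (v : cplx S.extNS) :
    ∃ r c s : ℂ, v = S.extVec H r c s := by
  obtain ⟨z, rfl⟩ := (cplxEquiv S.extNS).surjective v
  induction z with
  | zero => exact ⟨0, 0, 0, by
      have := extVec_smul (S := S) (H := H) 0 0 0 0
      simp only [zero_smul, mul_zero] at this
      rw [map_zero, ← this]⟩
  | add a b ha hb =>
    obtain ⟨r, c, s, e⟩ := ha
    obtain ⟨r', c', s', e'⟩ := hb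
    exact ⟨_, _, _, by rw [map_add, e, e', extVec_add]⟩
  | tmul c x =>
    obtain ⟨r, b, s, rfl⟩ := h.exists_latVec x
    exact ⟨_, _, _, by
      rw [← extVec_smul, ← toCplx_latVec]; exact tensorToCplx_tmul _ _ _⟩

theorem form_extVec (h : S.IsPolarization n H) (r c s r' c' s' : ℂ) :
    latticeForm mukaiGram (S.extVec H r c s : MukaiIndex → ℂ) (S.extVec H r' c' s') =
      2 * n * c * c' - r * s' - s * r' := by
  rw [extVec, extVec, latticeForm_mukaiVec, latticeForm_smul_left, latticeForm_smul_right,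
    latticeForm_castVec, h.degree]
  push_cast
  ring

theorem form_latVec (h : S.IsPolarization n H) (r b s r' b' s' : ℤ) :
    latticeForm mukaiGram (S.latVec H r b s : MukaiIndex → ℤ) (S.latVec H r' b' s') =
      2 * n * b * b' - r * s' - s * r' := by
  rw [latVec, latVec, latticeForm_mukaiVec, latticeForm_smul_left, latticeForm_smul_right,
    h.degree]
  ring

theorem extVec_inj (h : S.IsPolarization n H) {r c s r' c' s' : ℂ} :
    S.extVec H r c s = S.extVec H r' c' s' ↔ r = r' ∧ c = c' ∧ s = s' := by
  refine ⟨fun e => ?_, by rintro ⟨rfl, rfl, rfl⟩; rfl⟩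
  have hn : (n : ℂ) ≠ 0 := by exact_mod_cast h.n_pos.ne'
  have h1 := h.form_extVec r c s 0 0 1
  have h2 := h.form_extVec r c s 1 0 0
  have h3 := h.form_extVec r c s 0 1 0
  rw [e, h.form_extVec] at h1 h2 h3
  simp only [mul_zero, mul_one, zero_sub, sub_zero, neg_inj] at h1 h2 h3
  exact ⟨h1.symm, (mul_left_cancel₀ (by simpa using hn) h3).symm, h2.symm⟩

theorem latVec_inj (h : S.IsPolarization n H) {r b s r' b' s' : ℤ} :
    S.latVec H r b s = S.latVec H r' b' s' ↔ r = r' ∧ b = b' ∧ s = s' := by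
  refine ⟨fun e => ?_, by rintro ⟨rfl, rfl, rfl⟩; rfl⟩
  have := congrArg (toCplx S.extNS) e
  rw [toCplx_latVec, toCplx_latVec, h.extVec_inj] at this
  exact_mod_cast this

/-- A primitive vector of a unimodular lattice pairs to `1` with some vector. If `d` generates the
ideal of values `(H, ·)`, inverting the Gram matrix shows that `H` is divisible by `d`. The quotient
lies in `NS(S) = ℤH` by saturation, so `d` is a unit. -/
theorem exists_form_eq_one (h : S.IsPolarization n H) :
    ∃ D : K3Index → ℤ, latticeForm k3Gram (H : K3Index → ℤ) D = 1 := by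
  obtain ⟨d, hd⟩ := (IsPrincipalIdealRing.principal
    (LinearMap.range (latticeFunctional k3Gram (H : K3Index → ℤ)))).principal
  have hdvd : ∀ y, d ∣ latticeForm k3Gram (H : K3Index → ℤ) y := fun y => by
    have : latticeForm k3Gram (H : K3Index → ℤ) y ∈
      LinearMap.range (latticeFunctional k3Gram (H : K3Index → ℤ)) := ⟨y, rfl⟩
    rw [hd] at this
    exact Ideal.mem_span_singleton.1 this
  choose q hq using hdvd
  set w : K3Index → ℤ := fun i => q (Pi.single i 1)
  have hw : (k3Gram.mulVec (H : K3Index → ℤ)) = d • w := by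
    ext i
    have h1 := hq (Pi.single i 1)
    rw [latticeForm_comm k3Gram_isSymm] at h1
    simpa [latticeForm, show k3Gram.map (Int.cast : ℤ → ℤ) = k3Gram from by ext; simp] using h1
  have hH : (H : K3Index → ℤ) = d • (k3Gram⁻¹.mulVec w) := by
    rw [← Matrix.mulVec_smul, ← hw, Matrix.mulVec_mulVec,
      Matrix.nonsing_inv_mul _ isUnit_det_k3Gram, Matrix.one_mulVec]
  have hd0 : d ≠ 0 := by
    rintro rfl
    rw [zero_smul] at hH
    exact h.ne_zero hH
  obtain ⟨m, hm⟩ := h.exists_smul (mem_NS_of_smul_mem hd0 (hH ▸ H.2))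
  rw [hm, smul_smul] at hH
  have h2 : (1 - d * m) • (H : K3Index → ℤ) = 0 := by
    rw [sub_smul, one_smul, ← hH, sub_self]
  have h3 : d * m = 1 := by
    rcases smul_eq_zero.1 h2 with h2 | h2
    · linarith
    · exact absurd h2 h.ne_zero
  have h4 : (1 : ℤ) ∈ LinearMap.range (latticeFunctional k3Gram (H : K3Index → ℤ)) := by
    rw [hd]
    exact Ideal.mem_span_singleton.2 ⟨m, h3.symm⟩
  exact h4

/-! ### The transcendental lattice -/

theorem mem_transc (h : S.IsPolarization n H) {y : MukaiIndex → ℤ} :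
    y ∈ S.transc ↔ y (Sum.inr 0) = 0 ∧ y (Sum.inr 1) = 0 ∧
      latticeForm k3Gram (H : K3Index → ℤ) (y ∘ Sum.inl) = 0 := by
  have key : ∀ r b s : ℤ, latticeForm mukaiGram (S.latVec H r b s : MukaiIndex → ℤ) y =
      b * latticeForm k3Gram (H : K3Index → ℤ) (y ∘ Sum.inl) - r * y (Sum.inr 1)
        - s * y (Sum.inr 0) := fun r b s => by
    conv_lhs => rw [← mukaiVec_eta y, latVec]
    rw [latticeForm_mukaiVec, latticeForm_smul_left]
  constructor
  · intro hy
    have h1 := hy _ (S.latVec H 1 0 0).2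
    have h2 := hy _ (S.latVec H 0 1 0).2
    have h3 := hy _ (S.latVec H 0 0 1).2
    rw [key] at h1 h2 h3
    refine ⟨by linarith, by linarith, by linarith⟩
  · rintro ⟨h1, h2, h3⟩ x hx
    obtain ⟨r, b, s, e⟩ := h.exists_latVec ⟨x, hx⟩
    rw [show x = (S.latVec H r b s : MukaiIndex → ℤ) from congrArg Subtype.val e, key, h1, h2, h3]
    simp

theorem projection_mem_transc (h : S.IsPolarization n H) (x : K3Index → ℤ) :
    mukaiVec 0 ((2 * n : ℤ) • x - latticeForm k3Gram (H : K3Index → ℤ) x • (H : K3Index → ℤ)) 0 ∈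
      S.transc := by
  rw [h.mem_transc]
  refine ⟨rfl, rfl, ?_⟩
  change latticeForm k3Gram (H : K3Index → ℤ) (_ - _) = 0
  rw [latticeForm_sub_right, latticeForm_smul_right, latticeForm_smul_right, h.degree]
  ring

/-- After multiplication by `2n` the orthogonal projections to `T` and `L` become integral. The next
lemmas use this splitting to pass between the whole lattice and the two summands. -/
theorem smul_eq_projection_add (x : MukaiIndex → ℤ) :
    (2 * n : ℤ) • x = mukaiVec 0 ((2 * n : ℤ) • (x ∘ Sum.inl) -
        latticeForm k3Gram (H : K3Index → ℤ) (x ∘ Sum.inl) • (H : K3Index → ℤ)) 0 +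
      (S.latVec H (2 * n * x (Sum.inr 0)) (latticeForm k3Gram (H : K3Index → ℤ) (x ∘ Sum.inl))
        (2 * n * x (Sum.inr 1)) : MukaiIndex → ℤ) := by
  ext i
  rcases i with i | i
  · simp [latVec, mukaiVec]
  · fin_cases i <;> simp [latVec, mukaiVec]

theorem transc_nondegenerate (h : S.IsPolarization n H) {y : MukaiIndex → ℤ} (hy : y ∈ S.transc)
    (hy' : ∀ t ∈ S.transc, latticeForm mukaiGram t y = 0) : y = 0 := by
  apply eq_zero_of_latticeForm_eq_zero isUnit_det_mukaiGram
  intro x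
  have h1 : (2 * n : ℤ) * latticeForm mukaiGram x y = 0 := by
    rw [← latticeForm_smul_left, smul_eq_projection_add (H := H) x, latticeForm_add_left,
      hy' _ (h.projection_mem_transc _), hy _ (Subtype.coe_prop _), add_zero]
  have := h.n_pos
  rcases mul_eq_zero.1 h1 with h1 | h1
  · omega
  · exact h1

/-- The double orthogonal complement of `L` is `L` again: the component of `2nv` in `T` is
orthogonal to `T`, hence zero, so `2nv ∈ L`, and saturation removes the factor. -/
theorem mem_extNS_of_orthogonal (h : S.IsPolarization n H) {v : MukaiIndex → ℤ}
    (hv : ∀ t ∈ S.transc, latticeForm mukaiGram t v = 0) : v ∈ S.extNS := by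
  have hn : (2 * n : ℤ) ≠ 0 := by have := h.n_pos; omega
  have h0 := h.transc_nondegenerate (h.projection_mem_transc (v ∘ Sum.inl)) fun t ht => by
    have h1 := congrArg (latticeForm mukaiGram t) (smul_eq_projection_add (n := n) (H := H) v)
    rw [latticeForm_smul_right, hv t ht, latticeForm_add_right,
      latticeForm_comm mukaiGram_isSymm t (S.latVec H _ _ _), ht _ (Subtype.coe_prop _)] at h1
    linarith
  have h1 := congrArg (LinearMap.funLeft ℤ ℤ Sum.inl) h0
  have h2 : (2 * n : ℤ) • (v ∘ Sum.inl) =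
      latticeForm k3Gram (H : K3Index → ℤ) (v ∘ Sum.inl) • (H : K3Index → ℤ) :=
    sub_eq_zero.1 h1
  exact mem_NS_of_smul_mem hn (h2 ▸ S.NS.smul_mem _ H.2)

theorem period_mem_cplx_transc (h : S.IsPolarization n H) :
    mukaiVec 0 S.period 0 ∈ cplx S.transc := by
  have hn : (2 * n : ℂ) ≠ 0 := by
    have := h.n_pos.ne'
    simpa using this
  -- `P` is `2n` times the orthogonal projection to `H^⊥`. It sends basis vectors into `T`, and it
  -- multiplies the period by `2n` because `(H, ω) = 0`.
  let P : (K3Index → ℂ) →ₗ[ℂ] (MukaiIndex → ℂ) :=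
    { toFun := fun v => mukaiVec 0 ((2 * n : ℂ) • v -
        latticeForm k3Gram (castVec (H : K3Index → ℤ)) v • castVec (H : K3Index → ℤ)) 0
      map_add' := fun v w => by
        ext i
        rcases i with i | i
        · simp [mukaiVec, latticeForm_add_right]; ring
        · fin_cases i <;> simp [mukaiVec]
      map_smul' := fun k v => by
        ext i
        rcases i with i | i
        · simp [mukaiVec, latticeForm_smul_right]; ring
        · fin_cases i <;> simp [mukaiVec] }
  have hP : ∀ v, P v ∈ cplx S.transc := fun v => by
    rw [pi_eq_sum_univ' v, map_sum]
    refine Submodule.sum_mem _ fun i _ => ?_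
    rw [map_smul]
    refine Submodule.smul_mem _ _ (Submodule.subset_span
      ⟨_, h.projection_mem_transc (Pi.single i 1), ?_⟩)
    have e : (Pi.single i 1 : K3Index → ℂ) = castVec (Pi.single i 1) := by
      ext j
      simp [castVec, Pi.single_apply]
    rw [e]
    ext j
    rcases j with j | j
    · simp [P, mukaiVec, castVec]
      exact Or.inl (latticeForm_castVec _ _ _).symm
    · fin_cases j <;> simp [P, mukaiVec, castVec]
  have h1 : mukaiVec 0 S.period 0 = (2 * n : ℂ)⁻¹ • P S.period := by
    have hH : latticeForm k3Gram (castVec (H : K3Index → ℤ)) S.period = 0 := H.2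
    ext i
    rcases i with i | i
    · simp only [mukaiVec, P, LinearMap.coe_mk, AddHom.coe_mk, hH, Pi.smul_apply, Sum.elim_inl,
        zero_smul, sub_zero, smul_eq_mul]
      rw [inv_mul_cancel_left₀ hn]
    · fin_cases i <;> simp [P, mukaiVec]
  rw [h1]
  exact Submodule.smul_mem _ _ (hP _)

/-- `T` is the kernel of the functional `(H, ·)` on a lattice of rank 22, and this functional is
onto `ℤ`. What matters later is that 21 is odd. -/
theorem finrank_transc (h : S.IsPolarization n H) : Module.finrank ℤ S.transc = 21 := by
  let f : S.transc →ₗ[ℤ] (K3Index → ℤ) :=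
    (LinearMap.funLeft ℤ ℤ Sum.inl).comp S.transc.subtype
  have hf : Function.Injective f := by
    rw [injective_iff_map_eq_zero]
    rintro ⟨y, hy⟩ e
    have h1 := h.mem_transc.1 hy
    apply Subtype.ext
    ext i
    rcases i with i | i
    · exact congrFun e i
    · fin_cases i
      · exact h1.1
      · exact h1.2.1
  have hr : LinearMap.range f = LinearMap.ker (latticeFunctional k3Gram (H : K3Index → ℤ)) := by
    ext x
    constructor
    · rintro ⟨y, rfl⟩
      exact (h.mem_transc.1 y.2).2.2
    · intro hx
      exact ⟨⟨mukaiVec 0 x 0, h.mem_transc.2 ⟨rfl, rfl, hx⟩⟩, rfl⟩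
  have hs : LinearMap.range (latticeFunctional k3Gram (H : K3Index → ℤ)) = ⊤ := by
    obtain ⟨D, hD⟩ := h.exists_form_eq_one
    exact (Ideal.eq_top_iff_one _).2 ⟨D, hD⟩
  have := Submodule.finrank_quotient_add_finrank
    (LinearMap.ker (latticeFunctional k3Gram (H : K3Index → ℤ)))
  rw [(latticeFunctional k3Gram (H : K3Index → ℤ)).quotKerEquivRange.finrank_eq, hs, ← hr,
    LinearMap.finrank_range_of_inj hf, finrank_top] at this
  simp at this
  omega

end IsPolarization

end MarkedK3

/-! ### Hodge isometries and the action on discriminant groups -/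

/-- An isometry of a nondegenerate lattice of odd rank has `1` or `-1` as an eigenvalue. -/
theorem exists_eigenvector_of_odd_finrank {M : Type*} [AddCommGroup M] [Module.Free ℤ M]
    [Module.Finite ℤ M] (hM : Odd (Module.finrank ℤ M)) (B : LinearMap.BilinForm ℤ M)
    (hB : B.SeparatingLeft) (f : M →ₗ[ℤ] M) (hf : ∀ x y, B (f x) (f y) = B x y) :
    ∃ (δ : ℤˣ) (x : M), x ≠ 0 ∧ f x = (δ : ℤ) • x := by
  set b := Module.finBasis ℤ M
  set A := LinearMap.BilinForm.toMatrix b B with hA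
  have hdet : A.det ≠ 0 := (LinearMap.BilinForm.nondegenerate_iff_det_ne_zero b).1
    (LinearMap.BilinForm.Nondegenerate.ofSeparatingLeft hB)
  set F := LinearMap.toMatrix b b f with hF
  have h1 : F.transpose * A * F = A := by
    have h := LinearMap.BilinForm.toMatrix_comp b b B f f
    rw [← h]
    congr 1
    ext x y
    exact hf x y
  have h2 : F.det * F.det = 1 := by
    have h := congrArg Matrix.det h1
    rw [Matrix.det_mul, Matrix.det_mul, Matrix.det_transpose] at h
    have : (F.det * F.det - 1) * A.det = 0 := by linear_combination h
    rcases mul_eq_zero.1 this with h | h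
    · linarith
    · exact absurd h hdet
  set d := F.det
  -- The eigenvalue is the determinant `d = ±1`. Taking determinants in this identity, in odd rank,
  -- gives `d · det A · det(F - d) = -d · det A · det(F - d)`, so `det(F - d) = 0`.
  have h3 : F.transpose * A * (F - d • 1) = (-d) • ((F - d • 1).transpose * A) := by
    rw [mul_sub, h1, Matrix.transpose_sub, sub_mul, Matrix.transpose_smul, Matrix.transpose_one,
      mul_smul_comm, mul_one, smul_mul_assoc, one_mul, smul_sub, smul_smul, neg_mul, h2]
    module
  have h4 : (F - d • 1).det = 0 := by
    have h := congrArg Matrix.det h3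
    rw [Matrix.det_mul, Matrix.det_mul, Matrix.det_smul, Matrix.det_mul, Matrix.det_transpose,
      Matrix.det_transpose, Fintype.card_fin, hM.neg_pow] at h
    have hd : d ^ Module.finrank ℤ M = d := by
      obtain ⟨k, hk⟩ := hM
      rw [hk, pow_succ, pow_mul, pow_two, h2, one_pow, one_mul]
    rw [hd] at h
    have : (2 * d * A.det) * (F - d • 1).det = 0 := by linear_combination h
    have hd0 : d ≠ 0 := by rintro e; rw [e] at h2; simp at h2
    exact (mul_eq_zero.1 this).resolve_left (mul_ne_zero (mul_ne_zero two_ne_zero hd0) hdet)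
  have h5 : LinearMap.det (f - d • LinearMap.id) = 0 := by
    rw [← LinearMap.det_toMatrix b, map_sub, map_smul, LinearMap.toMatrix_id]
    exact h4
  obtain ⟨x, hx, hx0⟩ := Submodule.exists_mem_ne_zero_of_ne_bot
    (LinearMap.bot_lt_ker_of_det_eq_zero h5).ne'
  exact ⟨⟨d, d, h2, h2⟩, x, hx0, by simpa [sub_eq_zero] using hx⟩

/-- Multiplication by a sign, as an isometry. -/
def signIsometry {κ : Type} [Fintype κ] (G : Matrix κ κ ℤ) (L : Submodule ℤ (κ → ℤ)) (δ : ℤˣ) :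
    isometryGroup G L :=
  ⟨LinearEquiv.smulOfUnit δ, fun x y => by
    have h : ∀ z : L, ((LinearEquiv.smulOfUnit δ : L ≃ₗ[ℤ] L) z : κ → ℤ) =
      (δ : ℤ) • (z : κ → ℤ) := fun _ => rfl
    rw [h, h, latticeForm_smul_left, latticeForm_smul_right, ← mul_assoc, ← Units.val_mul,
      Int.units_mul_self]
    simp⟩

section Glue

variable {κ : Type} [Fintype κ] {G : Matrix κ κ ℤ} {L : Submodule ℤ (κ → ℤ)}

theorem signIsometry_apply (δ : ℤˣ) (x : L) :
    (signIsometry G L δ : L ≃ₗ[ℤ] L) x = (δ : ℤ) • x := rfl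

theorem discRep_mk (g : isometryGroup G L) (φ : Module.Dual ℤ L) :
    discRep G L g (Submodule.Quotient.mk φ) = Submodule.Quotient.mk
      (φ ∘ₗ ((g⁻¹ : isometryGroup G L) : L ≃ₗ[ℤ] L).toLinearMap) := rfl

theorem inv_signIsometry_apply (δ : ℤˣ) (x : L) :
    (((signIsometry G L δ)⁻¹ : isometryGroup G L) : L ≃ₗ[ℤ] L) x = (δ : ℤ) • x := by
  apply (signIsometry G L δ : L ≃ₗ[ℤ] L).injective
  have h : (signIsometry G L δ : L ≃ₗ[ℤ] L)
    ((((signIsometry G L δ)⁻¹ : isometryGroup G L) : L ≃ₗ[ℤ] L) x) = x :=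
      (signIsometry G L δ : L ≃ₗ[ℤ] L).apply_symm_apply x
  rw [h, signIsometry_apply, smul_smul, ← Units.val_mul, Int.units_mul_self]
  simp

theorem discRep_signIsometry (δ : ℤˣ) (a : DiscGroup G L) :
    discRep G L (signIsometry G L δ) a = (δ : ℤ) • a := by
  obtain ⟨φ, rfl⟩ := Submodule.Quotient.mk_surjective _ a
  rw [discRep_mk, ← Submodule.Quotient.mk_smul]
  congr 1
  ext x
  simp only [LinearMap.comp_apply, LinearEquiv.coe_coe, inv_signIsometry_apply, map_smul]
  rfl

theorem form_inv_right (g : isometryGroup G L) (x y : L) :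
    latticeForm G (x : κ → ℤ) ((((g⁻¹ : isometryGroup G L) : L ≃ₗ[ℤ] L) y : L) : κ → ℤ) =
      latticeForm G ((g : L ≃ₗ[ℤ] L) x : κ → ℤ) (y : κ → ℤ) := by
  rw [← g.2 x]
  congr 2
  exact (g : L ≃ₗ[ℤ] L).apply_symm_apply y

theorem glueGraph_smul {M N : Submodule ℤ (κ → ℤ)} (k : ℤ) {a : DiscGroup G M} {b : DiscGroup G N}
    (h : (a, b) ∈ glueGraph G M N) : (k • a, k • b) ∈ glueGraph G M N := by
  obtain ⟨v, hv⟩ := h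
  obtain ⟨rfl, rfl⟩ := Prod.mk.inj hv
  exact ⟨k • v, by simp only [map_smul]; rfl⟩

end Glue

namespace MarkedK3.IsPolarization

variable {S : MarkedK3} {n : ℕ} {H : S.NS}

/-- A Hodge isometry of the transcendental lattice is multiplication by a sign. -/
theorem eq_signIsometry_of_mem_hodgeIsometries (h : S.IsPolarization n H)
    {g : isometryGroup mukaiGram S.transc} (hg : g ∈ S.hodgeIsometries) :
    ∃ δ : ℤˣ, g = signIsometry mukaiGram S.transc δ := by
  set ω : cplx S.transc := ⟨_, h.period_mem_cplx_transc⟩ with hω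
  obtain ⟨ζ, hζ⟩ := Submodule.mem_span_singleton.1
    ((hg ω).1 (Submodule.subset_span rfl))
  have hζ' : cplxAut S.transc (g : S.transc ≃ₗ[ℤ] S.transc) ω = ζ • ω := Subtype.ext hζ.symm
  -- A vector of `T` orthogonal to the period lies in `NS(S) = ℤH` and is also orthogonal to `H`,
  -- hence is zero.
  have hinj : ∀ x : S.transc, latticeForm mukaiGram (ω : MukaiIndex → ℂ)
      (toCplx S.transc x : MukaiIndex → ℂ) = 0 → x = 0 := by
    intro x hx
    obtain ⟨h1, h2, h3⟩ := h.mem_transc.1 x.2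
    have e : (toCplx S.transc x : MukaiIndex → ℂ) =
        mukaiVec 0 (castVec ((x : MukaiIndex → ℤ) ∘ Sum.inl)) 0 := by
      ext i
      rcases i with i | i
      · rfl
      · fin_cases i
        · simp [toCplx, castVec, mukaiVec, h1]
        · simp [toCplx, castVec, mukaiVec, h2]
    rw [e] at hx
    change latticeForm mukaiGram (mukaiVec 0 S.period 0) _ = 0 at hx
    rw [latticeForm_mukaiVec, latticeForm_comm k3Gram_isSymm] at hx
    have hx' : (x : MukaiIndex → ℤ) ∘ Sum.inl ∈ S.NS := by
      change latticeForm k3Gram _ _ = 0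
      simpa using hx
    obtain ⟨b, hb⟩ := h.exists_smul hx'
    rw [hb, latticeForm_smul_right, h.degree] at h3
    have hb0 : b = 0 := by
      have := h.n_pos
      rcases mul_eq_zero.1 h3 with h3 | h3
      · exact h3
      · omega
    rw [hb0, zero_smul] at hb
    apply Subtype.ext
    rw [← mukaiVec_eta (x : MukaiIndex → ℤ), h1, h2, hb]
    ext i
    rcases i with i | i
    · rfl
    · fin_cases i <;> rfl
  let B : LinearMap.BilinForm ℤ S.transc := LinearMap.mk₂ ℤ
    (fun x y => latticeForm mukaiGram (x : MukaiIndex → ℤ) (y : MukaiIndex → ℤ))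
    (fun _ _ _ => latticeForm_add_left _ _ _ _) (fun _ _ _ => latticeForm_smul_left _ _ _ _)
    (fun _ _ _ => latticeForm_add_right _ _ _ _) (fun _ _ _ => latticeForm_smul_right _ _ _ _)
  obtain ⟨δ, x, hx0, hx⟩ := exists_eigenvector_of_odd_finrank (by rw [h.finrank_transc]; decide) B
    (fun x hx => Subtype.ext (h.transc_nondegenerate x.2 fun t ht => by
      rw [latticeForm_comm mukaiGram_isSymm]; exact hx ⟨t, ht⟩))
    (g : S.transc ≃ₗ[ℤ] S.transc).toLinearMap g.2
  have key : ∀ y : S.transc, ζ * latticeForm mukaiGram (ω : MukaiIndex → ℂ)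
      (toCplx S.transc ((g : S.transc ≃ₗ[ℤ] S.transc) y) : MukaiIndex → ℂ) =
      latticeForm mukaiGram (ω : MukaiIndex → ℂ) (toCplx S.transc y : MukaiIndex → ℂ) := by
    intro y
    rw [← latticeForm_cplxAut mukaiGram S.transc g ω (toCplx S.transc y), hζ', cplxAut_toCplx,
      Submodule.coe_smul,
      latticeForm_smul_left]
  have hδ : ((δ : ℤ) : ℂ) * ((δ : ℤ) : ℂ) = 1 := by
    rw [← Int.cast_mul, ← Units.val_mul, Int.units_mul_self]; simp
  have hsm : ∀ y : S.transc, (toCplx S.transc ((δ : ℤ) • y) : MukaiIndex → ℂ) =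
      ((δ : ℤ) : ℂ) • (toCplx S.transc y : MukaiIndex → ℂ) := by
    intro y; ext i; simp [toCplx, castVec]
  -- The eigenvector pairs nontrivially with `ω`, so the eigenvalue `ζ` on `ω` is tied to `δ`. It
  -- then follows that `(ω, gy) = δ(ω, y)` for every `y`, and injectivity of the pairing gives `gy =
  -- δy`.
  have hζδ : ζ * ((δ : ℤ) : ℂ) = 1 := by
    have h1 := key x
    rw [show (g : S.transc ≃ₗ[ℤ] S.transc) x = (δ : ℤ) • x from hx, hsm,
      latticeForm_smul_right, ← mul_assoc] at h1
    exact mul_right_cancel₀ (fun e => hx0 (hinj x e)) (h1.trans (one_mul _).symm)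
  refine ⟨δ, Subtype.ext (LinearEquiv.ext fun y => ?_)⟩
  rw [signIsometry_apply, ← sub_eq_zero]
  apply hinj
  rw [map_sub, Submodule.coe_sub, latticeForm_sub_right, hsm, latticeForm_smul_right]
  linear_combination ((δ : ℤ) : ℂ) * key y - hζδ * latticeForm mukaiGram (ω : MukaiIndex → ℂ)
      (toCplx S.transc ((g : S.transc ≃ₗ[ℤ] S.transc) y) : MukaiIndex → ℂ)

theorem signIsometry_mem_hodgeIsometries (δ : ℤˣ) :
    signIsometry mukaiGram S.transc δ ∈ S.hodgeIsometries := by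
  intro v
  have h : (cplxAut S.transc (signIsometry mukaiGram S.transc δ : S.transc ≃ₗ[ℤ] S.transc) :
      cplx S.transc →ₗ[ℂ] cplx S.transc) = ((δ : ℤ) : ℂ) • LinearMap.id := cplx_ext fun x => by
    simp only [LinearEquiv.coe_coe, cplxAut_toCplx, signIsometry_apply, map_smul,
      LinearMap.smul_apply, LinearMap.id_apply, Int.cast_smul_eq_zsmul]
  have h' := LinearMap.congr_fun h v
  simp only [LinearEquiv.coe_coe, LinearMap.smul_apply, LinearMap.id_apply] at h'
  rw [h', Submodule.coe_smul]
  exact (Submodule.smul_mem_iff _ (by exact_mod_cast δ.ne_zero)).symm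

theorem eq_zero_of_form_extNS (h : S.IsPolarization n H) {l : S.extNS}
    (hl : ∀ x : S.extNS, latticeForm mukaiGram (l : MukaiIndex → ℤ) (x : MukaiIndex → ℤ) = 0) :
    l = 0 := by
  obtain ⟨r, b, s, rfl⟩ := h.exists_latVec l
  have h1 := hl (S.latVec H 1 0 0)
  have h2 := hl (S.latVec H 0 1 0)
  have h3 := hl (S.latVec H 0 0 1)
  rw [h.form_latVec] at h1 h2 h3
  have := h.n_pos
  have hb : b = 0 := by
    have h2' : (2 * n : ℤ) * b = 0 := by linarith
    rcases mul_eq_zero.1 h2' with h2' | h2'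
    · omega
    · exact h2'
  have h0 := latVec_smul (S := S) (H := H) 0 0 0 0
  simp only [zero_smul, mul_zero] at h0
  rw [h0, h.latVec_inj]
  exact ⟨by linarith, hb, by linarith⟩

/-- An isometry of the extended Néron-Severi lattice lies in `Γ(S)` if and only if it acts as a
sign on the generator `H / 2n` of the discriminant group. -/
theorem mem_Gam_iff (h : S.IsPolarization n H) (γ : isometryGroup mukaiGram S.extNS) :
    γ ∈ S.Gam ↔ ∃ (δ : ℤˣ) (l : S.extNS), (γ : S.extNS ≃ₗ[ℤ] S.extNS) (S.latVec H 0 1 0) =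
      (δ : ℤ) • S.latVec H 0 1 0 + (2 * n : ℤ) • l := by
  obtain ⟨D, hD⟩ := h.exists_form_eq_one
  have hn : (2 * n : ℤ) ≠ 0 := by have := h.n_pos; omega
  -- The vector `(0, D, 0)` with `(H, D) = 1` restricts on `L` to the functional of `H / 2n`. It is
  -- an integral lift of the generator of `D_L`, so its two restrictions are matched by `λ`.
  have hv : ∀ x : S.extNS, (2 * n : ℤ) * latticeForm mukaiGram (mukaiVec 0 D 0)
      (x : MukaiIndex → ℤ) =
      latticeForm mukaiGram (S.latVec H 0 1 0 : MukaiIndex → ℤ) (x : MukaiIndex → ℤ) := by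
    intro x
    obtain ⟨r, b, s, rfl⟩ := h.exists_latVec x
    rw [h.form_latVec, latVec, latticeForm_mukaiVec, latticeForm_smul_right,
      latticeForm_comm k3Gram_isSymm, hD]
    ring
  constructor
  · rintro ⟨g, hg, hγ⟩
    obtain ⟨δ, rfl⟩ := h.eq_signIsometry_of_mem_hodgeIsometries hg
    obtain ⟨w, hw⟩ := (hγ _ _).1 ⟨mukaiVec 0 D 0, rfl⟩
    obtain ⟨hw1, hw2⟩ := Prod.mk.inj hw
    rw [discRep_mk] at hw1
    rw [discRep_signIsometry, ← Submodule.Quotient.mk_smul] at hw2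
    obtain ⟨l₁, hl₁, e₁⟩ := (Submodule.Quotient.eq _).1 hw1
    obtain ⟨t, ht, e₂⟩ := (Submodule.Quotient.eq _).1 hw2
    -- On `T` the functionals of `w` and `δD` differ by that of `t ∈ T`. Hence the vector on the
    -- left is orthogonal to `T` and lies in `L`.
    have e₃ : w - (δ : ℤ) • mukaiVec 0 D 0 - t ∈ S.extNS := by
      refine h.mem_extNS_of_orthogonal fun y hy => ?_
      have := LinearMap.congr_fun e₂ ⟨y, hy⟩
      change latticeForm mukaiGram t y = latticeForm mukaiGram w y -
        (δ : ℤ) * latticeForm mukaiGram (mukaiVec 0 D 0) y at this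
      rw [latticeForm_comm mukaiGram_isSymm, latticeForm_sub_left, latticeForm_sub_left,
        latticeForm_smul_left, this, sub_self]
    refine ⟨δ, ⟨_, e₃⟩ - ⟨l₁, hl₁⟩, ?_⟩
    rw [← sub_eq_zero]
    refine h.eq_zero_of_form_extNS fun x => ?_
    have e₄ := LinearMap.congr_fun e₁ x
    change latticeForm mukaiGram l₁ (x : MukaiIndex → ℤ) =
      latticeForm mukaiGram w (x : MukaiIndex → ℤ) - latticeForm mukaiGram (mukaiVec 0 D 0) _ at e₄
    have e₅ := hv (((γ⁻¹ : isometryGroup mukaiGram S.extNS) : S.extNS ≃ₗ[ℤ] S.extNS) x)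
    rw [form_inv_right] at e₅
    have e₆ : latticeForm mukaiGram t (x : MukaiIndex → ℤ) = 0 := by
      rw [latticeForm_comm mukaiGram_isSymm]
      exact ht _ x.2
    simp only [Submodule.coe_sub, Submodule.coe_add, Submodule.coe_smul, latticeForm_sub_left,
      latticeForm_add_left, latticeForm_smul_left, ← e₅, ← hv x, e₆]
    rw [e₄]
    simp only [LinearEquiv.coe_coe]
    ring
  · rintro ⟨δ, l, hl⟩
    have key : ∀ a, discRep mukaiGram S.extNS γ a = (δ : ℤ) • a := by
      intro a
      obtain ⟨φ, rfl⟩ := Submodule.Quotient.mk_surjective _ a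
      -- Since `e` and `f` span a unimodular plane, `φ` is the functional of `l₁ + m·(H / 2n)` with
      -- `l₁` in that plane and the integer `m` the value of `φ` on `(0, H, 0)`. Thus its class is a
      -- multiple of that of `H / 2n`.
      set l₁ := S.latVec H (-φ (S.latVec H 0 0 1)) 0 (-φ (S.latVec H 1 0 0))
      set m := φ (S.latVec H 0 1 0)
      have hφ : ∀ x : S.extNS, (2 * n : ℤ) * φ x =
          m * latticeForm mukaiGram (S.latVec H 0 1 0 : MukaiIndex → ℤ) (x : MukaiIndex → ℤ) +
          2 * n * latticeForm mukaiGram (l₁ : MukaiIndex → ℤ) (x : MukaiIndex → ℤ) := by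
        intro x
        obtain ⟨r, b, s, rfl⟩ := h.exists_latVec x
        have : S.latVec H r b s = r • S.latVec H 1 0 0 + b • S.latVec H 0 1 0 +
            s • S.latVec H 0 0 1 := by
          simp [latVec_smul, latVec_add]
        conv_lhs => rw [this]
        simp only [map_add, map_smul, h.form_latVec, l₁, m, smul_eq_mul]
        ring
      rw [discRep_mk, ← Submodule.Quotient.mk_smul]
      -- Replacing `φ` by `l₁ + m·(H / 2n)`, the difference `γφ - δφ` is `γl₁ - δl₁ + m(γH - δH) /
      -- 2n`, and the last quotient is `l`.
      refine (Submodule.Quotient.eq _).2 ⟨(m • l + (γ : S.extNS ≃ₗ[ℤ] S.extNS) l₁ -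
        (δ : ℤ) • l₁ : S.extNS), Subtype.coe_prop _, ?_⟩
      ext x
      apply mul_left_cancel₀ hn
      change (2 * n : ℤ) * latticeForm mukaiGram _ (x : MukaiIndex → ℤ) =
        2 * n * (φ _ - (δ : ℤ) * φ x)
      rw [mul_sub, hφ, mul_left_comm, hφ]
      simp only [LinearEquiv.coe_coe]
      rw [form_inv_right, form_inv_right, hl]
      simp only [Submodule.coe_sub, Submodule.coe_add, Submodule.coe_smul, latticeForm_sub_left,
        latticeForm_add_left, latticeForm_smul_left]
      ring
    refine ⟨signIsometry mukaiGram S.transc δ, signIsometry_mem_hodgeIsometries δ, fun a b => ?_⟩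
    rw [key, discRep_signIsometry]
    refine ⟨glueGraph_smul _, fun hab => ?_⟩
    have := glueGraph_smul (δ : ℤ) hab
    rw [smul_smul, smul_smul, ← Units.val_mul, Int.units_mul_self] at this
    simpa using this

end MarkedK3.IsPolarization

/-! ### Traceless matrices and the Clifford relation -/

/-- A functional and multiplicative relation between groups is the graph of a homomorphism. -/
theorem exists_monoidHom_of_rel {A B : Type*} [Group A] [Group B] (r : A → B → Prop)
    (hex : ∀ a, ∃ b, r a b) (hmul : ∀ {a b a' b'}, r a b → r a' b' → r (a * a') (b * b'))
    (huniq : ∀ {a b b'}, r a b → r a b' → b = b') : ∃ Ψ : A →* B, ∀ a, r a (Ψ a) := by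
  choose f hf using hex
  exact ⟨MonoidHom.mk' f fun a a' => huniq (hf _) (hmul (hf a) (hf a')), hf⟩

/-- The matrix of trace zero with coordinates `(r, b, s)`; for integral coordinates these matrices
form the lattice of traceless matrices `A` with `tr (A B) ∈ nℤ` for all `B` in the Eichler order of
level `n`. -/
def tracelessMat {R : Type} [CommRing R] (n : ℕ) (r b s : R) : Matrix (Fin 2) (Fin 2) R :=
  !![-(n * b), s; -(n * r), n * b]

theorem exists_tracelessMat {R : Type} [Field R] [CharZero R] {n : ℕ} (hn : 0 < n)
    {A : Matrix (Fin 2) (Fin 2) R} (hA : A.trace = 0) :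
    ∃ r b s, A = tracelessMat n r b s := by
  have hn' : (n : R) ≠ 0 := by exact_mod_cast hn.ne'
  refine ⟨-A 1 0 / n, A 1 1 / n, A 0 1, ?_⟩
  rw [Matrix.trace_fin_two] at hA
  ext i j
  fin_cases i <;> fin_cases j <;> simp [tracelessMat, mul_div_cancel₀ _ hn']
  linear_combination hA

theorem trace_conj {R : Type} [CommRing R] (γ : GL (Fin 2) R) (A : Matrix (Fin 2) (Fin 2) R) :
    ((γ : Matrix (Fin 2) (Fin 2) R) * A * ((γ⁻¹ : GL (Fin 2) R) : Matrix (Fin 2) (Fin 2) R)).trace =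
      A.trace := by
  rw [Matrix.trace_mul_comm, ← mul_assoc, Units.inv_mul, one_mul]

/-- This is the Clifford relation: the scalar is `n` times the Mukai pairing of the two vectors. It
lets the algebra structure detect the form. -/
theorem tracelessMat_anticommutator {R : Type} [CommRing R] (n : ℕ) (r b s r' b' s' : R) :
    tracelessMat n r b s * tracelessMat n r' b' s' +
        tracelessMat n r' b' s' * tracelessMat n r b s =
      (n * (2 * n * b * b' - r * s' - s * r')) • 1 := by
  ext i j
  fin_cases i <;> fin_cases j <;> simp [tracelessMat] <;> ring

theorem tracelessMat_mul_trace {R : Type} [CommRing R] (n : ℕ) (r b s r' b' s' : R) :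
    (tracelessMat n r b s * tracelessMat n r' b' s').trace =
      n * (2 * n * b * b' - r * s' - s * r') := by
  simp [tracelessMat, Matrix.trace_fin_two]
  ring

/-- Two matrices of square zero with anticommutator the identity are simultaneously conjugate to the
elementary matrices. -/
theorem exists_conj_elementary {K : Type} [Field K] {P Q : Matrix (Fin 2) (Fin 2) K}
    (hP : P * P = 0) (hQ : Q * Q = 0) (hPQ : P * Q + Q * P = 1) :
    ∃ γ : GL (Fin 2) K,
      (γ : Matrix (Fin 2) (Fin 2) K) * !![0, 1; 0, 0] = P * (γ : Matrix (Fin 2) (Fin 2) K) ∧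
      (γ : Matrix (Fin 2) (Fin 2) K) * !![0, 0; 1, 0] = Q * (γ : Matrix (Fin 2) (Fin 2) K) := by
  have hd : Q.det = 0 := by
    have := congrArg Matrix.det hQ
    rw [Matrix.det_mul, Matrix.det_zero] at this
    exact mul_self_eq_zero.1 this
  obtain ⟨z, hz0, hz⟩ := Matrix.exists_mulVec_eq_zero_iff.2 hd
  have hQPz : Q.mulVec (P.mulVec z) = z := by
    have := congrArg (fun A => A.mulVec z) hPQ
    simpa [Matrix.add_mulVec, ← Matrix.mulVec_mulVec, hz] using this
  have hPPz : P.mulVec (P.mulVec z) = 0 := by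
    rw [Matrix.mulVec_mulVec, hP, Matrix.zero_mulVec]
  -- For `z` in the kernel of `Q` the relation gives `QPz = z`, and `P²z = 0`. In the basis `(Pz,
  -- z)` both `P` and `Q` are therefore elementary matrices.
  set γ : Matrix (Fin 2) (Fin 2) K := (Matrix.of ![P.mulVec z, z]).transpose with hγ
  have hmul : ∀ A : Matrix (Fin 2) (Fin 2) K,
      A * γ = (Matrix.of ![A.mulVec (P.mulVec z), A.mulVec z]).transpose := by
    intro A
    ext i j
    fin_cases i <;> fin_cases j <;>
      simp [γ, Matrix.mul_apply, Fin.sum_univ_two]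
  have hγv : ∀ x : Fin 2 → K, γ.mulVec x = x 0 • P.mulVec z + x 1 • z := by
    intro x
    ext i
    fin_cases i <;> simp [γ, Matrix.mulVec, dotProduct, Fin.sum_univ_two] <;> ring
  have hdet : γ.det ≠ 0 := by
    intro h0
    obtain ⟨x, hx0, hx⟩ := Matrix.exists_mulVec_eq_zero_iff.2 h0
    rw [hγv] at hx
    have h1 := congrArg Q.mulVec hx
    rw [Matrix.mulVec_add, Matrix.mulVec_smul, Matrix.mulVec_smul, hQPz, hz, smul_zero, add_zero,
      Matrix.mulVec_zero] at h1
    have h2 := (smul_eq_zero.1 h1).resolve_right hz0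
    rw [h2, zero_smul, zero_add] at hx
    have h3 := (smul_eq_zero.1 hx).resolve_right hz0
    exact hx0 (by ext i; fin_cases i <;> simp [h2, h3])
  refine ⟨Matrix.GeneralLinearGroup.mkOfDetNeZero γ hdet, ?_, ?_⟩
  · change γ * _ = P * γ
    rw [hmul, hPPz]
    ext i j
    fin_cases j <;> simp [γ, Matrix.mul_apply, Fin.sum_univ_two]
  · change γ * _ = Q * γ
    rw [hmul, hQPz, hz]
    ext i j
    fin_cases j <;> simp [γ, Matrix.mul_apply, Fin.sum_univ_two]

/-! ### The Eichler order and its traceless dual lattice -/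

theorem tracelessMat_mem_eichlerOrder (n : ℕ) (r b s : ℤ) :
    tracelessMat n (r : ℚ) b s ∈ eichlerOrder n :=
  ⟨-(n * b), s, -r, n * b, by simp [tracelessMat]⟩

theorem inv_smul_tracelessMat_mul_mem_eichlerOrder {n : ℕ} (hn : 0 < n) (r b s r' b' s' : ℤ) :
    (n : ℚ)⁻¹ • (tracelessMat n (r : ℚ) b s * tracelessMat n (r' : ℚ) b' s') ∈ eichlerOrder n := by
  have hn' : (n : ℚ) ≠ 0 := by exact_mod_cast hn.ne'
  refine ⟨n * b * b' - s * r', s * b' - b * s', r * b' - b * r', n * b * b' - r * s', ?_⟩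
  ext i j
  fin_cases i <;> fin_cases j <;>
    simp [tracelessMat] <;> field_simp <;> ring

/-- Conjugation by `γ` maps the traceless dual lattice to itself. -/
def PreservesTraceless (n : ℕ) (γ : GL (Fin 2) ℚ) : Prop :=
  ∀ r b s : ℤ, ∃ r' b' s' : ℤ, (γ : Matrix (Fin 2) (Fin 2) ℚ) * tracelessMat n (r : ℚ) b s *
    ((γ⁻¹ : GL (Fin 2) ℚ) : Matrix (Fin 2) (Fin 2) ℚ) = tracelessMat n (r' : ℚ) b' s'

/-- The lattice is cut out among traceless matrices by `tr(XY) ∈ nℤ` for `Y` in the order, and the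
trace is invariant under conjugation. The condition need only be tested on the three generators
`E₁₁`, `E₁₂`, `nE₂₁`, which read off the coordinates of `X`. -/
theorem preservesTraceless_of_mem_eichlerNormalizer {n : ℕ} (hn : 0 < n) {γ : GL (Fin 2) ℚ}
    (hγ : γ ∈ eichlerNormalizer n) : PreservesTraceless n γ := by
  have hn' : (n : ℚ) ≠ 0 := by exact_mod_cast hn.ne'
  intro r b s
  set X := (γ : Matrix (Fin 2) (Fin 2) ℚ) * tracelessMat n (r : ℚ) b s *
    ((γ⁻¹ : GL (Fin 2) ℚ) : Matrix (Fin 2) (Fin 2) ℚ) with hX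
  have key : ∀ Y ∈ eichlerOrder n, ∃ k : ℤ, (X * Y).trace = n * k := by
    intro Y hY
    have hY' := ((eichlerNormalizer n).inv_mem hγ Y).1 hY
    obtain ⟨a, b', c, d, e⟩ := hY'
    rw [inv_inv] at e
    refine ⟨-(b * a) + s * c - r * b' + b * d, ?_⟩
    rw [hX, mul_assoc, mul_assoc, Matrix.trace_mul_comm, mul_assoc, e]
    simp [tracelessMat, Matrix.trace_fin_two]
    ring
  obtain ⟨k₁, h₁⟩ := key !![1, 0; 0, 0] ⟨1, 0, 0, 0, by simp⟩
  obtain ⟨k₂, h₂⟩ := key !![0, 1; 0, 0] ⟨0, 1, 0, 0, by simp⟩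
  obtain ⟨k₃, h₃⟩ := key !![0, 0; n, 0] ⟨0, 0, 1, 0, by simp⟩
  have h₄ : X.trace = 0 := by
    rw [hX, trace_conj]; simp [tracelessMat, Matrix.trace_fin_two]
  simp [Matrix.mul_apply, Fin.sum_univ_two, Matrix.trace_fin_two] at h₁ h₂ h₃ h₄
  refine ⟨-k₂, -k₁, k₃, ?_⟩
  ext i j
  fin_cases i <;> fin_cases j <;> simp [tracelessMat]
  · exact h₁
  · exact mul_right_cancel₀ hn' (h₃.trans (mul_comm _ _))
  · exact h₂
  · linear_combination h₄ - h₁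

/-- The order is recovered from the lattice: `E₁₂` and `-nE₂₁` belong to the lattice, and their two
products divided by `n` are `-E₁₁` and `-E₂₂`. Since `XY / n` lies in the order for all lattice
elements `X`, `Y`, conjugation preserves the order as soon as it preserves the lattice. -/
theorem conj_mem_eichlerOrder {n : ℕ} (hn : 0 < n) {γ : GL (Fin 2) ℚ}
    (hγ : PreservesTraceless n γ) {A : Matrix (Fin 2) (Fin 2) ℚ} (hA : A ∈ eichlerOrder n) :
    (γ : Matrix (Fin 2) (Fin 2) ℚ) * A * ((γ⁻¹ : GL (Fin 2) ℚ) : Matrix (Fin 2) (Fin 2) ℚ) ∈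
      eichlerOrder n := by
  have hn' : (n : ℚ) ≠ 0 := by exact_mod_cast hn.ne'
  obtain ⟨a, b, c, d, rfl⟩ := hA
  obtain ⟨r, t, s, h₁⟩ := hγ 1 0 0
  obtain ⟨r', t', s', h₂⟩ := hγ 0 0 1
  have e : (!![(a : ℚ), b; n * c, d] : Matrix (Fin 2) (Fin 2) ℚ) =
      (-a) • ((n : ℚ)⁻¹ • (tracelessMat n ((0 : ℤ) : ℚ) (0 : ℤ) (1 : ℤ) *
          tracelessMat n ((1 : ℤ) : ℚ) (0 : ℤ) (0 : ℤ))) +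
      (-d) • ((n : ℚ)⁻¹ • (tracelessMat n ((1 : ℤ) : ℚ) (0 : ℤ) (0 : ℤ) *
          tracelessMat n ((0 : ℤ) : ℚ) (0 : ℤ) (1 : ℤ))) +
      b • tracelessMat n ((0 : ℤ) : ℚ) (0 : ℤ) (1 : ℤ) +
      (-c) • tracelessMat n ((1 : ℤ) : ℚ) (0 : ℤ) (0 : ℤ) := by
    ext i j
    fin_cases i <;> fin_cases j <;>
      simp [tracelessMat, mul_comm, hn']
  have hconj : ∀ X Y : Matrix (Fin 2) (Fin 2) ℚ, (γ : Matrix (Fin 2) (Fin 2) ℚ) * (X * Y) *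
      ((γ⁻¹ : GL (Fin 2) ℚ) : Matrix (Fin 2) (Fin 2) ℚ) =
      ((γ : Matrix (Fin 2) (Fin 2) ℚ) * X * ((γ⁻¹ : GL (Fin 2) ℚ) : Matrix (Fin 2) (Fin 2) ℚ)) *
      ((γ : Matrix (Fin 2) (Fin 2) ℚ) * Y * ((γ⁻¹ : GL (Fin 2) ℚ) : Matrix (Fin 2) (Fin 2) ℚ)) := by
    intro X Y
    simp only [mul_assoc, Units.inv_mul_cancel_left]
  rw [e]
  simp only [mul_add, add_mul, mul_smul_comm, smul_mul_assoc, hconj, h₁, h₂]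
  refine add_mem (add_mem (add_mem ?_ ?_) ?_) ?_
  · exact zsmul_mem (inv_smul_tracelessMat_mul_mem_eichlerOrder hn _ _ _ _ _ _) _
  · exact zsmul_mem (inv_smul_tracelessMat_mul_mem_eichlerOrder hn _ _ _ _ _ _) _
  · exact zsmul_mem (tracelessMat_mem_eichlerOrder _ _ _ _) _
  · exact zsmul_mem (tracelessMat_mem_eichlerOrder _ _ _ _) _

theorem mem_eichlerNormalizer_of_preservesTraceless {n : ℕ} (hn : 0 < n) {γ : GL (Fin 2) ℚ}
    (hγ : PreservesTraceless n γ) (hγ' : PreservesTraceless n γ⁻¹) :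
    γ ∈ eichlerNormalizer n := by
  intro A
  refine ⟨conj_mem_eichlerOrder hn hγ, fun h => ?_⟩
  have := conj_mem_eichlerOrder hn hγ' h
  rwa [inv_inv, mul_assoc, mul_assoc, Units.inv_mul, mul_one, Units.inv_mul_cancel_left] at this

/-- Conjugation by an invertible matrix as a linear automorphism. -/
def conjEquiv (γ : GL (Fin 2) ℚ) : Matrix (Fin 2) (Fin 2) ℚ ≃ₗ[ℤ] Matrix (Fin 2) (Fin 2) ℚ where
  toFun A := (γ : Matrix (Fin 2) (Fin 2) ℚ) * A * ((γ⁻¹ : GL (Fin 2) ℚ) : Matrix (Fin 2) (Fin 2) ℚ)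
  map_add' A B := by rw [mul_add, add_mul]
  map_smul' c A := by rw [mul_smul_comm, smul_mul_assoc]; rfl
  invFun A := ((γ⁻¹ : GL (Fin 2) ℚ) : Matrix (Fin 2) (Fin 2) ℚ) * A *
    (γ : Matrix (Fin 2) (Fin 2) ℚ)
  left_inv A := by simp only [mul_assoc, Units.inv_mul_cancel_left, Units.inv_mul, mul_one]
  right_inv A := by simp only [mul_assoc, Units.mul_inv_cancel_left, Units.mul_inv, mul_one]

/-! ### Isometries of the extended Néron-Severi lattice as rational conjugations -/

namespace MarkedK3

/-- The traceless rational matrix attached to a vector `(r, bH, s)`. -/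
def latMat (S : MarkedK3) (n : ℕ) (H : S.NS) : S.extNS →ₗ[ℤ] Matrix (Fin 2) (Fin 2) ℚ where
  toFun x := tracelessMat n (((x : MukaiIndex → ℤ) (Sum.inr 0) : ℤ) : ℚ)
    -- On `bH` this quotient is `b`, as `(H, H) = 2n`; it gives the coordinate linearly without a
    -- choice.
    ((latticeForm k3Gram (H : K3Index → ℤ) ((x : MukaiIndex → ℤ) ∘ Sum.inl) : ℤ) / (2 * n))
    (((x : MukaiIndex → ℤ) (Sum.inr 1) : ℤ) : ℚ)
  map_add' x y := by
    have e : ((x + y : S.extNS) : MukaiIndex → ℤ) ∘ Sum.inl =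
      (x : MukaiIndex → ℤ) ∘ Sum.inl + (y : MukaiIndex → ℤ) ∘ Sum.inl := rfl
    rw [e, latticeForm_add_right]
    ext i j
    fin_cases i <;> fin_cases j <;> simp [tracelessMat] <;> ring
  map_smul' c x := by
    have e : ((c • x : S.extNS) : MukaiIndex → ℤ) ∘ Sum.inl =
      c • ((x : MukaiIndex → ℤ) ∘ Sum.inl) := rfl
    rw [e, latticeForm_smul_right]
    ext i j
    fin_cases i <;> fin_cases j <;> simp [tracelessMat] <;> ring

/-- The isometry `g` is `ε • Ad(γ)` in terms of the traceless rational matrices attached to lattice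
vectors. -/
def IsRatAdjoint (S : MarkedK3) (n : ℕ) (H : S.NS) (γ : GL (Fin 2) ℚ) (ε : ℤˣ)
    (g : isometryGroup mukaiGram S.extNS) : Prop :=
  ∀ x, S.latMat n H ((g : S.extNS ≃ₗ[ℤ] S.extNS) x) =
    (ε : ℤ) • ((γ : Matrix (Fin 2) (Fin 2) ℚ) * S.latMat n H x *
      ((γ⁻¹ : GL (Fin 2) ℚ) : Matrix (Fin 2) (Fin 2) ℚ))

variable {S : MarkedK3} {n : ℕ} {H : S.NS}

theorem IsRatAdjoint.mul {γ γ' : GL (Fin 2) ℚ} {ε ε' : ℤˣ} {g g' : isometryGroup mukaiGram S.extNS}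
    (h : S.IsRatAdjoint n H γ ε g) (h' : S.IsRatAdjoint n H γ' ε' g') :
    S.IsRatAdjoint n H (γ * γ') (ε * ε') (g * g') := by
  intro x
  have e : ((g * g' : isometryGroup mukaiGram S.extNS) : S.extNS ≃ₗ[ℤ] S.extNS) x =
    (g : S.extNS ≃ₗ[ℤ] S.extNS) ((g' : S.extNS ≃ₗ[ℤ] S.extNS) x) := rfl
  rw [e, h, h']
  simp only [mul_smul_comm, smul_mul_assoc, smul_smul, mul_inv_rev, Units.val_mul, mul_assoc]

theorem IsRatAdjoint.inv {γ : GL (Fin 2) ℚ} {ε : ℤˣ} {g : isometryGroup mukaiGram S.extNS}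
    (h : S.IsRatAdjoint n H γ ε g) : S.IsRatAdjoint n H γ⁻¹ ε g⁻¹ := by
  intro x
  have h1 := h ((g⁻¹ : isometryGroup mukaiGram S.extNS).1 x)
  rw [show (g : S.extNS ≃ₗ[ℤ] S.extNS) ((g⁻¹ : isometryGroup mukaiGram S.extNS).1 x) = x from
    (g : S.extNS ≃ₗ[ℤ] S.extNS).apply_symm_apply x] at h1
  rw [h1, inv_inv]
  simp only [mul_smul_comm, smul_mul_assoc, smul_smul, mul_assoc, Units.inv_mul_cancel_left,
    ← Units.val_mul, Int.units_mul_self]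
  simp

namespace IsPolarization

theorem latMat_latVec (h : S.IsPolarization n H) (r b s : ℤ) :
    S.latMat n H (S.latVec H r b s) = tracelessMat n (r : ℚ) b s := by
  have hn : (n : ℚ) ≠ 0 := by exact_mod_cast h.n_pos.ne'
  have e : latticeForm k3Gram (H : K3Index → ℤ)
      ((S.latVec H r b s : MukaiIndex → ℤ) ∘ Sum.inl) = b * (2 * n) := by
    change latticeForm k3Gram (H : K3Index → ℤ) (b • _) = _
    rw [latticeForm_smul_right, h.degree]
  simp only [latMat, LinearMap.coe_mk, AddHom.coe_mk, e]
  congr 1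
  push_cast
  field_simp

theorem latMat_injective (h : S.IsPolarization n H) : Function.Injective (S.latMat n H) := by
  have hn : (n : ℚ) ≠ 0 := by exact_mod_cast h.n_pos.ne'
  intro x y hxy
  obtain ⟨r, b, s, rfl⟩ := h.exists_latVec x
  obtain ⟨r', b', s', rfl⟩ := h.exists_latVec y
  rw [h.latMat_latVec, h.latMat_latVec] at hxy
  have h1 := congrFun (congrFun hxy 0) 1
  have h2 := congrFun (congrFun hxy 1) 0
  have h3 := congrFun (congrFun hxy 1) 1
  simp [tracelessMat, hn] at h1 h2 h3
  rw [h1, h2, h3]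

theorem isRatAdjoint_unique (h : S.IsPolarization n H) {γ : GL (Fin 2) ℚ} {ε : ℤˣ}
    {g g' : isometryGroup mukaiGram S.extNS} (hg : S.IsRatAdjoint n H γ ε g)
    (hg' : S.IsRatAdjoint n H γ ε g') : g = g' :=
  Subtype.ext (LinearEquiv.ext fun x => h.latMat_injective ((hg x).trans (hg' x).symm))

theorem trace_latMat_mul (h : S.IsPolarization n H) (x y : S.extNS) :
    (S.latMat n H x * S.latMat n H y).trace =
      n * (latticeForm mukaiGram (x : MukaiIndex → ℤ) (y : MukaiIndex → ℤ) : ℤ) := by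
  obtain ⟨r, b, s, rfl⟩ := h.exists_latVec x
  obtain ⟨r', b', s', rfl⟩ := h.exists_latVec y
  rw [h.latMat_latVec, h.latMat_latVec, tracelessMat_mul_trace, h.form_latVec]
  push_cast
  rfl

theorem latMat_anticommutator (h : S.IsPolarization n H) (x y : S.extNS) :
    S.latMat n H x * S.latMat n H y + S.latMat n H y * S.latMat n H x =
      ((n : ℚ) * (latticeForm mukaiGram (x : MukaiIndex → ℤ) (y : MukaiIndex → ℤ) : ℤ)) • 1 := by
  obtain ⟨r, b, s, rfl⟩ := h.exists_latVec x
  obtain ⟨r', b', s', rfl⟩ := h.exists_latVec y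
  rw [h.latMat_latVec, h.latMat_latVec, tracelessMat_anticommutator, h.form_latVec]
  push_cast
  rfl

theorem isRatAdjoint_signIsometry (ε : ℤˣ) :
    S.IsRatAdjoint n H 1 ε (signIsometry mukaiGram S.extNS ε) := by
  intro x
  rw [signIsometry_apply, map_smul]
  simp

/-- Conjugation by `γ` and by `γ⁻¹` preserve the image of `L` in the matrices, so conjugation
transports to an automorphism of `L`. It is an isometry because the trace form is `n` times the
Mukai pairing. -/
theorem exists_isRatAdjoint (h : S.IsPolarization n H) {γ : GL (Fin 2) ℚ}
    (hγ : γ ∈ eichlerNormalizer n) (ε : ℤˣ) : ∃ g, S.IsRatAdjoint n H γ ε g := by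
  have key : ∀ γ ∈ eichlerNormalizer n, ∀ A ∈ LinearMap.range (S.latMat n H),
      conjEquiv γ A ∈ LinearMap.range (S.latMat n H) := by
    rintro γ hγ _ ⟨x, rfl⟩
    obtain ⟨r, b, s, rfl⟩ := h.exists_latVec x
    obtain ⟨r', b', s', e⟩ := preservesTraceless_of_mem_eichlerNormalizer h.n_pos hγ r b s
    exact ⟨S.latVec H r' b' s', by rw [h.latMat_latVec, h.latMat_latVec]; exact e.symm⟩
  have hmap : (LinearMap.range (S.latMat n H)).map (conjEquiv γ : _ →ₗ[ℤ] _) =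
      LinearMap.range (S.latMat n H) := by
    apply le_antisymm
    · rintro _ ⟨A, hA, rfl⟩
      exact key γ hγ A hA
    · intro A hA
      refine ⟨_, key γ⁻¹ (inv_mem hγ) A hA, ?_⟩
      change (γ : Matrix (Fin 2) (Fin 2) ℚ) * (_ * A * _) * _ = A
      rw [inv_inv]
      exact (conjEquiv γ).apply_symm_apply A
  let e := LinearEquiv.ofInjective (S.latMat n H) h.latMat_injective
  let g : S.extNS ≃ₗ[ℤ] S.extNS :=
    (e.trans ((conjEquiv γ).ofSubmodules _ _ hmap)).trans e.symm
  have hg : ∀ x, S.latMat n H (g x) = (γ : Matrix (Fin 2) (Fin 2) ℚ) * S.latMat n H x *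
      ((γ⁻¹ : GL (Fin 2) ℚ) : Matrix (Fin 2) (Fin 2) ℚ) := by
    intro x
    have : e (g x) = (conjEquiv γ).ofSubmodules _ _ hmap (e x) := by
      simp only [g, LinearEquiv.trans_apply, LinearEquiv.apply_symm_apply]
    exact congrArg Subtype.val this
  have hiso : g ∈ isometryGroup mukaiGram S.extNS := by
    intro x y
    have hn : (n : ℚ) ≠ 0 := by exact_mod_cast h.n_pos.ne'
    have h1 := h.trace_latMat_mul (g x) (g y)
    have h2 : ∀ a b : Matrix (Fin 2) (Fin 2) ℚ,
        (γ : Matrix (Fin 2) (Fin 2) ℚ) * a * ((γ⁻¹ : GL (Fin 2) ℚ) : Matrix (Fin 2) (Fin 2) ℚ) *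
        ((γ : Matrix (Fin 2) (Fin 2) ℚ) * b * ((γ⁻¹ : GL (Fin 2) ℚ) : Matrix (Fin 2) (Fin 2) ℚ)) =
        (γ : Matrix (Fin 2) (Fin 2) ℚ) * (a * b) *
          ((γ⁻¹ : GL (Fin 2) ℚ) : Matrix (Fin 2) (Fin 2) ℚ) := fun a b => by
      simp only [mul_assoc, Units.inv_mul_cancel_left]
    rw [hg, hg, h2, trace_conj, h.trace_latMat_mul] at h1
    exact_mod_cast (mul_left_cancel₀ hn h1).symm
  have h1 : S.IsRatAdjoint n H γ 1 ⟨g, hiso⟩ := fun x => by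
    rw [Units.val_one, one_smul]
    exact hg x
  have h2 := (isRatAdjoint_signIsometry ε).mul h1
  rw [one_mul, mul_one] at h2
  exact ⟨_, h2⟩

/-- Every isometry of the extended Néron-Severi lattice is, up to sign, conjugation by an element of
the normalizer of the Eichler order. -/
theorem exists_eichlerNormalizer (h : S.IsPolarization n H)
    (g : isometryGroup mukaiGram S.extNS) :
    ∃ γ ∈ eichlerNormalizer n, ∃ ε, S.IsRatAdjoint n H γ ε g := by
  have hn : (n : ℚ) ≠ 0 := by exact_mod_cast h.n_pos.ne'
  set e := S.latVec H 1 0 0 with he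
  set m := S.latVec H 0 1 0 with hm
  set f := S.latVec H 0 0 1 with hf
  set φ := S.latMat n H with hφ
  have φe : φ e = -(n : ℚ) • !![0, 0; 1, 0] := by
    rw [hφ, he, h.latMat_latVec]
    ext i j; fin_cases i <;> fin_cases j <;> simp [tracelessMat]
  have φm : φ m = (n : ℚ) • !![-1, 0; 0, 1] := by
    rw [hφ, hm, h.latMat_latVec]
    ext i j; fin_cases i <;> fin_cases j <;> simp [tracelessMat]
  have φf : φ f = !![0, 1; 0, 0] := by
    rw [hφ, hf, h.latMat_latVec]
    ext i j; fin_cases i <;> fin_cases j <;> simp [tracelessMat]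
  -- The images of `e`, `m`, `f` under `g` satisfy the same Clifford relations as `e`, `m`, `f`
  -- themselves.
  have hac : ∀ x y : S.extNS, φ ((g : S.extNS ≃ₗ[ℤ] S.extNS) x) *
      φ ((g : S.extNS ≃ₗ[ℤ] S.extNS) y) + φ ((g : S.extNS ≃ₗ[ℤ] S.extNS) y) *
      φ ((g : S.extNS ≃ₗ[ℤ] S.extNS) x) =
      ((n : ℚ) * (latticeForm mukaiGram (x : MukaiIndex → ℤ) (y : MukaiIndex → ℤ) : ℤ)) • 1 := by
    intro x y
    rw [hφ, h.latMat_anticommutator, g.2 x y]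
  have hsq : ∀ A : Matrix (Fin 2) (Fin 2) ℚ, A + A = 0 → A = 0 := by
    intro A hA
    rw [← two_smul ℚ, smul_eq_zero] at hA
    exact hA.resolve_left two_ne_zero
  set P := φ ((g : S.extNS ≃ₗ[ℤ] S.extNS) f)
  set Q := φ ((g : S.extNS ≃ₗ[ℤ] S.extNS) e)
  set M := φ ((g : S.extNS ≃ₗ[ℤ] S.extNS) m)
  have hP : P * P = 0 := hsq _ (by
    rw [hac, hf, h.form_latVec]; simp)
  have hQ : Q * Q = 0 := hsq _ (by
    rw [hac, he, h.form_latVec]; simp)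
  have hPQ : P * Q + Q * P = (-n : ℚ) • 1 := by
    rw [hac, he, hf, h.form_latVec]; simp
  have hPM : P * M + M * P = 0 := by
    rw [hac, hm, hf, h.form_latVec]; simp
  have hQM : Q * M + M * Q = 0 := by
    rw [hac, he, hm, h.form_latVec]; simp
  have hMM : M * M = ((n : ℚ) * n) • 1 := by
    have h1 : M * M + M * M = _ := hac m m
    rw [hm, h.form_latVec, ← two_smul ℚ] at h1
    have h2 := congrArg ((2 : ℚ)⁻¹ • ·) h1
    simp only [smul_smul] at h2
    rw [inv_mul_cancel₀ two_ne_zero, one_smul] at h2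
    rw [h2]
    congr 1
    push_cast
    ring
  -- The factor `-1/n` normalizes the anticommutator: `(f, e) = -1` gives `PQ + QP = -n`.
  obtain ⟨γ, hγP, hγQ⟩ := exists_conj_elementary (P := P) (Q := (-(n : ℚ)⁻¹) • Q) hP
    (by rw [smul_mul_smul_comm, hQ, smul_zero])
    (by rw [mul_smul_comm, smul_mul_assoc, ← smul_add, hPQ, smul_smul, neg_mul_neg,
          inv_mul_cancel₀ hn, one_smul])
  set γ' : Matrix (Fin 2) (Fin 2) ℚ := ((γ⁻¹ : GL (Fin 2) ℚ) : Matrix (Fin 2) (Fin 2) ℚ)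
  have hγγ' : (γ : Matrix (Fin 2) (Fin 2) ℚ) * γ' = 1 := Units.mul_inv γ
  have hγ'γ : γ' * (γ : Matrix (Fin 2) (Fin 2) ℚ) = 1 := Units.inv_mul γ
  have e1 : (γ : Matrix (Fin 2) (Fin 2) ℚ) * φ f * γ' = P := by
    rw [φf, hγP, mul_assoc, hγγ', mul_one]
  have e2 : (γ : Matrix (Fin 2) (Fin 2) ℚ) * φ e * γ' = Q := by
    rw [φe, mul_smul_comm, hγQ, smul_mul_assoc, smul_mul_assoc, smul_mul_assoc, mul_assoc, hγγ',
      mul_one, smul_smul, neg_mul_neg, mul_inv_cancel₀ hn, one_smul]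
  set N := γ' * M * (γ : Matrix (Fin 2) (Fin 2) ℚ) with hN
  have hconj : ∀ X Y : Matrix (Fin 2) (Fin 2) ℚ, (γ' * X * (γ : Matrix (Fin 2) (Fin 2) ℚ)) *
      (γ' * Y * (γ : Matrix (Fin 2) (Fin 2) ℚ)) = γ' * (X * Y) * γ := by
    intro X Y
    simp only [mul_assoc]
    rw [← mul_assoc (γ : Matrix (Fin 2) (Fin 2) ℚ) γ', hγγ', one_mul]
  have hP' : γ' * P * (γ : Matrix (Fin 2) (Fin 2) ℚ) = φ f := by
    rw [← e1]
    simp only [mul_assoc, hγ'γ, mul_one]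
    rw [← mul_assoc, hγ'γ, one_mul]
  have hQ' : γ' * Q * (γ : Matrix (Fin 2) (Fin 2) ℚ) = φ e := by
    rw [← e2]
    simp only [mul_assoc, hγ'γ, mul_one]
    rw [← mul_assoc, hγ'γ, one_mul]
  have n1 : φ f * N + N * φ f = 0 := by
    rw [← hP', hN, hconj, hconj, ← add_mul, ← mul_add, hPM, mul_zero, zero_mul]
  have n2 : φ e * N + N * φ e = 0 := by
    rw [← hQ', hN, hconj, hconj, ← add_mul, ← mul_add, hQM, mul_zero, zero_mul]
  have n3 : N * N = ((n : ℚ) * n) • 1 := by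
    rw [hN, hconj, hMM, mul_smul_comm, smul_mul_assoc, mul_one, hγ'γ]
  -- Anticommuting with `E₁₂` and `E₂₁` forces `N` to be a multiple of `diag(-1, 1)`, and `N² = n²`
  -- leaves only the two signs.
  have hNm : N = φ m ∨ N = -φ m := by
    obtain ⟨x, y, z, w, hxyz⟩ : ∃ x y z w, N = !![x, y; z, w] :=
      ⟨_, _, _, _, Matrix.eta_fin_two N⟩
    rw [hxyz] at n1 n2 n3 ⊢
    have a1 := congrFun (congrFun n1 0) 0
    have a2 := congrFun (congrFun n1 0) 1
    have a3 := congrFun (congrFun n2 0) 0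
    have a4 := congrFun (congrFun n3 0) 0
    simp [φf, φe, hn] at a1 a2 a3 a4
    rw [a1, a3, mul_zero, add_zero] at a4
    have a5 : w = -x := by linarith
    rcases mul_self_eq_mul_self_iff.1 a4 with h' | h'
    · right
      ext i j
      fin_cases i <;> fin_cases j <;> simp [φm, a1, a3, a5, h']
    · left
      ext i j
      fin_cases i <;> fin_cases j <;> simp [φm, a1, a3, a5, h']
  have hM' : (γ : Matrix (Fin 2) (Fin 2) ℚ) * N * γ' = M := by
    rw [hN]
    simp only [mul_assoc, hγγ', mul_one]
    rw [← mul_assoc, hγγ', one_mul]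
  have hspan : ∀ (δ : GL (Fin 2) ℚ) (ε : ℤˣ),
      (∀ x ∈ ({e, m, f} : Set S.extNS), φ ((g : S.extNS ≃ₗ[ℤ] S.extNS) x) =
        (ε : ℤ) • ((δ : Matrix (Fin 2) (Fin 2) ℚ) * φ x *
        ((δ⁻¹ : GL (Fin 2) ℚ) : Matrix (Fin 2) (Fin 2) ℚ))) → S.IsRatAdjoint n H δ ε g := by
    intro δ ε hδ x
    obtain ⟨r, b, s, rfl⟩ := h.exists_latVec x
    have : S.latVec H r b s = r • e + b • m + s • f := by
      simp [e, m, f, latVec_smul, latVec_add]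
    rw [this]
    change φ _ = (ε : ℤ) • (_ * φ _ * _)
    simp only [map_add, map_smul]
    rw [hδ e (by simp), hδ m (by simp), hδ f (by simp)]
    simp only [mul_add, add_mul, mul_smul_comm, smul_mul_assoc, smul_add, smul_comm (ε : ℤ)]
  have hnorm : ∀ {δ : GL (Fin 2) ℚ} {ε : ℤˣ} {k : isometryGroup mukaiGram S.extNS},
      S.IsRatAdjoint n H δ ε k → PreservesTraceless n δ := by
    intro δ ε k hk r b s
    obtain ⟨r', b', s', e'⟩ := h.exists_latVec
      ((ε : ℤ) • (k : S.extNS ≃ₗ[ℤ] S.extNS) (S.latVec H r b s))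
    refine ⟨r', b', s', ?_⟩
    rw [← h.latMat_latVec, ← h.latMat_latVec, ← e', map_smul, hk, smul_smul, ← Units.val_mul,
      Int.units_mul_self]
    simp
  have hfin : ∀ {δ : GL (Fin 2) ℚ} {ε : ℤˣ}, S.IsRatAdjoint n H δ ε g →
      ∃ γ ∈ eichlerNormalizer n, ∃ ε, S.IsRatAdjoint n H γ ε g := fun hδ =>
    ⟨_, mem_eichlerNormalizer_of_preservesTraceless h.n_pos (hnorm hδ) (hnorm hδ.inv), _, hδ⟩
  rcases hNm with hNm | hNm
  · refine hfin (hspan γ 1 ?_)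
    rintro x (rfl | rfl | rfl)
    · rw [Units.val_one, one_smul]; exact e2.symm
    · rw [Units.val_one, one_smul, ← hNm]; exact hM'.symm
    · rw [Units.val_one, one_smul]; exact e1.symm
  -- Conjugation by `diag(1, -1)` negates `e` and `f` and fixes `m`. Combined with `ε = -1` it fixes
  -- `e` and `f` and negates `m`, which is the correction needed.
  · set d : GL (Fin 2) ℚ := Matrix.GeneralLinearGroup.mkOfDetNeZero !![1, 0; 0, -1] (by simp)
    have hd : ∀ X Y : Matrix (Fin 2) (Fin 2) ℚ,
        !![1, 0; 0, -1] * X = Y * !![1, 0; 0, -1] →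
        ((γ * d : GL (Fin 2) ℚ) : Matrix (Fin 2) (Fin 2) ℚ) * X *
          (((γ * d)⁻¹ : GL (Fin 2) ℚ) : Matrix (Fin 2) (Fin 2) ℚ) = γ * Y * γ' := by
      intro X Y hXY
      have hXY' : (d : Matrix (Fin 2) (Fin 2) ℚ) * X = Y * (d : Matrix (Fin 2) (Fin 2) ℚ) := hXY
      rw [mul_inv_rev, Units.val_mul, Units.val_mul, mul_assoc (γ : Matrix (Fin 2) (Fin 2) ℚ), hXY']
      simp only [mul_assoc, Units.mul_inv_cancel_left]
      rfl
    refine hfin (hspan (γ * d) (-1) ?_)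
    rintro x (rfl | rfl | rfl)
    · rw [hd _ (-φ e) (by
        rw [φe]; ext i j; fin_cases i <;> fin_cases j <;> simp)]
      simp only [mul_neg, neg_mul, e2]
      simp [Q]
    · rw [hd _ (φ m) (by
        rw [φm]; ext i j; fin_cases i <;> fin_cases j <;> simp)]
      change M = _
      rw [← hM', hNm]
      simp
    · rw [hd _ (-φ f) (by
        rw [φf]; ext i j; fin_cases i <;> fin_cases j <;> simp)]
      simp only [mul_neg, neg_mul, e1]
      simp [P]

end IsPolarization

end MarkedK3

/-! ### The complex adjoint action and equivariance of the tube map -/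

namespace MarkedK3

variable {S : MarkedK3} {n : ℕ} {H : S.NS}

/-- `ofTraceless` as a linear map on all matrices. -/
def ofTracelessLin (S : MarkedK3) (n : ℕ) (H : S.NS) :
    Matrix (Fin 2) (Fin 2) ℂ →ₗ[ℂ] cplx S.extNS where
  toFun := S.ofTraceless n H
  map_add' A B := by
    rw [ofTraceless, ofTraceless, ofTraceless, extVec_add]
    simp only [Matrix.add_apply]
    congr 1 <;> ring
  map_smul' c A := by
    rw [ofTraceless, ofTraceless, RingHom.id_apply, extVec_smul]
    simp only [Matrix.smul_apply, smul_eq_mul]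
    congr 1 <;> ring

theorem ofTracelessLin_apply (A : Matrix (Fin 2) (Fin 2) ℂ) :
    S.ofTracelessLin n H A = S.ofTraceless n H A := rfl

/-- The two normalizations of the identification with traceless matrices differ by the constant
`1/2`, which commutes with conjugation and so never affects which isometry is obtained. -/
theorem ofTraceless_tracelessMat (hn : 0 < n) (r c s : ℂ) :
    S.ofTraceless n H (tracelessMat n r c s) = (2⁻¹ : ℂ) • S.extVec H r c s := by
  have hn' : (n : ℂ) ≠ 0 := by exact_mod_cast hn.ne'
  rw [ofTraceless, extVec_smul]
  simp only [tracelessMat, Matrix.of_apply, Matrix.cons_val', Matrix.cons_val_zero,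
    Matrix.cons_val_one, Matrix.cons_val_fin_one]
  congr 1 <;> field_simp

theorem trace_tracelessMat {R : Type} [CommRing R] (n : ℕ) (r b s : R) :
    (tracelessMat n r b s).trace = 0 := by
  simp [tracelessMat, Matrix.trace_fin_two]

theorem IsAdjoint.mul {γ γ' : GL (Fin 2) ℂ} {ε ε' : ℤˣ} {g g' : isometryGroup mukaiGram S.extNS}
    (h : S.IsAdjoint n H γ ε g) (h' : S.IsAdjoint n H γ' ε' g') :
    S.IsAdjoint n H (γ * γ') (ε * ε') (g * g') := by
  intro A hA
  rw [Subgroup.coe_mul, map_mul, LinearEquiv.mul_apply, h' A hA, map_zsmul, h _ (by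
    rw [trace_conj, hA]), smul_smul, ← Units.val_mul, mul_comm ε']
  simp only [mul_inv_rev, Units.val_mul, mul_assoc]

/-- Conjugation sees a matrix only up to scalars. This allows passing between rational matrices and
elements of `SL(2, ℝ)`. -/
theorem IsAdjoint.of_eq_smul {γ γ' : GL (Fin 2) ℂ} {ε : ℤˣ} {g : isometryGroup mukaiGram S.extNS}
    (h : S.IsAdjoint n H γ ε g) {c : ℂ}
    (hc : (γ' : Matrix (Fin 2) (Fin 2) ℂ) = c • (γ : Matrix (Fin 2) (Fin 2) ℂ)) :
    S.IsAdjoint n H γ' ε g := by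
  intro A hA
  have e : (γ' : Matrix (Fin 2) (Fin 2) ℂ) * A *
      ((γ'⁻¹ : GL (Fin 2) ℂ) : Matrix (Fin 2) (Fin 2) ℂ) = γ * A *
      ((γ⁻¹ : GL (Fin 2) ℂ) : Matrix (Fin 2) (Fin 2) ℂ) := by
    rw [Units.mul_inv_eq_iff_eq_mul, hc, smul_mul_assoc, mul_smul_comm, mul_assoc, Units.inv_mul,
      mul_one]
  rw [h A hA, e]

namespace IsPolarization

theorem ofTraceless_inj (h : S.IsPolarization n H) {A B : Matrix (Fin 2) (Fin 2) ℂ}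
    (hA : A.trace = 0) (hB : B.trace = 0) (hAB : S.ofTraceless n H A = S.ofTraceless n H B) :
    A = B := by
  obtain ⟨r, c, s, rfl⟩ := exists_tracelessMat h.n_pos hA
  obtain ⟨r', c', s', rfl⟩ := exists_tracelessMat h.n_pos hB
  rw [ofTraceless_tracelessMat h.n_pos, ofTraceless_tracelessMat h.n_pos,
    smul_right_inj (by simp), h.extVec_inj] at hAB
  obtain ⟨rfl, rfl, rfl⟩ := hAB
  rfl

theorem isAdjoint_unique (h : S.IsPolarization n H) {γ : GL (Fin 2) ℂ} {ε : ℤˣ}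
    {g g' : isometryGroup mukaiGram S.extNS} (hg : S.IsAdjoint n H γ ε g)
    (hg' : S.IsAdjoint n H γ ε g') : g = g' := by
  refine Subtype.ext (LinearEquiv.ext fun x => ?_)
  obtain ⟨r, b, s, rfl⟩ := h.exists_latVec x
  have h1 : ∀ k : isometryGroup mukaiGram S.extNS,
      toCplx S.extNS ((k : S.extNS ≃ₗ[ℤ] S.extNS) (S.latVec H r b s)) =
      (2 : ℂ) • cplxAut S.extNS (k : S.extNS ≃ₗ[ℤ] S.extNS)
        (S.ofTraceless n H (tracelessMat n (r : ℂ) b s)) := by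
    intro k
    rw [ofTraceless_tracelessMat h.n_pos, ← toCplx_latVec, map_smul, cplxAut_toCplx, smul_smul,
      mul_inv_cancel₀ two_ne_zero, one_smul]
  have h2 := h1 g
  rw [hg _ (trace_tracelessMat _ _ _ _), ← hg' _ (trace_tracelessMat _ _ _ _), ← h1] at h2
  obtain ⟨r₁, b₁, s₁, e₁⟩ := h.exists_latVec ((g : S.extNS ≃ₗ[ℤ] S.extNS) (S.latVec H r b s))
  obtain ⟨r₂, b₂, s₂, e₂⟩ := h.exists_latVec ((g' : S.extNS ≃ₗ[ℤ] S.extNS) (S.latVec H r b s))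
  rw [e₁, e₂] at h2 ⊢
  rw [toCplx_latVec, toCplx_latVec, h.extVec_inj] at h2
  rw [h.latVec_inj]
  exact_mod_cast h2

theorem isAdjoint_apply_extVec (h : S.IsPolarization n H) {γ : GL (Fin 2) ℂ} {ε : ℤˣ}
    {g : isometryGroup mukaiGram S.extNS} (hg : S.IsAdjoint n H γ ε g) {r c s r' c' s' : ℂ}
    (he : (γ : Matrix (Fin 2) (Fin 2) ℂ) * tracelessMat n r c s = tracelessMat n r' c' s' *
      (γ : Matrix (Fin 2) (Fin 2) ℂ)) :
    cplxAut S.extNS (g : S.extNS ≃ₗ[ℤ] S.extNS) (S.extVec H r c s) =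
      (ε : ℤ) • S.extVec H r' c' s' := by
  have h1 := hg _ (trace_tracelessMat n r c s)
  rw [he, mul_assoc, Units.mul_inv, mul_one, ofTraceless_tracelessMat h.n_pos,
    ofTraceless_tracelessMat h.n_pos, map_smul, smul_comm (ε : ℤ)] at h1
  exact (smul_right_inj (by simp)).1 h1

/-- The hypothesis says `Aγ = εγA` for every traceless `A`. The two elementary nilpotents make `γ`
diagonal with entries `x`, `εx`, and `diag(-1, 1)`, which commutes with it, then forces `ε = 1`. -/
theorem scalar_of_isAdjoint_one (h : S.IsPolarization n H) {γ : GL (Fin 2) ℂ} {ε : ℤˣ}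
    (hg : S.IsAdjoint n H γ ε 1) :
    (∃ c : ℂ, (γ : Matrix (Fin 2) (Fin 2) ℂ) = c • 1) ∧ ε = 1 := by
  have key : ∀ A : Matrix (Fin 2) (Fin 2) ℂ, A.trace = 0 →
      A * (γ : Matrix (Fin 2) (Fin 2) ℂ) = ((ε : ℤ) : ℂ) • (γ * A) := by
    intro A hA
    have h1 := hg A hA
    simp only [Subgroup.coe_one, map_one] at h1
    change S.ofTraceless n H A = _ at h1
    rw [← Int.cast_smul_eq_zsmul ℂ, ← ofTracelessLin_apply, ← ofTracelessLin_apply,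
      ← map_smul] at h1
    have h2 := h.ofTraceless_inj hA (by rw [Matrix.trace_smul, trace_conj, hA, smul_zero]) h1
    conv_lhs => rw [h2]
    rw [smul_mul_assoc, mul_assoc, Units.inv_mul, mul_one]
  have k1 := key !![0, 1; 0, 0] (by simp [Matrix.trace_fin_two])
  have k2 := key !![0, 0; 1, 0] (by simp [Matrix.trace_fin_two])
  have k3 := key !![-1, 0; 0, 1] (by simp [Matrix.trace_fin_two])
  obtain ⟨x, y, z, w, hxyz⟩ : ∃ x y z w, (γ : Matrix (Fin 2) (Fin 2) ℂ) = !![x, y; z, w] :=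
    ⟨_, _, _, _, Matrix.eta_fin_two _⟩
  have hdet := γ.det.ne_zero
  rw [Matrix.GeneralLinearGroup.val_det_apply, hxyz, Matrix.det_fin_two_of] at hdet
  rw [hxyz] at k1 k2 k3
  have a1 := congrFun (congrFun k1 0) 0
  have a2 := congrFun (congrFun k1 0) 1
  have a3 := congrFun (congrFun k2 1) 1
  have a4 := congrFun (congrFun k3 0) 0
  simp at a1 a2 a3 a4
  have hx : x ≠ 0 := by
    rintro rfl
    simp [a1] at hdet
  have hε : ((ε : ℤ) : ℂ) = 1 := (mul_eq_right₀ hx).1 a4.symm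
  rw [hε, one_mul] at a2
  refine ⟨⟨x, ?_⟩, Units.ext (Int.cast_injective (hε.trans Int.cast_one.symm))⟩
  rw [hxyz, a1, a2, a3]
  ext i j
  fin_cases i <;> fin_cases j <;> simp

theorem isAdjoint_one_of_scalar {γ : GL (Fin 2) ℂ} {c : ℂ}
    (hγ : (γ : Matrix (Fin 2) (Fin 2) ℂ) = c • 1) : S.IsAdjoint n H γ 1 1 := by
  have h1 : S.IsAdjoint n H 1 1 1 := fun A _ => by simp
  exact h1.of_eq_smul (c := c) hγ

theorem ofTraceless_latMat (h : S.IsPolarization n H) (x : S.extNS) :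
    S.ofTraceless n H ((S.latMat n H x).map (algebraMap ℚ ℂ)) =
      (2⁻¹ : ℂ) • toCplx S.extNS x := by
  obtain ⟨r, b, s, rfl⟩ := h.exists_latVec x
  rw [h.latMat_latVec, toCplx_latVec, ← ofTraceless_tracelessMat h.n_pos]
  congr 1
  ext i j
  fin_cases i <;> fin_cases j <;> simp [tracelessMat]

theorem isAdjoint_of_isRatAdjoint (h : S.IsPolarization n H) {γ : GL (Fin 2) ℚ} {ε : ℤˣ}
    {g : isometryGroup mukaiGram S.extNS} (hg : S.IsRatAdjoint n H γ ε g) :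
    S.IsAdjoint n H (Matrix.GeneralLinearGroup.map (algebraMap ℚ ℂ) γ) ε g := by
  set γ' := Matrix.GeneralLinearGroup.map (algebraMap ℚ ℂ) γ with hγ'
  have e1 : (γ' : Matrix (Fin 2) (Fin 2) ℂ) =
    (γ : Matrix (Fin 2) (Fin 2) ℚ).map (algebraMap ℚ ℂ) := rfl
  have e2 : ((γ'⁻¹ : GL (Fin 2) ℂ) : Matrix (Fin 2) (Fin 2) ℂ) =
      ((γ⁻¹ : GL (Fin 2) ℚ) : Matrix (Fin 2) (Fin 2) ℚ).map (algebraMap ℚ ℂ) := by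
    rw [hγ', ← map_inv]; rfl
  have key : ∀ x : S.extNS, cplxAut S.extNS (g : S.extNS ≃ₗ[ℤ] S.extNS)
      (S.ofTracelessLin n H ((S.latMat n H x).map (algebraMap ℚ ℂ))) =
      (ε : ℤ) • S.ofTracelessLin n H ((γ' : Matrix (Fin 2) (Fin 2) ℂ) *
        (S.latMat n H x).map (algebraMap ℚ ℂ) *
        ((γ'⁻¹ : GL (Fin 2) ℂ) : Matrix (Fin 2) (Fin 2) ℂ)) := by
    intro x
    have hx := congrArg (fun A => S.ofTracelessLin n H (A.map (algebraMap ℚ ℂ))) (hg x)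
    simp only [ofTracelessLin_apply, h.ofTraceless_latMat] at hx
    rw [ofTracelessLin_apply, h.ofTraceless_latMat, map_smul, cplxAut_toCplx, hx, e1, e2,
      ← Matrix.map_mul, ← Matrix.map_mul, ← map_zsmul (S.ofTracelessLin n H),
      ofTracelessLin_apply]
    congr 1
    ext i j
    rw [Matrix.map_apply, Matrix.smul_apply, Matrix.smul_apply, zsmul_eq_mul, zsmul_eq_mul, map_mul,
      map_intCast, Matrix.map_apply]
  intro A hA
  obtain ⟨r, c, s, rfl⟩ := exists_tracelessMat h.n_pos hA
  have e3 : tracelessMat n r c s =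
      r • (S.latMat n H (S.latVec H 1 0 0)).map (algebraMap ℚ ℂ) +
      c • (S.latMat n H (S.latVec H 0 1 0)).map (algebraMap ℚ ℂ) +
      s • (S.latMat n H (S.latVec H 0 0 1)).map (algebraMap ℚ ℂ) := by
    simp only [h.latMat_latVec]
    ext i j
    fin_cases i <;> fin_cases j <;> simp [tracelessMat, mul_comm]
  rw [← ofTracelessLin_apply, ← ofTracelessLin_apply, e3]
  simp only [map_add, map_smul, mul_add, add_mul, mul_smul_comm, smul_mul_assoc, key, smul_add,
    smul_comm (ε : ℤ)]

/-- The tube domain map is equivariant. -/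
theorem tube_smul (h : S.IsPolarization n H) {γ : GL (Fin 2) ℂ} {ε : ℤˣ}
    {g : isometryGroup mukaiGram S.extNS} (hg : S.IsAdjoint n H γ ε g) (x : OnePoint ℂ) :
    S.tube n H (γ • x) = S.act g (S.tube n H x) := by
  obtain ⟨p, q, r, s, hγ⟩ : ∃ p q r s, (γ : Matrix (Fin 2) (Fin 2) ℂ) = !![p, q; r, s] :=
    ⟨_, _, _, _, Matrix.eta_fin_two _⟩
  have hdet := γ.det.ne_zero
  rw [Matrix.GeneralLinearGroup.val_det_apply, hγ, Matrix.det_fin_two_of] at hdet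
  have h00 : γ 0 0 = p := congrFun (congrFun hγ 0) 0
  have h01 : γ 0 1 = q := congrFun (congrFun hγ 0) 1
  have h10 : γ 1 0 = r := congrFun (congrFun hγ 1) 0
  have h11 : γ 1 1 = s := congrFun (congrFun hγ 1) 1
  have hn : (n : ℂ) ≠ 0 := by exact_mod_cast h.n_pos.ne'
  -- With `v = (τ, 1)` as a column and `J = (0, 1; -1, 0)`, the matrix of `(1, τH, nτ²)` is `n v
  -- vᵀJ`, and the point at infinity gives `v vᵀJ` with `v = (1, 0)`. Conjugation by `γ` turns `v
  -- vᵀJ` into `(γv)(γv)ᵀJ / det γ`; rescaling `γv` to the standard form yields the constants `k`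
  -- below.
  have key : ∀ (v w : cplx S.extNS) (hv : v ≠ 0) (hw : w ≠ 0) (a b c a' b' c' k : ℂ),
      v = S.extVec H a b c → w = S.extVec H a' b' c' → k ≠ 0 →
      (γ : Matrix (Fin 2) (Fin 2) ℂ) * tracelessMat n a b c =
        tracelessMat n (k * a') (k * b') (k * c') * (γ : Matrix (Fin 2) (Fin 2) ℂ) →
      Projectivization.mk ℂ w hw = S.act g (Projectivization.mk ℂ v hv) := by
    rintro v w hv hw a b c a' b' c' k rfl rfl hk he
    have h1 := h.isAdjoint_apply_extVec hg he
    rw [act, Projectivization.smul_mk, eq_comm, Projectivization.mk_eq_mk_iff']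
    refine ⟨(ε : ℤ) * k, ?_⟩
    change _ = cplxAut S.extNS (g : S.extNS ≃ₗ[ℤ] S.extNS) (S.extVec H a b c)
    rw [h1, ← extVec_smul, mul_smul, Int.cast_smul_eq_zsmul]
  induction x with
  | infty =>
    rw [OnePoint.smul_infty_eq_ite, h10, h00]
    by_cases hr : r = 0
    · subst hr
      rw [if_pos rfl]
      have hs : s ≠ 0 := by rintro rfl; simp at hdet
      have hp : p ≠ 0 := by rintro rfl; simp at hdet
      refine key _ _ _ _ 0 0 1 0 0 1 (p / s) rfl rfl (div_ne_zero hp hs) ?_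
      rw [hγ]
      ext i j
      fin_cases i <;> fin_cases j <;> simp [tracelessMat]
      field_simp
    · rw [if_neg hr]
      refine key _ _ _ _ 0 0 1 1 (p / r) (n * (p / r) ^ 2) (r ^ 2 / (n * (p * s - q * r)))
        rfl rfl ?_ ?_
      · exact div_ne_zero (pow_ne_zero 2 hr) (mul_ne_zero hn hdet)
      · rw [hγ]
        generalize hD : p * s - q * r = D at hdet ⊢
        ext i j
        fin_cases i <;> fin_cases j <;> simp [tracelessMat] <;> field_simp <;> subst hD <;> ring
  | coe τ =>
    rw [OnePoint.smul_some_eq_ite, h10, h11, h00, h01]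
    by_cases he : r * τ + s = 0
    · rw [if_pos he]
      obtain rfl : s = -(r * τ) := by linear_combination he
      have hr : r ≠ 0 := by rintro rfl; simp at hdet
      have hm : p * τ + q ≠ 0 := fun h0 => hdet (by linear_combination (-r) * h0)
      refine key _ _ _ _ 1 τ (n * τ ^ 2) 0 0 1 (-(n * (p * τ + q) / r)) rfl rfl
        (neg_ne_zero.2 (div_ne_zero (mul_ne_zero hn hm) hr)) ?_
      rw [hγ]
      ext i j
      fin_cases i <;> fin_cases j <;> simp [tracelessMat] <;> field_simp <;> ring
    · rw [if_neg he]
      refine key _ _ _ _ 1 τ (n * τ ^ 2) 1 ((p * τ + q) / (r * τ + s))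
        (n * ((p * τ + q) / (r * τ + s)) ^ 2) ((r * τ + s) ^ 2 / (p * s - q * r)) rfl rfl
        (div_ne_zero (pow_ne_zero 2 he) hdet) ?_
      rw [hγ]
      generalize hD : p * s - q * r = D at hdet ⊢
      generalize hd : r * τ + s = d at he ⊢
      ext i j
      fin_cases i <;> fin_cases j <;> simp [tracelessMat] <;> field_simp <;>
        subst hD <;> subst hd <;> ring

end IsPolarization

end MarkedK3

/-! ### Primitive matrices and the arithmetic of the Fricke group -/

theorem exists_primitive_quadruple {a b c d : ℤ} (h : ¬(a = 0 ∧ b = 0 ∧ c = 0 ∧ d = 0)) :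
    ∃ e p q r s x y z w : ℤ, e ≠ 0 ∧ a = e * p ∧ b = e * q ∧ c = e * r ∧ d = e * s ∧
      x * p + y * q + z * r + w * s = 1 := by
  obtain ⟨e, he⟩ := (IsPrincipalIdealRing.principal (Ideal.span {a, b, c, d})).principal
  have hdvd : ∀ t ∈ ({a, b, c, d} : Set ℤ), e ∣ t := fun t ht => by
    have : t ∈ Ideal.span {a, b, c, d} := Ideal.subset_span ht
    rw [he] at this
    exact Ideal.mem_span_singleton.1 this
  obtain ⟨p, hp⟩ := hdvd a (by simp)
  obtain ⟨q, hq⟩ := hdvd b (by simp)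
  obtain ⟨r, hr⟩ := hdvd c (by simp)
  obtain ⟨s, hs⟩ := hdvd d (by simp)
  have he0 : e ≠ 0 := by
    rintro rfl
    exact h ⟨by simpa using hp, by simpa using hq, by simpa using hr, by simpa using hs⟩
  have hmem : e ∈ Ideal.span {a, b, c, d} := by
    rw [he]; exact Ideal.mem_span_singleton_self e
  rw [Ideal.mem_span_insert] at hmem
  obtain ⟨x, t₁, ht₁, h₁⟩ := hmem
  rw [Ideal.mem_span_insert] at ht₁
  obtain ⟨y, t₂, ht₂, h₂⟩ := ht₁
  rw [Ideal.mem_span_insert] at ht₂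
  obtain ⟨z, t₃, ht₃, h₃⟩ := ht₂
  obtain ⟨w, h₄⟩ := Ideal.mem_span_singleton'.1 ht₃
  refine ⟨e, p, q, r, s, x, y, z, w, he0, hp, hq, hr, hs, mul_left_cancel₀ he0 ?_⟩
  rw [h₂, h₃, ← h₄] at h₁
  linear_combination x * hp.symm + y * hq.symm + z * hr.symm + w * hs.symm - h₁

/-- Every rational matrix that is not zero is a multiple of a primitive integral one. -/
theorem exists_primitive_multiple {A : Matrix (Fin 2) (Fin 2) ℚ} (hA : A ≠ 0) :
    ∃ (c : ℚ) (p q r s x y z w : ℤ), c ≠ 0 ∧ A = c • !![(p : ℚ), q; r, s] ∧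
      x * p + y * q + z * r + w * s = 1 := by
  have hden : ∀ i j, ((A i j).den : ℚ) ≠ 0 := fun i j => by exact_mod_cast (A i j).den_ne_zero
  have hent : ∀ i j, A i j = (A i j).num / (A i j).den := fun i j => (Rat.num_div_den _).symm
  set N : ℚ := (A 0 0).den * (A 0 1).den * (A 1 0).den * (A 1 1).den with hN
  have hN0 : N ≠ 0 := mul_ne_zero (mul_ne_zero (mul_ne_zero (hden _ _) (hden _ _)) (hden _ _))
    (hden _ _)
  have h00 : N * A 0 0 = ((A 0 0).num * (A 0 1).den * (A 1 0).den * (A 1 1).den : ℤ) := by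
    have := Rat.mul_den_eq_num (A 0 0)
    push_cast
    rw [hN, ← this]; ring
  have h01 : N * A 0 1 = ((A 0 0).den * (A 0 1).num * (A 1 0).den * (A 1 1).den : ℤ) := by
    have := Rat.mul_den_eq_num (A 0 1)
    push_cast
    rw [hN, ← this]; ring
  have h10 : N * A 1 0 = ((A 0 0).den * (A 0 1).den * (A 1 0).num * (A 1 1).den : ℤ) := by
    have := Rat.mul_den_eq_num (A 1 0)
    push_cast
    rw [hN, ← this]; ring
  have h11 : N * A 1 1 = ((A 0 0).den * (A 0 1).den * (A 1 0).den * (A 1 1).num : ℤ) := by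
    have := Rat.mul_den_eq_num (A 1 1)
    push_cast
    rw [hN, ← this]; ring
  generalize ((A 0 0).num * (A 0 1).den * (A 1 0).den * (A 1 1).den : ℤ) = a at h00
  generalize ((A 0 0).den * (A 0 1).num * (A 1 0).den * (A 1 1).den : ℤ) = b at h01
  generalize ((A 0 0).den * (A 0 1).den * (A 1 0).num * (A 1 1).den : ℤ) = c at h10
  generalize ((A 0 0).den * (A 0 1).den * (A 1 0).den * (A 1 1).num : ℤ) = d at h11
  obtain ⟨e, p, q, r, s, x, y, z, w, he, rfl, rfl, rfl, rfl, hB⟩ :=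
    exists_primitive_quadruple (a := a) (b := b) (c := c) (d := d) (by
      rintro ⟨rfl, rfl, rfl, rfl⟩
      simp [hN0] at h00 h01 h10 h11
      exact hA (by ext i j; fin_cases i <;> fin_cases j <;> simp [h00, h01, h10, h11]))
  refine ⟨e / N, p, q, r, s, x, y, z, w, div_ne_zero (by exact_mod_cast he) hN0, ?_, hB⟩
  push_cast at h00 h01 h10 h11
  ext i j
  fin_cases i <;> fin_cases j <;> simp <;> field_simp
  · linear_combination h00
  · linear_combination h01
  · linear_combination h10
  · linear_combination h11

theorem scalar_mem_frickeGroupRat {n : ℕ} {γ : GL (Fin 2) ℚ} {c : ℚ}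
    (h : (γ : Matrix (Fin 2) (Fin 2) ℚ) = c • 1) : γ ∈ frickeGroupRat n :=
  Subgroup.subset_closure (Or.inl (Or.inl ⟨c, h⟩))

/-- The matrix `(0, -1; n, 0)`. -/
def frickeInvolution {n : ℕ} (hn : 0 < n) : GL (Fin 2) ℚ :=
  Matrix.GeneralLinearGroup.mkOfDetNeZero !![0, -1; (n : ℚ), 0] (by
    simpa [Matrix.det_fin_two] using hn.ne')

theorem coe_frickeInvolution {n : ℕ} (hn : 0 < n) :
    (frickeInvolution hn : Matrix (Fin 2) (Fin 2) ℚ) = !![0, -1; (n : ℚ), 0] := rfl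

theorem frickeInvolution_mem_frickeGroupRat {n : ℕ} (hn : 0 < n) :
    frickeInvolution hn ∈ frickeGroupRat n :=
  Subgroup.subset_closure (Or.inr rfl)

/-- The involution exchanges `e` and `f` and sends `m` to `-m`, so it acts on the discriminant group
as `-1`. -/
theorem frickeInvolution_mul_tracelessMat {n : ℕ} (hn : 0 < n) (r b s : ℚ) :
    (frickeInvolution hn : Matrix (Fin 2) (Fin 2) ℚ) * tracelessMat n r b s =
      tracelessMat n s (-b) r * (frickeInvolution hn : Matrix (Fin 2) (Fin 2) ℚ) := by
  rw [coe_frickeInvolution]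
  ext i j
  fin_cases i <;> fin_cases j <;> simp [tracelessMat] <;> ring

theorem frickeInvolution_mem_eichlerNormalizer {n : ℕ} (hn : 0 < n) :
    frickeInvolution hn ∈ eichlerNormalizer n := by
  refine mem_eichlerNormalizer_of_preservesTraceless hn (fun r b s => ⟨s, -b, r, ?_⟩)
    (fun r b s => ⟨s, -b, r, ?_⟩)
  · rw [Units.mul_inv_eq_iff_eq_mul, frickeInvolution_mul_tracelessMat]
    simp
  · rw [inv_inv, mul_assoc, Units.inv_mul_eq_iff_eq_mul, frickeInvolution_mul_tracelessMat]
    simp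

/-- The isometry `Ad(γ)` acts on the discriminant group of the extended Néron-Severi lattice as the
sign `δ`. -/
def ActsBySign (n : ℕ) (γ : GL (Fin 2) ℚ) (δ : ℤˣ) : Prop :=
  ∃ i j k : ℤ, (γ : Matrix (Fin 2) (Fin 2) ℚ) * tracelessMat n (0 : ℚ) 1 0 =
    tracelessMat n (2 * n * i : ℚ) ((δ : ℤ) + 2 * n * j) (2 * n * k) *
      (γ : Matrix (Fin 2) (Fin 2) ℚ)

theorem mem_frickeGroupRat_of_actsBySign_one {n : ℕ} (hn : 0 < n) {γ : GL (Fin 2) ℚ}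
    (hγ : γ ∈ eichlerNormalizer n) (hdet : 0 < (γ : Matrix (Fin 2) (Fin 2) ℚ).det)
    (h : ActsBySign n γ 1) : γ ∈ frickeGroupRat n := by
  have hn' : (n : ℚ) ≠ 0 := by exact_mod_cast hn.ne'
  obtain ⟨c, p, q, r, s, x, y, z, w, hc, hA, hB⟩ :=
    exists_primitive_multiple (A := (γ : Matrix (Fin 2) (Fin 2) ℚ)) (by
      intro h0; rw [h0] at hdet; simp at hdet)
  set D : ℤ := p * s - q * r with hD
  have hDpos : 0 < D := by
    rw [hA, Matrix.det_smul, Matrix.det_fin_two_of, Fintype.card_fin] at hdet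
    have : (0 : ℚ) < p * s - q * r := pos_of_mul_pos_right hdet (sq_nonneg c)
    exact_mod_cast this
  -- Replacing the inverse by the adjugate clears denominators: the entries of `A X adj(A)` are
  -- quadratic in `p, q, r, s`, and they equal `D` times the entries of an element of the lattice.
  have hcancel : ∀ {X Y : Matrix (Fin 2) (Fin 2) ℚ}, (γ : Matrix (Fin 2) (Fin 2) ℚ) * X =
      Y * (γ : Matrix (Fin 2) (Fin 2) ℚ) →
      !![(p : ℚ), q; r, s] * X * !![(s : ℚ), -q; -r, p] = (D : ℚ) • Y := by
    intro X Y hXY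
    rw [hA, smul_mul_assoc, mul_smul_comm, smul_right_inj hc] at hXY
    rw [hXY, mul_assoc]
    have : !![(p : ℚ), q; r, s] * !![(s : ℚ), -q; -r, p] = (D : ℚ) • 1 := by
      ext i j
      fin_cases i <;> fin_cases j <;> simp [hD] <;> ring
    rw [this, mul_smul_comm, mul_one]
  have hpres := preservesTraceless_of_mem_eichlerNormalizer hn hγ
  obtain ⟨r₁, b₁, s₁, h₁⟩ := hpres 0 0 1
  obtain ⟨r₂, b₂, s₂, h₂⟩ := hpres 1 0 0
  obtain ⟨i, j, k, h₃⟩ := h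
  have k₁ := hcancel ((Units.mul_inv_eq_iff_eq_mul _).1 h₁)
  have k₂ := hcancel ((Units.mul_inv_eq_iff_eq_mul _).1 h₂)
  have k₃ := hcancel h₃
  have f1 := congrFun (congrFun k₁ 0) 1
  have f2 := congrFun (congrFun k₁ 1) 0
  have f3 := congrFun (congrFun k₁ 1) 1
  have f4 := congrFun (congrFun k₂ 0) 1
  have f5 := congrFun (congrFun k₂ 1) 0
  have f6 := congrFun (congrFun k₂ 1) 1
  have f7 := congrFun (congrFun k₃ 0) 1
  have f8 := congrFun (congrFun k₃ 1) 0
  have f9 := congrFun (congrFun k₃ 1) 1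
  simp [tracelessMat] at f1 f2 f3 f4 f5 f6 f7 f8 f9
  have e1 : p * p = D * s₁ := by exact_mod_cast f1
  have e2 : r * r = D * (n * r₁) := by
    have : (r : ℚ) * r = D * (n * r₁) := by linear_combination f2
    exact_mod_cast this
  have e3 : p * r = D * (n * b₁) := by
    have : (p : ℚ) * r = D * (n * b₁) := by linear_combination f3
    exact_mod_cast this
  have e4 : n * (q * q) = D * s₂ := by
    have : (n : ℚ) * (q * q) = D * s₂ := by linear_combination f4
    exact_mod_cast this
  have e5 : s * s = D * r₂ := by
    have : (s : ℚ) * s = D * r₂ := mul_left_cancel₀ hn' (by linear_combination f5)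
    exact_mod_cast this
  have e6 : q * s = D * b₂ := by
    have : (q : ℚ) * s = D * b₂ := mul_left_cancel₀ hn' (by linear_combination f6)
    exact_mod_cast this
  have e7 : p * q = D * k := by
    have : (p : ℚ) * q = D * k :=
      mul_left_cancel₀ (mul_ne_zero two_ne_zero hn') (by linear_combination f7)
    exact_mod_cast this
  have e8 : r * s = D * (n * i) := by
    have : (r : ℚ) * s = D * (n * i) :=
      mul_left_cancel₀ (mul_ne_zero two_ne_zero hn') (by linear_combination -f8)
    exact_mod_cast this
  have e9 : p * s + q * r = D * (1 + 2 * n * j) := by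
    have : (p : ℚ) * s + q * r = D * (1 + 2 * n * j) :=
      mul_left_cancel₀ hn' (by linear_combination f9)
    exact_mod_cast this
  have e10 : q * r = D * (n * j) := by linarith
  have e11 : p * s = D * (1 + n * j) := by linarith
  -- The relation `e4` controls only `nq²`. Divisibility of `q²` itself comes from `D q² = (pq)(qs)
  -- - q²(qr)`, where the factor `n` in `qr = Dnj` is absorbed by `nq² = Ds₂`. Here the action on
  -- the discriminant is essential.
  have e12 : q * q = D * (k * b₂ - s₂ * j) := by
    apply mul_left_cancel₀ hDpos.ne'
    linear_combination (q * q) * hD + (q * s) * e7 + D * k * e6 - (q * q) * e10 - D * j * e4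
  -- Now `D` divides every product of two entries, hence also `(xp + yq + zr + ws)² = 1`.
  have hD1 : D = 1 := by
    refine Int.eq_one_of_dvd_one hDpos.le ⟨x * x * s₁ + y * y * (k * b₂ - s₂ * j) +
      z * z * (n * r₁) + w * w * r₂ + 2 * x * y * k + 2 * x * z * (n * b₁) +
      2 * x * w * (1 + n * j) + 2 * y * z * (n * j) + 2 * y * w * b₂ + 2 * z * w * (n * i), ?_⟩
    linear_combination -(1 + (x * p + y * q + z * r + w * s)) * hB + x * x * e1 + y * y * e12 +
      z * z * e2 + w * w * e5 + 2 * x * y * e7 + 2 * x * z * e3 + 2 * x * w * e11 +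
      2 * y * z * e10 + 2 * y * w * e6 + 2 * z * w * e8
  -- Multiply `1 = ps - qr` by `r` and use that `rs` and `qr` are divisible by `n`.
  have hr : r = n * (p * i - r * j) := by
    rw [hD1] at e8 e10 hD
    linear_combination r * hD + p * e8 - r * e10
  have hM : (!![p, q; r, s] : Matrix (Fin 2) (Fin 2) ℤ).det = 1 := by
    rw [Matrix.det_fin_two_of]; linarith
  set M : SL(2, ℤ) := ⟨!![p, q; r, s], hM⟩
  have hMG : M ∈ CongruenceSubgroup.Gamma0 n := by
    rw [CongruenceSubgroup.Gamma0_mem]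
    change ((r : ℤ) : ZMod n) = 0
    rw [ZMod.intCast_zmod_eq_zero_iff_dvd]
    exact ⟨_, hr⟩
  set M' : GL (Fin 2) ℚ := Matrix.GeneralLinearGroup.mkOfDetNeZero !![(p : ℚ), q; r, s] (by
    rw [Matrix.det_fin_two_of]
    have : (p : ℚ) * s - q * r = 1 := by exact_mod_cast hD.symm.trans hD1
    rw [this]; exact one_ne_zero)
  have hM' : M' ∈ frickeGroupRat n := by
    refine Subgroup.subset_closure (Or.inl (Or.inr ⟨M, hMG, ?_⟩))
    ext i j
    fin_cases i <;> fin_cases j <;> rfl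
  have : γ = (γ * M'⁻¹) * M' := by simp
  rw [this]
  refine mul_mem (scalar_mem_frickeGroupRat (c := c) ?_) hM'
  rw [Units.val_mul, hA, smul_mul_assoc]
  congr 1
  exact Units.mul_inv M'

theorem ActsBySign.frickeInvolution_mul {n : ℕ} (hn : 0 < n) {γ : GL (Fin 2) ℚ} {δ : ℤˣ}
    (h : ActsBySign n γ δ) : ActsBySign n (frickeInvolution hn * γ) (-δ) := by
  obtain ⟨i, j, k, h⟩ := h
  refine ⟨k, -j, i, ?_⟩
  rw [Units.val_mul, mul_assoc, h, ← mul_assoc, frickeInvolution_mul_tracelessMat, mul_assoc]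
  congr 2
  push_cast
  ring

/-- Multiplication by the Fricke involution reverses the sign and keeps the determinant positive,
which reduces the sign `-1` to the sign `+1`. -/
theorem mem_frickeGroupRat_of_actsBySign {n : ℕ} (hn : 0 < n) {γ : GL (Fin 2) ℚ}
    (hγ : γ ∈ eichlerNormalizer n) (hdet : 0 < (γ : Matrix (Fin 2) (Fin 2) ℚ).det) {δ : ℤˣ}
    (h : ActsBySign n γ δ) : γ ∈ frickeGroupRat n := by
  rcases Int.units_eq_one_or δ with rfl | rfl
  · exact mem_frickeGroupRat_of_actsBySign_one hn hγ hdet h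
  · have h1 := h.frickeInvolution_mul hn
    rw [neg_neg] at h1
    refine (Subgroup.mul_mem_cancel_left _ (frickeInvolution_mem_frickeGroupRat hn)).1
      (mem_frickeGroupRat_of_actsBySign_one hn
        (mul_mem (frickeInvolution_mem_eichlerNormalizer hn) hγ) ?_ h1)
    rw [Units.val_mul, Matrix.det_mul, coe_frickeInvolution, Matrix.det_fin_two_of]
    have : (0 : ℚ) < n := by exact_mod_cast hn
    exact mul_pos (by simpa using this) hdet

/-! ### The group `Γ(S)` in terms of matrices -/

namespace MarkedK3.IsPolarization

variable {S : MarkedK3} {n : ℕ} {H : S.NS}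

/-- This translates the congruence `γ m ≡ ±m` modulo `2nL` into matrices. The sign `ε` is absorbed
into `δ`, so membership depends on `γ` alone. -/
theorem mem_Gam_iff_actsBySign (h : S.IsPolarization n H) {γ : GL (Fin 2) ℚ} {ε : ℤˣ}
    {g : isometryGroup mukaiGram S.extNS} (hg : S.IsRatAdjoint n H γ ε g) :
    g ∈ S.Gam ↔ ∃ δ, ActsBySign n γ δ := by
  have hm : S.latMat n H (S.latVec H 0 1 0) = tracelessMat n 0 1 0 := by
    rw [h.latMat_latVec]; simp
  have hgm := hg (S.latVec H 0 1 0)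
  rw [hm] at hgm
  have hsm : ∀ k i j l : ℤ, k • tracelessMat n (i : ℚ) j l =
      tracelessMat n ((k * i : ℤ) : ℚ) (k * j : ℤ) (k * l : ℤ) := by
    intro k i j l
    rw [← h.latMat_latVec, ← h.latMat_latVec, ← map_smul, latVec_smul]
  rw [h.mem_Gam_iff]
  constructor
  · rintro ⟨δ, l, hl⟩
    obtain ⟨i, j, k, rfl⟩ := h.exists_latVec l
    refine ⟨ε * δ, ε * i, ε * j, ε * k, ?_⟩
    rw [← Units.mul_inv_eq_iff_eq_mul]
    have h1 := congrArg (fun A => (ε : ℤ) • A) hgm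
    simp only [smul_smul, ← Units.val_mul, Int.units_mul_self, Units.val_one, one_smul] at h1
    rw [← h1, hl, latVec_smul, latVec_smul, latVec_add, h.latMat_latVec, hsm]
    congr 1 <;> push_cast <;> ring
  · rintro ⟨δ, i, j, k, hA⟩
    refine ⟨ε * δ, S.latVec H (ε * i) (ε * j) (ε * k), h.latMat_injective ?_⟩
    rw [hgm, (Units.mul_inv_eq_iff_eq_mul _).2 hA, latVec_smul, latVec_smul, latVec_add,
      h.latMat_latVec]
    have h1 := hsm ε (2 * n * i) (δ + 2 * n * j) (2 * n * k)
    push_cast at h1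
    rw [h1]
    congr 1 <;> push_cast <;> ring

/-- Conjugation by an element of the group generated by the scalars, `Γ₀(n)` and `(0, -1; n, 0)` is
an isometry in `Γ(S)`. -/
theorem exists_mem_Gam_of_mem_frickeGroupRat (h : S.IsPolarization n H) {γ : GL (Fin 2) ℚ}
    (hγ : γ ∈ frickeGroupRat n) : γ ∈ eichlerNormalizer n ∧
      0 < (γ : Matrix (Fin 2) (Fin 2) ℚ).det ∧ ∃ g ∈ S.Gam, S.IsRatAdjoint n H γ 1 g := by
  have key : ∀ (γ : GL (Fin 2) ℚ) (δ : ℤˣ), γ ∈ eichlerNormalizer n → ActsBySign n γ δ →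
      ∃ g ∈ S.Gam, S.IsRatAdjoint n H γ 1 g := by
    intro γ δ hγ hδ
    obtain ⟨g, hg⟩ := h.exists_isRatAdjoint hγ 1
    exact ⟨g, (h.mem_Gam_iff_actsBySign hg).2 ⟨δ, hδ⟩, hg⟩
  induction hγ using Subgroup.closure_induction with
  | mem γ hγ =>
    rcases hγ with (⟨c, hc⟩ | ⟨M, hM, hγM⟩) | hγ
    · have hN : γ ∈ eichlerNormalizer n := by
        intro A
        have : (γ : Matrix (Fin 2) (Fin 2) ℚ) * A *
            ((γ⁻¹ : GL (Fin 2) ℚ) : Matrix (Fin 2) (Fin 2) ℚ) = A := by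
          rw [Units.mul_inv_eq_iff_eq_mul, hc]; simp
        rw [this]
      refine ⟨hN, ?_, key γ 1 hN ⟨0, 0, 0, ?_⟩⟩
      · have := γ.det.ne_zero
        rw [Matrix.GeneralLinearGroup.val_det_apply] at this
        rw [hc, Matrix.det_smul, Matrix.det_one, mul_one, Fintype.card_fin] at this ⊢
        positivity
      · rw [hc]; simp
    · obtain ⟨r₀, hr₀⟩ : (n : ℤ) ∣ M 1 0 := by
        rw [CongruenceSubgroup.Gamma0_mem] at hM
        exact (ZMod.intCast_zmod_eq_zero_iff_dvd _ _).1 hM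
      have hdetM := M.det_coe
      rw [Matrix.det_fin_two, hr₀] at hdetM
      have hγ' : (γ : Matrix (Fin 2) (Fin 2) ℚ) =
          !![((M 0 0 : ℤ) : ℚ), (M 0 1 : ℤ); (n : ℚ) * r₀, (M 1 1 : ℤ)] := by
        rw [hγM]
        ext i j
        fin_cases i <;> fin_cases j <;> simp [hr₀]
      generalize M 0 0 = p at hdetM hγ'
      generalize M 0 1 = q at hdetM hγ'
      generalize M 1 1 = s at hdetM hγ'
      have hdet : (p : ℚ) * s - q * (n * r₀) = 1 := by exact_mod_cast hdetM
      have hinv : ((γ⁻¹ : GL (Fin 2) ℚ) : Matrix (Fin 2) (Fin 2) ℚ) =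
          !![(s : ℚ), (-q : ℤ); (n : ℚ) * (-r₀ : ℤ), p] := by
        apply Units.inv_eq_of_mul_eq_one_right
        rw [hγ']
        ext i j
        fin_cases i <;> fin_cases j <;> simp <;>
          first | ring1 | linear_combination hdet
      have hN : γ ∈ eichlerNormalizer n := by
        have m1 : (γ : Matrix (Fin 2) (Fin 2) ℚ) ∈ eichlerOrder n := ⟨p, q, r₀, s, hγ'⟩
        have m2 : ((γ⁻¹ : GL (Fin 2) ℚ) : Matrix (Fin 2) (Fin 2) ℚ) ∈ eichlerOrder n :=
          ⟨s, -q, -r₀, p, hinv⟩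
        refine fun A => ⟨fun hA => mul_mem (mul_mem m1 hA) m2, fun hA => ?_⟩
        have := mul_mem (mul_mem m2 hA) m1
        simpa only [mul_assoc, Units.inv_mul_cancel_left, Units.inv_mul, mul_one] using this
      -- The coefficients come from conjugating `diag(-n, n)`: the off-diagonal entries are `2npq`
      -- and `-2n(nr₀)s`, and the lower diagonal entry is `n(ps + nqr₀) = n(1 + 2nqr₀)`.
      refine ⟨hN, ?_, key γ 1 hN ⟨r₀ * s, q * r₀, p * q, ?_⟩⟩
      · rw [hγ', Matrix.det_fin_two_of, hdet]; exact one_pos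
      · rw [hγ']
        ext i j
        fin_cases i <;> fin_cases j <;> simp [tracelessMat]
        · ring
        · linear_combination -(2 * (n : ℚ) * q) * hdet
        · linear_combination (2 * (n : ℚ) * r₀ * n) * hdet
        · ring
    · have hγ' : γ = frickeInvolution h.n_pos := Units.ext hγ
      subst hγ'
      refine ⟨frickeInvolution_mem_eichlerNormalizer _, ?_,
        key _ (-1) (frickeInvolution_mem_eichlerNormalizer _) ?_⟩
      · rw [coe_frickeInvolution, Matrix.det_fin_two_of]
        have := h.n_pos
        simpa using this
      · have := ActsBySign.frickeInvolution_mul h.n_pos (γ := 1) (δ := 1) ⟨0, 0, 0, by simp⟩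
        rwa [mul_one] at this
  | one =>
    exact ⟨one_mem _, by simp, 1, one_mem _, by
      intro x
      simp⟩
  | mul γ γ' _ _ ih ih' =>
    obtain ⟨h1, h2, g, hg, hγ⟩ := ih
    obtain ⟨h1', h2', g', hg', hγ'⟩ := ih'
    refine ⟨mul_mem h1 h1', ?_, g * g', mul_mem hg hg', ?_⟩
    · rw [Units.val_mul, Matrix.det_mul]; exact mul_pos h2 h2'
    · simpa using hγ.mul hγ'
  | inv γ _ ih =>
    obtain ⟨h1, h2, g, hg, hγ⟩ := ih
    refine ⟨inv_mem h1, ?_, g⁻¹, inv_mem hg, hγ.inv⟩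
    have : (γ : Matrix (Fin 2) (Fin 2) ℚ).det *
        ((γ⁻¹ : GL (Fin 2) ℚ) : Matrix (Fin 2) (Fin 2) ℚ).det = 1 := by
      rw [← Matrix.det_mul, Units.mul_inv, Matrix.det_one]
    exact pos_of_mul_pos_right (this ▸ one_pos) h2.le

end MarkedK3.IsPolarization

/-! ### The affine chart of the projective space and the tube domain -/

namespace MarkedK3

/-- The coordinate `r` of `(r, cH, s)`. -/
def fstCoord (S : MarkedK3) : cplx S.extNS →ₗ[ℂ] ℂ :=
  (LinearMap.proj (Sum.inr 0)).comp (cplx S.extNS).subtype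

/-- The coordinate `c` of `(r, cH, s)`. -/
def midCoord (S : MarkedK3) (n : ℕ) (H : S.NS) : cplx S.extNS →ₗ[ℂ] ℂ :=
  (2 * n : ℂ)⁻¹ • (latticeFunctional k3Gram (castVec (H : K3Index → ℤ))).comp
    ((LinearMap.funLeft ℂ ℂ Sum.inl).comp (cplx S.extNS).subtype)

/-- The lines `ℂ(r, cH, s)` with `r ≠ 0` and `c / r ∈ W`. -/
def chartSet (S : MarkedK3) (n : ℕ) (H : S.NS) (W : Set ℂ) : Set (ℙ ℂ (cplx S.extNS)) :=
  {p | S.fstCoord p.rep ≠ 0 ∧ S.midCoord n H p.rep / S.fstCoord p.rep ∈ W}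

variable {S : MarkedK3} {n : ℕ} {H : S.NS}

theorem fstCoord_extVec (r c s : ℂ) : S.fstCoord (S.extVec H r c s) = r := rfl

/-- The conditions are homogeneous of degree zero, so any representative may replace the chosen one.
This makes the chart a tool for proving openness in the quotient topology. -/
theorem mk_mem_chartSet {W : Set ℂ} {v : cplx S.extNS} (hv : v ≠ 0) :
    Projectivization.mk ℂ v hv ∈ S.chartSet n H W ↔
      S.fstCoord v ≠ 0 ∧ S.midCoord n H v / S.fstCoord v ∈ W := by
  obtain ⟨a, ha⟩ := Projectivization.exists_smul_eq_mk_rep ℂ v hv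
  rw [chartSet, Set.mem_ofPred_eq, ← ha, Units.smul_def, map_smul, map_smul, smul_eq_mul,
    smul_eq_mul, mul_div_mul_left _ _ a.ne_zero, Ne, mul_eq_zero, or_iff_right a.ne_zero]

theorem continuous_fstCoord : Continuous S.fstCoord :=
  LinearMap.continuous_of_finiteDimensional _

theorem continuous_midCoord : Continuous (S.midCoord n H) :=
  LinearMap.continuous_of_finiteDimensional _

theorem isOpen_fstCoord_midCoord {W : Set ℂ} (hW : IsOpen W) :
    IsOpen {v : cplx S.extNS | S.fstCoord v ≠ 0 ∧ S.midCoord n H v / S.fstCoord v ∈ W} := by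
  have h1 : IsOpen {v : cplx S.extNS | S.fstCoord v ≠ 0} :=
    isOpen_ne_fun continuous_fstCoord continuous_const
  have h2 : ContinuousOn (fun v => S.midCoord n H v / S.fstCoord v)
      {v : cplx S.extNS | S.fstCoord v ≠ 0} :=
    continuous_midCoord.continuousOn.div continuous_fstCoord.continuousOn fun _ h => h
  exact h2.isOpen_inter_preimage h1 hW

theorem isOpen_chartSet {W : Set ℂ} (hW : IsOpen W) : IsOpen (S.chartSet n H W) := by
  rw [isOpen_coinduced]
  have := (isOpen_fstCoord_midCoord (S := S) (n := n) (H := H) hW).preimage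
    (continuous_subtype_val (p := fun v : cplx S.extNS => v ≠ 0))
  convert this using 1
  ext v
  exact mk_mem_chartSet v.2

theorem continuous_extVec {X : Type*} [TopologicalSpace X] {r c s : X → ℂ} (hr : Continuous r)
    (hc : Continuous c) (hs : Continuous s) :
    Continuous fun x => S.extVec H (r x) (c x) (s x) := by
  refine Continuous.subtype_mk (continuous_pi fun i => ?_) _
  rcases i with i | i
  · exact hc.mul continuous_const
  · fin_cases i
    · exact hr
    · exact hs

theorem tube_coe (τ : ℂ) : S.tube n H (τ : OnePoint ℂ) = Projectivization.mk ℂ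
    (S.extVec H 1 τ (n * τ ^ 2)) (S.extVec_ne_zero_left H one_ne_zero _ _) := rfl

theorem tube_infty : S.tube n H OnePoint.infty = Projectivization.mk ℂ
    (S.extVec H 0 0 1) (S.extVec_ne_zero_right H one_ne_zero _ _) := rfl

theorem continuous_tube : Continuous fun τ : ℂ => S.tube n H (τ : OnePoint ℂ) := by
  have h1 : Continuous (Projectivization.mk' ℂ : {v : cplx S.extNS // v ≠ 0} → _) :=
    continuous_coinduced_rng
  have h2 : Continuous fun τ : ℂ => (⟨S.extVec H 1 τ (n * τ ^ 2),
      S.extVec_ne_zero_left H one_ne_zero _ _⟩ : {v : cplx S.extNS // v ≠ 0}) :=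
    Continuous.subtype_mk (continuous_extVec continuous_const continuous_id (by fun_prop)) _
  exact h1.comp h2

namespace IsPolarization

theorem midCoord_extVec (h : S.IsPolarization n H) (r c s : ℂ) :
    S.midCoord n H (S.extVec H r c s) = c := by
  have hn : (n : ℂ) ≠ 0 := by exact_mod_cast h.n_pos.ne'
  change (2 * n : ℂ)⁻¹ * latticeForm k3Gram (castVec (H : K3Index → ℤ))
    (c • castVec (H : K3Index → ℤ)) = c
  rw [latticeForm_smul_right, latticeForm_castVec, h.degree]
  push_cast
  field_simp

theorem tube_mem_chartSet (h : S.IsPolarization n H) {W : Set ℂ} {τ : ℂ} :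
    S.tube n H (τ : OnePoint ℂ) ∈ S.chartSet n H W ↔ τ ∈ W := by
  rw [tube_coe, mk_mem_chartSet, fstCoord_extVec, h.midCoord_extVec, div_one]
  exact and_iff_right one_ne_zero

theorem infty_notMem_chartSet {W : Set ℂ} : S.tube n H OnePoint.infty ∉ S.chartSet n H W := by
  rw [tube_infty, mk_mem_chartSet, fstCoord_extVec]
  exact fun h => h.1 rfl

theorem tube_injective (h : S.IsPolarization n H) : Function.Injective (S.tube n H) := by
  intro x y hxy
  have key : ∀ (x : OnePoint ℂ) (τ : ℂ), S.tube n H x = S.tube n H (τ : OnePoint ℂ) →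
      x = (τ : OnePoint ℂ) := by
    intro x τ hx
    have h1 : S.tube n H x ∈ S.chartSet n H {τ} := hx ▸ h.tube_mem_chartSet.2 rfl
    induction x with
    | infty => exact absurd h1 infty_notMem_chartSet
    | coe σ => rw [h.tube_mem_chartSet.1 h1]
  induction y with
  | infty =>
    induction x with
    | infty => rfl
    | coe τ => exact (key _ _ hxy.symm).symm
  | coe τ => exact key _ _ hxy

/-! ### The period domain -/

theorem mk_eq_tube (h : S.IsPolarization n H) {v : cplx S.extNS} (hv : v ≠ 0) {r c s : ℂ}
    (he : v = S.extVec H r c s) (hr : r ≠ 0) (hrs : r * s = n * c ^ 2) :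
    Projectivization.mk ℂ v hv = S.tube n H ((c / r : ℂ) : OnePoint ℂ) := by
  rw [tube_coe, Projectivization.mk_eq_mk_iff']
  refine ⟨r, ?_⟩
  rw [he, extVec_smul, h.extVec_inj]
  refine ⟨mul_one r, by field_simp, ?_⟩
  field_simp
  linear_combination -hrs

theorem form_star_tubeVec (h : S.IsPolarization n H) (τ : ℂ) :
    latticeForm mukaiGram (S.extVec H 1 τ (n * τ ^ 2) : MukaiIndex → ℂ)
      (star (S.extVec H 1 τ (n * τ ^ 2) : MukaiIndex → ℂ)) = (4 * n * τ.im ^ 2 : ℝ) := by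
  rw [star_extVec, h.form_extVec]
  apply Complex.ext
  · simp [pow_two]; ring
  · simp [pow_two]; ring

theorem mem_Omega_iff (h : S.IsPolarization n H) {p : ℙ ℂ (cplx S.extNS)} :
    p ∈ S.Omega ↔ ∃ τ : ℂ, τ.im ≠ 0 ∧ p = S.tube n H (τ : OnePoint ℂ) := by
  have hn : (n : ℂ) ≠ 0 := by exact_mod_cast h.n_pos.ne'
  have hn' : (0 : ℝ) < n := by exact_mod_cast h.n_pos
  constructor
  · rintro ⟨v, hv, rfl, h1, h2⟩
    obtain ⟨r, c, s, he⟩ := h.exists_extVec v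
    rw [he, h.form_extVec] at h1
    have hrs : r * s = n * c ^ 2 := by linear_combination -h1 / 2
    -- If `r = 0`, isotropy gives `c = 0`, and then `(v, v̄) = 0`, against positivity.
    have hr : r ≠ 0 := by
      rintro rfl
      have hc : c = 0 := by simpa [hn] using hrs
      rw [he, star_extVec, h.form_extVec, hc] at h2
      simp at h2
    refine ⟨c / r, ?_, h.mk_eq_tube hv he hr hrs⟩
    have hv' : v = r • S.extVec H 1 (c / r) (n * (c / r) ^ 2) := by
      rw [he, extVec_smul, h.extVec_inj]
      refine ⟨(mul_one r).symm, by field_simp, ?_⟩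
      field_simp
      linear_combination hrs
    intro h0
    rw [hv', Submodule.coe_smul, star_smul, latticeForm_smul_left, latticeForm_smul_right,
      h.form_star_tubeVec, h0] at h2
    simp at h2
  · rintro ⟨τ, hτ, rfl⟩
    refine ⟨_, _, rfl, ?_, ?_⟩
    · rw [h.form_extVec]; ring
    · rw [h.form_star_tubeVec, Complex.ofReal_re]
      positivity

/-- For the ample class `kH` of degree `2nk²`, the normalizing factor `√(2 / 2nk²)` times `k` is
`1/√n`: the base point is the fixed point `i/√n` of the Fricke involution. -/
theorem basePoint_eq (h : S.IsPolarization n H) :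
    S.basePoint = S.tube n H ((((√n)⁻¹ : ℝ) * Complex.I : ℂ) : OnePoint ℂ) := by
  obtain ⟨k, hk, hn, e⟩ := h.exists_ample_eq
  have hn' : (0 : ℝ) < n := by exact_mod_cast hn
  have hk' : (0 : ℝ) < k := by exact_mod_cast hk
  have h1 : Real.sqrt (2 / (latticeForm k3Gram S.ample S.ample : ℤ)) * k = (√n)⁻¹ := by
    rw [e, latticeForm_smul_left, latticeForm_smul_right, h.degree]
    have : (2 : ℝ) / ((k * (k * (2 * n)) : ℤ) : ℝ) = ((k : ℝ)⁻¹) ^ 2 * (n : ℝ)⁻¹ := by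
      push_cast
      field_simp
    rw [this, Real.sqrt_mul (sq_nonneg _), Real.sqrt_sq (inv_pos.2 hk').le, Real.sqrt_inv]
    field_simp
  have h2 : S.extVec S.ampleNS 1
      ((Real.sqrt (2 / (latticeForm k3Gram S.ample S.ample : ℤ)) : ℝ) * Complex.I) (-1) =
      S.extVec H 1 ((((√n)⁻¹ : ℝ) : ℂ) * Complex.I) (-1) := by
    rw [← h1]
    apply Subtype.ext
    have h3 : castVec (S.ampleNS : K3Index → ℤ) = (k : ℂ) • castVec (H : K3Index → ℤ) := by
      change castVec S.ample = _
      rw [e]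
      ext i
      simp [castVec]
    simp only [extVec]
    rw [h3, smul_smul]
    push_cast
    congr 2
    ring
  have h4 : (1 : ℂ) * (-1) = n * (((((√n)⁻¹ : ℝ) : ℂ) * Complex.I)) ^ 2 := by
    rw [mul_pow, Complex.I_sq, ← Complex.ofReal_pow, inv_pow, Real.sq_sqrt hn'.le]
    have : (n : ℂ) ≠ 0 := by exact_mod_cast hn.ne'
    push_cast
    field_simp
  have := h.mk_eq_tube (S.extVec_ne_zero_left _ one_ne_zero _ _) h2 one_ne_zero h4
  rw [div_one] at this
  exact this

/-- The image of the upper half plane is connected and contains the base point. The charts over the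
two half planes are disjoint open sets covering the period domain, so the component cannot reach the
lower one. -/
theorem OmegaPlus_eq (h : S.IsPolarization n H) :
    S.OmegaPlus = (fun τ : ℂ => S.tube n H (τ : OnePoint ℂ)) '' {τ | 0 < τ.im} := by
  have hn' : (0 : ℝ) < n := by exact_mod_cast h.n_pos
  have hbase : S.basePoint ∈ (fun τ : ℂ => S.tube n H (τ : OnePoint ℂ)) '' {τ | 0 < τ.im} := by
    refine ⟨_, ?_, h.basePoint_eq.symm⟩
    rw [Set.mem_ofPred_eq, Complex.im_ofReal_mul, Complex.I_im, mul_one]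
    exact inv_pos.2 (Real.sqrt_pos.2 hn')
  have hsub : (fun τ : ℂ => S.tube n H (τ : OnePoint ℂ)) '' {τ | 0 < τ.im} ⊆ S.Omega := by
    rintro _ ⟨τ, hτ, rfl⟩
    exact h.mem_Omega_iff.2 ⟨τ, ne_of_gt hτ, rfl⟩
  apply subset_antisymm
  · have h1 : S.OmegaPlus ⊆ S.Omega := connectedComponentIn_subset _ _
    have hu : IsOpen {τ : ℂ | 0 < τ.im} := isOpen_lt continuous_const Complex.continuous_im
    have hw : IsOpen {τ : ℂ | τ.im < 0} := isOpen_lt Complex.continuous_im continuous_const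
    have h2 : S.OmegaPlus ⊆ S.chartSet n H {τ | 0 < τ.im} := by
      refine isPreconnected_connectedComponentIn.subset_left_of_subset_union
        (isOpen_chartSet (S := S) (n := n) (H := H) hu)
        (isOpen_chartSet (S := S) (n := n) (H := H) hw) ?_ ?_ ?_
      · rw [Set.disjoint_left]
        rintro p ⟨_, h3⟩ ⟨_, h4⟩
        exact lt_asymm (α := ℝ) h3 h4
      · intro p hp
        obtain ⟨τ, hτ, rfl⟩ := h.mem_Omega_iff.1 (h1 hp)
        rcases lt_or_gt_of_ne hτ with h3 | h3
        · exact Or.inr (h.tube_mem_chartSet.2 h3)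
        · exact Or.inl (h.tube_mem_chartSet.2 h3)
      · refine ⟨S.basePoint, mem_connectedComponentIn (hsub hbase), ?_⟩
        obtain ⟨τ, hτ, e⟩ := hbase
        rw [← e]
        exact h.tube_mem_chartSet.2 hτ
    intro p hp
    obtain ⟨τ, -, rfl⟩ := h.mem_Omega_iff.1 (h1 hp)
    exact ⟨τ, h.tube_mem_chartSet.1 (h2 hp), rfl⟩
  · exact ((convex_halfSpace_im_gt 0).isPreconnected.image _
      continuous_tube.continuousOn).subset_connectedComponentIn hbase hsub

theorem tube_mem_OmegaPlus (h : S.IsPolarization n H) {τ : ℂ} :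
    S.tube n H (τ : OnePoint ℂ) ∈ S.OmegaPlus ↔ 0 < τ.im := by
  rw [h.OmegaPlus_eq]
  refine ⟨?_, fun hτ => ⟨τ, hτ, rfl⟩⟩
  rintro ⟨σ, hσ, e⟩
  rwa [← OnePoint.coe_eq_coe.1 (h.tube_injective e)]

theorem exists_eq_tube (h : S.IsPolarization n H) {p : ℙ ℂ (cplx S.extNS)}
    (hp : p ∈ S.OmegaPlus) : ∃ τ : ℍ, p = S.tube n H ((τ : ℂ) : OnePoint ℂ) := by
  rw [h.OmegaPlus_eq] at hp
  obtain ⟨τ, hτ, rfl⟩ := hp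
  exact ⟨⟨τ, hτ⟩, rfl⟩

/-! ### The isotropic lines -/

theorem latticeLine_infty (h : S.IsPolarization n H) {k : ℤ} (hk : S.latVec H 0 0 k ≠ 0) :
    S.latticeLine (S.latVec H 0 0 k) hk = S.tube n H OnePoint.infty := by
  rw [latticeLine, tube_infty, Projectivization.mk_eq_mk_iff']
  refine ⟨k, ?_⟩
  rw [toCplx_latVec, extVec_smul, h.extVec_inj]
  simp

theorem latticeLine_coe (h : S.IsPolarization n H) {a b c : ℤ} (ha : a ≠ 0)
    (habc : a * c = n * b ^ 2) (hl : S.latVec H a b c ≠ 0) :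
    S.latticeLine (S.latVec H a b c) hl =
      S.tube n H ((((b / a : ℚ) : ℚ) : ℂ) : OnePoint ℂ) := by
  have := h.mk_eq_tube (v := toCplx S.extNS (S.latVec H a b c)) (by
      intro h0
      apply hl
      rw [toCplx_latVec] at h0
      have h1 := congrArg S.fstCoord h0
      rw [fstCoord_extVec, map_zero] at h1
      exact absurd (by exact_mod_cast h1) ha) (toCplx_latVec a b c)
    (by exact_mod_cast ha) (by exact_mod_cast habc)
  push_cast
  exact this

theorem latVec_ne_zero (h : S.IsPolarization n H) {a b c : ℤ} (h0 : ¬(a = 0 ∧ b = 0 ∧ c = 0)) :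
    S.latVec H a b c ≠ 0 := by
  intro e
  have e0 := latVec_smul (S := S) (H := H) 0 0 0 0
  simp only [zero_smul, mul_zero] at e0
  rw [e0, h.latVec_inj] at e
  exact h0 e

theorem isotropic_cases (h : S.IsPolarization n H) {l : S.extNS} (hl : l ≠ 0)
    (h0 : latticeForm mukaiGram (l : MukaiIndex → ℤ) (l : MukaiIndex → ℤ) = 0) :
    (∃ k : ℤ, k ≠ 0 ∧ l = S.latVec H 0 0 k) ∨
      ∃ a b c : ℤ, a ≠ 0 ∧ a * c = n * b ^ 2 ∧ l = S.latVec H a b c := by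
  obtain ⟨a, b, c, rfl⟩ := h.exists_latVec l
  rw [h.form_latVec] at h0
  have habc : a * c = n * b ^ 2 := by linarith
  by_cases ha : a = 0
  · subst ha
    have hn := h.n_pos
    have hb : b = 0 := by
      have : (n : ℤ) * b ^ 2 = 0 := by linarith
      rcases mul_eq_zero.1 this with h1 | h1
      · omega
      · exact pow_eq_zero_iff (two_ne_zero) |>.1 h1
    subst hb
    refine Or.inl ⟨c, ?_, rfl⟩
    rintro rfl
    have e0 := latVec_smul (S := S) (H := H) 0 0 0 0
    simp only [zero_smul, mul_zero] at e0
    exact hl e0.symm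
  · exact Or.inr ⟨a, b, c, ha, habc, rfl⟩

theorem mem_isotropicLines_iff (h : S.IsPolarization n H) {p : ℙ ℂ (cplx S.extNS)} :
    p ∈ S.isotropicLines ↔ p = S.tube n H OnePoint.infty ∨
      ∃ q : ℚ, p = S.tube n H ((q : ℂ) : OnePoint ℂ) := by
  constructor
  · rintro ⟨l, hl, h0, rfl⟩
    rcases h.isotropic_cases hl h0 with ⟨k, _, rfl⟩ | ⟨a, b, c, ha, habc, rfl⟩
    · exact Or.inl (h.latticeLine_infty hl)
    · exact Or.inr ⟨_, h.latticeLine_coe ha habc hl⟩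
  · rintro (rfl | ⟨q, rfl⟩)
    · have hl := h.latVec_ne_zero (a := 0) (b := 0) (c := 1) (by simp)
      exact ⟨_, hl, by rw [h.form_latVec]; simp, (h.latticeLine_infty hl).symm⟩
    · have hd : (q.den : ℤ) ≠ 0 := by exact_mod_cast q.den_ne_zero
      -- This is `(1, qH, nq²)` multiplied by the square of the denominator of `q`.
      have hl := h.latVec_ne_zero (a := q.den ^ 2) (b := q.num * q.den) (c := n * q.num ^ 2)
        (fun h0 => pow_ne_zero 2 hd h0.1)
      refine ⟨_, hl, by rw [h.form_latVec]; ring, ?_⟩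
      rw [h.latticeLine_coe (pow_ne_zero 2 hd) (by ring) hl]
      congr 3
      have hd' : (q.den : ℚ) ≠ 0 := by exact_mod_cast q.den_ne_zero
      conv_lhs => rw [← Rat.num_div_den q]
      push_cast
      field_simp

end IsPolarization

end MarkedK3

/-! ### The Fricke group up to scalars -/

theorem proportional_of_mk_eq {γ γ' : GL (Fin 2) ℂ}
    (h : Matrix.ProjGenLinGroup.mk γ = Matrix.ProjGenLinGroup.mk γ') :
    ∃ c : ℂ, (γ' : Matrix (Fin 2) (Fin 2) ℂ) = c • (γ : Matrix (Fin 2) (Fin 2) ℂ) := by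
  rw [Matrix.ProjGenLinGroup.mk_eq_mk_iff'] at h
  obtain ⟨z, hz, rfl⟩ := h
  rw [Matrix.GeneralLinearGroup.mem_center_iff_val_mem_range_scalar] at hz
  obtain ⟨a, ha⟩ := hz
  refine ⟨a, ?_⟩
  rw [Units.val_mul, ← ha, Matrix.scalar_apply, ← Matrix.smul_one_eq_diagonal, mul_smul_comm,
    mul_one]

theorem mk_eq_of_proportional {γ γ' : GL (Fin 2) ℂ} {c : ℂ}
    (h : (γ' : Matrix (Fin 2) (Fin 2) ℂ) = c • (γ : Matrix (Fin 2) (Fin 2) ℂ)) :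
    Matrix.ProjGenLinGroup.mk γ = Matrix.ProjGenLinGroup.mk γ' := by
  rw [Matrix.ProjGenLinGroup.mk_eq_mk_iff']
  refine ⟨γ⁻¹ * γ', ?_, mul_inv_cancel_left _ _⟩
  rw [Matrix.GeneralLinearGroup.mem_center_iff_val_mem_range_scalar]
  refine ⟨c, ?_⟩
  rw [Units.val_mul, h, mul_smul_comm, Units.inv_mul, Matrix.scalar_apply,
    ← Matrix.smul_one_eq_diagonal]

theorem coe_slToGL (γ : SL(2, ℝ)) : (slToGL γ : Matrix (Fin 2) (Fin 2) ℂ) =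
    (γ : Matrix (Fin 2) (Fin 2) ℝ).map (algebraMap ℝ ℂ) := rfl

theorem coe_map_algebraMap {K L : Type} [Field K] [Field L] [Algebra K L] (γ : GL (Fin 2) K) :
    (Matrix.GeneralLinearGroup.map (algebraMap K L) γ : Matrix (Fin 2) (Fin 2) L) =
      (γ : Matrix (Fin 2) (Fin 2) K).map (algebraMap K L) := rfl

/-- The Fricke involution in `SL(2, ℝ)`. -/
def frickeInvolutionReal {n : ℕ} (hn : 0 < n) : SL(2, ℝ) :=
  ⟨!![0, -(√n)⁻¹; √n, 0], by
    have : √(n : ℝ) ≠ 0 := (Real.sqrt_pos.2 (by exact_mod_cast hn)).ne'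
    simp [Matrix.det_fin_two, this]⟩

theorem frickeInvolutionReal_mem {n : ℕ} (hn : 0 < n) : frickeInvolutionReal hn ∈ frickeGroup n :=
  Subgroup.subset_closure (Or.inr rfl)

theorem mk_slToGL_frickeInvolutionReal {n : ℕ} (hn : 0 < n) :
    Matrix.ProjGenLinGroup.mk (slToGL (frickeInvolutionReal hn)) = Matrix.ProjGenLinGroup.mk
      (Matrix.GeneralLinearGroup.map (algebraMap ℚ ℂ) (frickeInvolution hn)) := by
  refine mk_eq_of_proportional (c := ((√n : ℝ) : ℂ)) ?_
  have h0 : √(n : ℝ) ≠ 0 := (Real.sqrt_pos.2 (by exact_mod_cast hn)).ne'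
  have h1 : ((√n : ℝ) : ℂ) * ((√n : ℝ) : ℂ) = n := by
    rw [← Complex.ofReal_mul, Real.mul_self_sqrt (Nat.cast_nonneg n), Complex.ofReal_natCast]
  have h2 : ((√n : ℝ) : ℂ) ≠ 0 := Complex.ofReal_ne_zero.2 h0
  rw [coe_slToGL, coe_map_algebraMap, coe_frickeInvolution]
  ext i j
  fin_cases i <;> fin_cases j <;> simp [frickeInvolutionReal, h1, h2]

theorem mk_slToGL_gamma0 {γ : GL (Fin 2) ℚ} {M : SL(2, ℤ)}
    (h : (γ : Matrix (Fin 2) (Fin 2) ℚ) = (M : Matrix (Fin 2) (Fin 2) ℤ).map (Int.cast : ℤ → ℚ)) :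
    Matrix.ProjGenLinGroup.mk (slToGL (Matrix.SpecialLinearGroup.map (Int.castRingHom ℝ) M)) =
      Matrix.ProjGenLinGroup.mk (Matrix.GeneralLinearGroup.map (algebraMap ℚ ℂ) γ) := by
  refine mk_eq_of_proportional (c := 1) ?_
  rw [coe_slToGL, coe_map_algebraMap, h]
  ext i j
  simp

/-- The real and the rational group have the same image in `PGL(2, ℂ)`. Their generators match up to
scalars: the two Fricke involutions differ by `√n`, and the rational scalars become trivial. -/
theorem map_frickeGroup_eq {n : ℕ} (hn : 0 < n) :
    (frickeGroup n).map (Matrix.ProjGenLinGroup.mk.comp slToGL) =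
      (frickeGroupRat n).map (Matrix.ProjGenLinGroup.mk.comp
        (Matrix.GeneralLinearGroup.map (algebraMap ℚ ℂ))) := by
  apply le_antisymm
  · rw [Subgroup.map_le_iff_le_comap, frickeGroup, Subgroup.closure_le]
    rintro γ (⟨M, hM, rfl⟩ | hγ)
    · refine ⟨Matrix.SpecialLinearGroup.toGL (Matrix.SpecialLinearGroup.map (Int.castRingHom ℚ) M),
        Subgroup.subset_closure (Or.inl (Or.inr ⟨M, hM, rfl⟩)), (mk_slToGL_gamma0 rfl).symm⟩
    · have : γ = frickeInvolutionReal hn := Subtype.ext hγ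
      rw [this]
      exact ⟨_, frickeInvolution_mem_frickeGroupRat hn, (mk_slToGL_frickeInvolutionReal hn).symm⟩
  · rw [Subgroup.map_le_iff_le_comap, frickeGroupRat, Subgroup.closure_le]
    rintro γ ((⟨c, hc⟩ | ⟨M, hM, hγ⟩) | hγ)
    · refine ⟨1, one_mem _, ?_⟩
      refine mk_eq_of_proportional (c := c) ?_
      rw [coe_map_algebraMap, hc]
      ext i j
      simp [Matrix.one_apply]
      split_ifs <;> simp
    · exact ⟨_, Subgroup.subset_closure (Or.inl ⟨M, hM, rfl⟩), mk_slToGL_gamma0 hγ⟩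
    · have : γ = frickeInvolution hn := Units.ext hγ
      rw [this]
      exact ⟨_, frickeInvolutionReal_mem hn, mk_slToGL_frickeInvolutionReal hn⟩

theorem exists_frickeGroupRat_of_mem_frickeGroup {n : ℕ} (hn : 0 < n) {δ : SL(2, ℝ)}
    (hδ : δ ∈ frickeGroup n) : ∃ γ ∈ frickeGroupRat n, ∃ c : ℂ,
      (slToGL δ : Matrix (Fin 2) (Fin 2) ℂ) = c •
        (Matrix.GeneralLinearGroup.map (algebraMap ℚ ℂ) γ : Matrix (Fin 2) (Fin 2) ℂ) := by
  have h := (map_frickeGroup_eq hn).le ⟨δ, hδ, rfl⟩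
  obtain ⟨γ, hγ, e⟩ := h
  exact ⟨γ, hγ, proportional_of_mk_eq e⟩

theorem exists_frickeGroup_of_mem_frickeGroupRat {n : ℕ} (hn : 0 < n) {γ : GL (Fin 2) ℚ}
    (hγ : γ ∈ frickeGroupRat n) : ∃ δ ∈ frickeGroup n, ∃ c : ℂ,
      (slToGL δ : Matrix (Fin 2) (Fin 2) ℂ) = c •
        (Matrix.GeneralLinearGroup.map (algebraMap ℚ ℂ) γ : Matrix (Fin 2) (Fin 2) ℂ) := by
  obtain ⟨δ, hδ, e⟩ := (map_frickeGroup_eq hn).ge ⟨γ, hγ, rfl⟩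
  exact ⟨δ, hδ, proportional_of_mk_eq e.symm⟩

/-! ### Orientation -/

theorem smul_coe_eq_num_div_denom (γ : GL (Fin 2) ℝ) {z : ℂ} (hz : z.im ≠ 0) :
    Matrix.GeneralLinearGroup.map (algebraMap ℝ ℂ) γ • (z : OnePoint ℂ) =
      ((UpperHalfPlane.num γ z / UpperHalfPlane.denom γ z : ℂ) : OnePoint ℂ) := by
  rw [OnePoint.smul_some_eq_ite, if_neg]
  · rfl
  · exact UpperHalfPlane.denom_ne_zero_of_im γ hz

theorem coe_smul_upperHalfPlane (γ : SL(2, ℝ)) (τ : ℍ) :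
    (((γ • τ : ℍ) : ℂ) : OnePoint ℂ) = slToGL γ • ((τ : ℂ) : OnePoint ℂ) := by
  rw [UpperHalfPlane.coe_specialLinearGroup_apply]
  exact (smul_coe_eq_num_div_denom (Matrix.SpecialLinearGroup.toGL γ) τ.im_ne_zero).symm

namespace MarkedK3.IsPolarization

variable {S : MarkedK3} {n : ℕ} {H : S.NS}

/-- By equivariance this is `Im(γτ) = det γ · Im τ / |rτ + s|²`, with `(r, s)` the lower row of `γ`.
The sign `ε` does not act on lines, so it plays no role. -/
theorem act_mem_OmegaPlus_of_det_pos (h : S.IsPolarization n H) {γ : GL (Fin 2) ℝ} {ε : ℤˣ}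
    {g : isometryGroup mukaiGram S.extNS}
    (hg : S.IsAdjoint n H (Matrix.GeneralLinearGroup.map (algebraMap ℝ ℂ) γ) ε g)
    (hdet : 0 < γ.det.val) {p : ℙ ℂ (cplx S.extNS)} (hp : p ∈ S.OmegaPlus) :
    S.act g p ∈ S.OmegaPlus := by
  obtain ⟨τ, rfl⟩ := h.exists_eq_tube hp
  rw [← h.tube_smul hg, smul_coe_eq_num_div_denom _ τ.im_ne_zero, h.tube_mem_OmegaPlus,
    UpperHalfPlane.moebius_im]
  exact div_pos (mul_pos hdet τ.im_pos) (UpperHalfPlane.normSq_denom_pos _ τ.im_ne_zero)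

theorem det_pos_of_act_mem_OmegaPlus (h : S.IsPolarization n H) {γ : GL (Fin 2) ℝ} {ε : ℤˣ}
    {g : isometryGroup mukaiGram S.extNS}
    (hg : S.IsAdjoint n H (Matrix.GeneralLinearGroup.map (algebraMap ℝ ℂ) γ) ε g)
    (hact : ∀ p ∈ S.OmegaPlus, S.act g p ∈ S.OmegaPlus) : 0 < γ.det.val := by
  have h1 := hact _ (h.tube_mem_OmegaPlus (τ := Complex.I).2 (by simp))
  rw [← h.tube_smul hg, smul_coe_eq_num_div_denom _ (by simp), h.tube_mem_OmegaPlus,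
    UpperHalfPlane.moebius_im, Complex.I_im, mul_one] at h1
  exact (div_pos_iff_of_pos_right (UpperHalfPlane.normSq_denom_pos _ (by simp))).1 h1

theorem isAdjoint_real (h : S.IsPolarization n H) {γ : GL (Fin 2) ℚ} {ε : ℤˣ}
    {g : isometryGroup mukaiGram S.extNS} (hg : S.IsRatAdjoint n H γ ε g) :
    S.IsAdjoint n H (Matrix.GeneralLinearGroup.map (algebraMap ℝ ℂ)
      (Matrix.GeneralLinearGroup.map (algebraMap ℚ ℝ) γ)) ε g := by
  convert h.isAdjoint_of_isRatAdjoint hg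
  ext i j
  simp

theorem det_map_real (γ : GL (Fin 2) ℚ) :
    (Matrix.GeneralLinearGroup.map (algebraMap ℚ ℝ) γ).det.val =
      (((γ : Matrix (Fin 2) (Fin 2) ℚ).det : ℚ) : ℝ) := by
  rw [Matrix.GeneralLinearGroup.val_det_apply, coe_map_algebraMap]
  exact (RingHom.map_det (algebraMap ℚ ℝ) _).symm

/-- Preserving `Ω⁺` supplies the positive determinant and `Γ(S)` the sign on the discriminant, which
together are what the arithmetic criterion needs. -/
theorem mem_GamPlus_iff (h : S.IsPolarization n H) {γ : GL (Fin 2) ℚ} {ε : ℤˣ}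
    {g : isometryGroup mukaiGram S.extNS} (hγ : γ ∈ eichlerNormalizer n)
    (hg : S.IsRatAdjoint n H γ ε g) : g ∈ S.GamPlus ↔ γ ∈ frickeGroupRat n := by
  constructor
  · rintro ⟨h1, h2⟩
    obtain ⟨δ, hδ⟩ := (h.mem_Gam_iff_actsBySign hg).1 h1
    refine mem_frickeGroupRat_of_actsBySign h.n_pos hγ ?_ hδ
    have := h.det_pos_of_act_mem_OmegaPlus (h.isAdjoint_real hg) fun p hp => (h2 p).1 hp
    rw [det_map_real] at this
    exact_mod_cast this
  · intro hF
    have hpos : ∀ γ ∈ frickeGroupRat n,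
        0 < (Matrix.GeneralLinearGroup.map (algebraMap ℚ ℝ) γ).det.val := fun γ hF => by
      rw [det_map_real]
      exact_mod_cast (h.exists_mem_Gam_of_mem_frickeGroupRat hF).2.1
    obtain ⟨-, -, g₀, hg₀, hr⟩ := h.exists_mem_Gam_of_mem_frickeGroupRat hF
    refine ⟨(h.mem_Gam_iff_actsBySign hg).2 ((h.mem_Gam_iff_actsBySign hr).1 hg₀), fun p =>
      ⟨h.act_mem_OmegaPlus_of_det_pos (h.isAdjoint_real hg) (hpos _ hF), fun hp => ?_⟩⟩
    have := h.act_mem_OmegaPlus_of_det_pos (h.isAdjoint_real hg.inv) (hpos _ (inv_mem hF)) hp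
    rwa [← act_mul, inv_mul_cancel, act_one] at this

/-- The isometry group of the extended Néron-Severi lattice in terms of the normalizer of the
Eichler order. -/
theorem exists_eichlerNormalizer_hom (h : S.IsPolarization n H) :
    ∃ Ψ : eichlerNormalizer n × ℤˣ →* isometryGroup mukaiGram S.extNS,
      Function.Surjective Ψ ∧
      (∀ γ ε, Ψ (γ, ε) = 1 ↔
        (∃ c : ℚ, ((γ : GL (Fin 2) ℚ) : Matrix (Fin 2) (Fin 2) ℚ) = c • 1) ∧ ε = 1) ∧
      (∀ (γ : eichlerNormalizer n) (ε : ℤˣ), S.IsAdjoint n H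
        (Matrix.GeneralLinearGroup.map (algebraMap ℚ ℂ) (γ : GL (Fin 2) ℚ)) ε (Ψ (γ, ε))) ∧
      ∀ γ ε, Ψ (γ, ε) ∈ S.GamPlus ↔ (γ : GL (Fin 2) ℚ) ∈ frickeGroupRat n := by
  obtain ⟨Ψ, hΨ⟩ := exists_monoidHom_of_rel
    (fun (a : eichlerNormalizer n × ℤˣ) g => S.IsRatAdjoint n H a.1 a.2 g)
    (fun a => h.exists_isRatAdjoint a.1.2 a.2) (fun ha hb => ha.mul hb)
    (fun ha hb => h.isRatAdjoint_unique ha hb)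
  refine ⟨Ψ, fun g => ?_, fun γ ε => ⟨fun h1 => ?_, ?_⟩,
    fun γ ε => h.isAdjoint_of_isRatAdjoint (hΨ (γ, ε)),
    fun γ ε => h.mem_GamPlus_iff γ.2 (hΨ (γ, ε))⟩
  · obtain ⟨γ, hγ, ε, hg⟩ := h.exists_eichlerNormalizer g
    exact ⟨(⟨γ, hγ⟩, ε), h.isRatAdjoint_unique (hΨ _) hg⟩
  · have h2 := h.isAdjoint_of_isRatAdjoint (hΨ (γ, ε))
    rw [h1] at h2
    obtain ⟨⟨c, hc⟩, hε⟩ := h.scalar_of_isAdjoint_one h2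
    -- The scalar is known a priori only as a complex number; as a diagonal entry of `γ` it is
    -- rational.
    refine ⟨⟨((γ : GL (Fin 2) ℚ) : Matrix (Fin 2) (Fin 2) ℚ) 0 0, ?_⟩, hε⟩
    rw [coe_map_algebraMap] at hc
    have key := fun i j => congrFun (congrFun hc i) j
    have k00 := key 0 0
    have k01 := key 0 1
    have k10 := key 1 0
    have k11 := key 1 1
    simp at k00 k01 k10 k11
    rw [← k00] at k11
    ext i j
    fin_cases i <;> fin_cases j <;> simp [k01, k10]
    exact_mod_cast k11
  · rintro ⟨⟨c, hc⟩, rfl⟩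
    refine h.isAdjoint_unique (h.isAdjoint_of_isRatAdjoint (hΨ (γ, 1)))
      (isAdjoint_one_of_scalar (c := c) ?_)
    rw [coe_map_algebraMap, hc]
    ext i j
    simp [Matrix.one_apply]
    split_ifs <;> simp

theorem scalar_iff_eq_one_or {γ : SL(2, ℝ)} :
    (∃ c : ℂ, (slToGL γ : Matrix (Fin 2) (Fin 2) ℂ) = c • 1) ↔ γ = 1 ∨ γ = -1 := by
  constructor
  · rintro ⟨c, hc⟩
    rw [coe_slToGL] at hc
    have key := fun i j => congrFun (congrFun hc i) j
    have k00 := key 0 0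
    have k01 := key 0 1
    have k10 := key 1 0
    have k11 := key 1 1
    simp at k00 k01 k10 k11
    rw [← k00, Complex.ofReal_inj] at k11
    have hdet := γ.det_coe
    rw [Matrix.det_fin_two, k01, k10, k11] at hdet
    have h1 : γ 0 0 = 1 ∨ γ 0 0 = -1 := by
      apply mul_self_eq_one_iff.1
      linarith
    refine h1.imp (fun h1 => ?_) fun h1 => ?_
    · ext i j
      fin_cases i <;> fin_cases j <;> simp [k01, k10, k11, h1]
    · ext i j
      fin_cases i <;> fin_cases j <;> simp [k01, k10, k11, h1]
  · rintro (rfl | rfl)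
    · exact ⟨1, by simp⟩
    · refine ⟨-1, ?_⟩
      rw [coe_slToGL]
      ext i j
      fin_cases i <;> fin_cases j <;> simp

/-- The group `Γ(S)⁺` in terms of the Fricke group, and the equivariance of the tube domain map. -/
theorem exists_frickeGroup_hom (h : S.IsPolarization n H) :
    ∃ Ψ : frickeGroup n × ℤˣ →* S.GamPlus,
      Function.Surjective Ψ ∧
      (∀ γ ε, Ψ (γ, ε) = 1 ↔ ((γ : SL(2, ℝ)) = 1 ∨ (γ : SL(2, ℝ)) = -1) ∧ ε = 1) ∧
      (∀ (γ : frickeGroup n) (ε : ℤˣ), S.IsAdjoint n H (slToGL γ) ε (Ψ (γ, ε))) ∧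
      ∀ (γ : frickeGroup n) (ε : ℤˣ) (x : OnePoint ℂ),
        S.tube n H (slToGL γ • x) = S.act (Ψ (γ, ε)) (S.tube n H x) := by
  have hex : ∀ a : frickeGroup n × ℤˣ, ∃ g : S.GamPlus,
      S.IsAdjoint n H (slToGL a.1) a.2 g.1 := by
    rintro ⟨⟨δ, hδ⟩, ε⟩
    obtain ⟨γ, hγ, c, hc⟩ := exists_frickeGroupRat_of_mem_frickeGroup h.n_pos hδ
    have hN := (h.exists_mem_Gam_of_mem_frickeGroupRat hγ).1
    obtain ⟨g, hg⟩ := h.exists_isRatAdjoint hN ε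
    exact ⟨⟨g, (h.mem_GamPlus_iff hN hg).2 hγ⟩, (h.isAdjoint_of_isRatAdjoint hg).of_eq_smul hc⟩
  obtain ⟨Ψ, hΨ⟩ := exists_monoidHom_of_rel
    (fun (a : frickeGroup n × ℤˣ) (g : S.GamPlus) => S.IsAdjoint n H (slToGL a.1) a.2 g.1) hex
    (fun {a b a' b'} ha hb => by
      have := ha.mul hb
      rw [← map_mul] at this
      exact this)
    (fun ha hb => Subtype.ext (h.isAdjoint_unique ha hb))
  refine ⟨Ψ, fun g => ?_, fun γ ε => ?_, fun γ ε => hΨ (γ, ε),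
    fun γ ε x => h.tube_smul (hΨ (γ, ε)) x⟩
  · obtain ⟨γ, hγ, ε, hg⟩ := h.exists_eichlerNormalizer g.1
    obtain ⟨δ, hδ, c, hc⟩ := exists_frickeGroup_of_mem_frickeGroupRat h.n_pos
      ((h.mem_GamPlus_iff hγ hg).1 g.2)
    exact ⟨(⟨δ, hδ⟩, ε), Subtype.ext (h.isAdjoint_unique (hΨ (⟨δ, hδ⟩, ε))
      ((h.isAdjoint_of_isRatAdjoint hg).of_eq_smul hc))⟩
  · rw [← scalar_iff_eq_one_or]
    constructor
    · intro h1
      have h2 := hΨ (γ, ε)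
      rw [h1] at h2
      exact h.scalar_of_isAdjoint_one h2
    · rintro ⟨⟨c, hc⟩, rfl⟩
      exact Subtype.ext (h.isAdjoint_unique (hΨ (γ, 1)) (isAdjoint_one_of_scalar hc))

end MarkedK3.IsPolarization

/-! ### The tube domain realization as an isomorphism -/

/-- Isomorphisms compatible with equivalence relations descend to the quotients. -/
def HolSpace.Iso.quotient {X Y : HolSpace} (e : X.Iso Y) {r : Setoid X.Carrier}
    {s : Setoid Y.Carrier} (h : ∀ x y, r x y ↔ s (e.toHomeo x) (e.toHomeo y)) :
    (X.quotient r).Iso (Y.quotient s) where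
  toHomeo :=
    { toEquiv := Quotient.congr e.toHomeo.toEquiv h
      continuous_toFun := Continuous.quotient_map' e.toHomeo.continuous fun x y => (h x y).1
      continuous_invFun := Continuous.quotient_map' e.toHomeo.symm.continuous fun x y hxy => by
        refine (h _ _).2 ?_
        simpa only [Homeomorph.apply_symm_apply] using hxy }
  hol_iff U hU f :=
    e.hol_iff (Quotient.mk s ⁻¹' U) (hU.preimage continuous_quotient_mk') (f ∘ Quotient.mk s)

namespace MarkedK3.IsPolarization

variable {S : MarkedK3} {n : ℕ} {H : S.NS}

/-- The tube domain realization of `Ω⁺` as a homeomorphism. -/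
def upperHomeo (h : S.IsPolarization n H) : ℍ ≃ₜ S.OmegaPlus :=
  (Equiv.ofBijective
    (fun τ : ℍ => (⟨S.tube n H ((τ : ℂ) : OnePoint ℂ), h.tube_mem_OmegaPlus.2 τ.im_pos⟩ :
      S.OmegaPlus))
    ⟨fun τ σ e =>
        UpperHalfPlane.ext (OnePoint.coe_eq_coe.1 (h.tube_injective (Subtype.ext_iff.1 e))),
      fun p => by
        obtain ⟨τ, e⟩ := h.exists_eq_tube p.2
        exact ⟨τ, Subtype.ext e.symm⟩⟩).toHomeomorphOfContinuousOpen
    ((continuous_tube.comp UpperHalfPlane.continuous_coe).subtype_mk _)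
    (by
      intro U hU
      have h1 := UpperHalfPlane.isOpenEmbedding_coe.isOpenMap U hU
      -- The image of an open set is the trace on `Ω⁺` of the open chart set over it.
      refine ⟨_, isOpen_chartSet (S := S) (n := n) (H := H) h1, ?_⟩
      ext p
      obtain ⟨τ, e⟩ := h.exists_eq_tube p.2
      obtain rfl : p = ⟨S.tube n H ((τ : ℂ) : OnePoint ℂ), h.tube_mem_OmegaPlus.2 τ.im_pos⟩ :=
        Subtype.ext e
      rw [Set.mem_preimage, h.tube_mem_chartSet]
      constructor
      · rintro ⟨σ, hσ, e'⟩
        exact ⟨σ, hσ, by rw [← UpperHalfPlane.ext e']; rfl⟩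
      · rintro ⟨σ, hσ, e'⟩
        exact ⟨σ, hσ, OnePoint.coe_eq_coe.1 (h.tube_injective (Subtype.ext_iff.1 e'))⟩)

theorem coords_of_mk_eq_tube (h : S.IsPolarization n H) {v : cplx S.extNS} {hv : v ≠ 0} {τ : ℂ}
    (e : Projectivization.mk ℂ v hv = S.tube n H (τ : OnePoint ℂ)) :
    S.fstCoord v ≠ 0 ∧ S.midCoord n H v / S.fstCoord v = τ :=
  (mk_mem_chartSet (W := {τ}) hv).1 (e ▸ h.tube_mem_chartSet.2 rfl)

theorem _root_.MarkedK3.differentiable_fstCoord : Differentiable ℂ S.fstCoord :=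
  (LinearMap.toContinuousLinearMap S.fstCoord).differentiable

theorem _root_.MarkedK3.differentiable_midCoord : Differentiable ℂ (S.midCoord n H) :=
  (LinearMap.toContinuousLinearMap (S.midCoord n H)).differentiable

theorem _root_.MarkedK3.differentiable_tubeVec :
    Differentiable ℂ fun τ : ℂ => S.extVec H 1 τ (n * τ ^ 2) := by
  have e : (fun τ : ℂ => S.extVec H 1 τ (n * τ ^ 2)) = fun τ : ℂ =>
      S.extVec H 1 0 0 + τ • S.extVec H 0 1 0 + (n * τ ^ 2) • S.extVec H 0 0 1 := by
    ext1 τ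
    simp only [extVec_smul, extVec_add]
    simp
  rw [e]
  fun_prop

/-- The two notions of holomorphy are compared by the section `τ ↦ (1, τH, nτ²)` of the cone and by
its left inverse, the quotient of coordinates `(r, cH, s) ↦ c / r`. Composition with the section
gives one direction; composition with the quotient gives an extension of `f` to an open subset of
`L_ℂ`. -/
theorem isHol_omegaHol_iff (h : S.IsPolarization n H) {U : Set S.OmegaPlus} (hU : IsOpen U)
    (f : S.OmegaPlus → ℂ) : S.omegaHol.IsHol U f ↔
      DifferentiableOn ℂ (fun z => f (h.upperHomeo (UpperHalfPlane.ofComplex z)))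
        (((↑) : ℍ → ℂ) '' (h.upperHomeo ⁻¹' U)) := by
  have hopen : IsOpen (((↑) : ℍ → ℂ) '' (h.upperHomeo ⁻¹' U)) :=
    UpperHalfPlane.isOpenEmbedding_coe.isOpenMap _ (hU.preimage h.upperHomeo.continuous)
  have heq : ∀ {v : cplx S.extNS} {hv : v ≠ 0} (hp : Projectivization.mk ℂ v hv ∈ S.OmegaPlus),
      ∃ τ : ℍ, h.upperHomeo τ = ⟨_, hp⟩ ∧ S.fstCoord v ≠ 0 ∧
        S.midCoord n H v / S.fstCoord v = τ := fun hp => by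
    obtain ⟨τ, e⟩ := h.exists_eq_tube hp
    exact ⟨τ, Subtype.ext e.symm, h.coords_of_mk_eq_tube e⟩
  constructor
  · rintro hf _ ⟨τ, hτ, rfl⟩
    obtain ⟨N, F, hN, hv, hF, hFf⟩ := hf _ (S.extVec_ne_zero_left H one_ne_zero τ (n * τ ^ 2))
      (h.upperHomeo τ).2 hτ
    have h1 : DifferentiableAt ℂ (fun z : ℂ => F (S.extVec H 1 z (n * z ^ 2))) τ :=
      (hF.differentiableAt (hN.mem_nhds hv)).comp (τ : ℂ) differentiable_tubeVec.differentiableAt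
    refine (h1.congr_of_eventuallyEq ?_).differentiableWithinAt
    filter_upwards [hopen.mem_nhds ⟨τ, hτ, rfl⟩,
      (hN.preimage differentiable_tubeVec.continuous).mem_nhds hv]
    rintro _ ⟨σ, hσ, rfl⟩ hσN
    have h2 := hFf _ hσN (S.extVec_ne_zero_left H one_ne_zero σ (n * σ ^ 2))
      (h.upperHomeo σ).2 hσ
    rw [UpperHalfPlane.ofComplex_apply]
    exact h2.symm
  · intro hf v hv hp hU'
    refine ⟨{w | S.fstCoord w ≠ 0 ∧
        S.midCoord n H w / S.fstCoord w ∈ ((↑) : ℍ → ℂ) '' (h.upperHomeo ⁻¹' U)},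
      fun w => f (h.upperHomeo (UpperHalfPlane.ofComplex (S.midCoord n H w / S.fstCoord w))),
      isOpen_fstCoord_midCoord hopen, ?_, ?_, ?_⟩
    · obtain ⟨τ, e, h1, h2⟩ := heq hp
      refine ⟨h1, τ, ?_, h2.symm⟩
      rw [Set.mem_preimage, e]
      exact hU'
    · refine hf.comp ?_ fun w hw => hw.2
      simp only [div_eq_mul_inv]
      exact differentiable_midCoord.differentiableOn.fun_mul
        (differentiable_fstCoord.differentiableOn.fun_inv fun w hw => hw.1)
    · intro w _ hw hq _
      obtain ⟨τ, e, -, h2⟩ := heq hq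
      change f (h.upperHomeo (UpperHalfPlane.ofComplex (S.midCoord n H w / S.fstCoord w))) =
        f (⟨_, hq⟩ : S.OmegaPlus)
      rw [h2, UpperHalfPlane.ofComplex_apply, e]

/-- The tube domain realization of `Ω⁺`. -/
def upperIso (h : S.IsPolarization n H) : upperHol.Iso S.omegaHol where
  toHomeo := h.upperHomeo
  hol_iff _ hU f := h.isHol_omegaHol_iff hU f

end MarkedK3.IsPolarization

/-! ### Horoballs at the cusps -/

theorem dist_tangent_disk_lt_iff (τ : ℍ) (q : ℚ) {r : ℝ} (hr : 0 < r) :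
    dist (τ : ℂ) ((q : ℂ) + r * Complex.I) < r ↔ ‖(τ : ℂ) - q‖ ^ 2 < 2 * r * τ.im := by
  rw [Complex.dist_eq, ← sq_lt_sq₀ (norm_nonneg _) hr.le, ← Complex.normSq_eq_norm_sq,
    ← Complex.normSq_eq_norm_sq, Complex.normSq_apply, Complex.normSq_apply]
  simp only [Complex.sub_re, Complex.sub_im, Complex.add_re, Complex.add_im, Complex.mul_re,
    Complex.mul_im, Complex.ofReal_re, Complex.ofReal_im, Complex.I_re, Complex.I_im,
    Complex.ratCast_re, Complex.ratCast_im, UpperHalfPlane.coe_im, UpperHalfPlane.coe_re]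
  constructor <;> intro h <;> nlinarith

theorem HStar.cases (x : HStar) :
    (∃ τ : ℍ, x = HStar.ofUpper τ) ∨ (∃ q : ℚ, x = HStar.ofRat q) ∨ x = HStar.inf := by
  obtain ⟨x, ⟨τ, hτ⟩ | ⟨q, hq⟩ | hx⟩ := x
  · exact Or.inl ⟨τ, Subtype.ext hτ⟩
  · exact Or.inr (Or.inl ⟨q, Subtype.ext hq⟩)
  · exact Or.inr (Or.inr (Subtype.ext hx))

namespace MarkedK3

/-- The set `W ⊆ ℍ` contains a horoball `{(v, v̄) > M |(v, l)|²}`. -/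
def ContainsHoroball (S : MarkedK3) (n : ℕ) (H : S.NS) (l : S.extNS) (W : Set ℍ) : Prop :=
  ∃ M : ℝ, ∀ τ : ℍ, M * ‖latticeForm mukaiGram (S.extVec H 1 τ (n * (τ : ℂ) ^ 2) : MukaiIndex → ℂ)
    (castVec (l : MukaiIndex → ℤ))‖ ^ 2 < 4 * n * τ.im ^ 2 → τ ∈ W

namespace IsPolarization

variable {S : MarkedK3} {n : ℕ} {H : S.NS}

theorem form_extVec_latVec (h : S.IsPolarization n H) (r c s : ℂ) (a b d : ℤ) :
    latticeForm mukaiGram (S.extVec H r c s : MukaiIndex → ℂ)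
      (castVec (S.latVec H a b d : MukaiIndex → ℤ)) = 2 * n * c * b - r * d - s * a := by
  have e : castVec (S.latVec H a b d : MukaiIndex → ℤ) =
      (S.extVec H a b d : MukaiIndex → ℂ) := congrArg Subtype.val (toCplx_latVec (S := S) a b d)
  rw [e, h.form_extVec]

/-- The condition on neighbourhoods of a cusp of `Ω⁺`, on the upper half plane. -/
theorem containsHoroball_iff (h : S.IsPolarization n H) {l : S.extNS} {W : Set S.OmegaPlus} :
    (∃ M : ℝ, ∀ (v : cplx S.extNS) (hv : v ≠ 0)
        (hp : Projectivization.mk ℂ v hv ∈ S.OmegaPlus),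
        M * ‖latticeForm mukaiGram (v : MukaiIndex → ℂ) (castVec (l : MukaiIndex → ℤ))‖ ^ 2 <
          (latticeForm mukaiGram (v : MukaiIndex → ℂ) (star (v : MukaiIndex → ℂ))).re →
        (⟨_, hp⟩ : S.OmegaPlus) ∈ W) ↔ S.ContainsHoroball n H l (h.upperHomeo ⁻¹' W) := by
  refine exists_congr fun M => ⟨fun hM τ hτ => ?_, fun hM v hv hp hlt => ?_⟩
  · refine hM _ (S.extVec_ne_zero_left H one_ne_zero _ _) (h.upperHomeo τ).2 ?_
    rw [h.form_star_tubeVec, Complex.ofReal_re]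
    exact hτ
  · obtain ⟨τ, e⟩ := h.exists_eq_tube hp
    have e' : (⟨_, hp⟩ : S.OmegaPlus) = h.upperHomeo τ := Subtype.ext e
    rw [e']
    apply hM τ
    -- Scaling the representative by `c` multiplies both sides of the inequality by `|c|²`, so the
    -- section suffices.
    rw [tube_coe, Projectivization.mk_eq_mk_iff'] at e
    obtain ⟨c, rfl⟩ := e
    have hc : c ≠ 0 := by
      rintro rfl
      exact hv (zero_smul _ _)
    have hpos : 0 < ‖c‖ ^ 2 := by positivity
    rw [Submodule.coe_smul, star_smul, latticeForm_smul_left, latticeForm_smul_left,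
      latticeForm_smul_right, h.form_star_tubeVec, norm_mul, mul_pow, mul_left_comm,
      Complex.star_def, ← mul_assoc c, Complex.mul_conj, ← Complex.ofReal_mul, Complex.ofReal_re,
      Complex.normSq_eq_norm_sq] at hlt
    exact lt_of_mul_lt_mul_left hlt hpos.le

/-- The pairing of `(0, 0, k)` with the section is the constant `-k`, so the horoball condition only
bounds `Im τ` from below. -/
theorem containsHoroball_infty (h : S.IsPolarization n H) {k : ℤ} (hk : k ≠ 0) {W : Set ℍ} :
    S.ContainsHoroball n H (S.latVec H 0 0 k) W ↔ ∃ M : ℝ, ∀ τ : ℍ, M < τ.im → τ ∈ W := by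
  have hn : (1 : ℝ) ≤ n := by exact_mod_cast h.n_pos
  have hk' : (0 : ℝ) < (k : ℝ) ^ 2 := by positivity
  have e : ∀ τ : ℍ, ‖latticeForm mukaiGram (S.extVec H 1 τ (n * (τ : ℂ) ^ 2) : MukaiIndex → ℂ)
      (castVec (S.latVec H 0 0 k : MukaiIndex → ℤ))‖ ^ 2 = (k : ℝ) ^ 2 := fun τ => by
    rw [h.form_extVec_latVec]
    simp
  constructor
  · rintro ⟨M, hM⟩
    -- The added `1` ensures `Im τ > 1`, hence `Im τ < (Im τ)²`; this avoids a square root and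
    -- covers negative `M`.
    refine ⟨|M| * k ^ 2 + 1, fun τ hτ => hM τ ?_⟩
    rw [e]
    have h0 : 0 ≤ |M| * (k : ℝ) ^ 2 := by positivity
    calc M * (k : ℝ) ^ 2 ≤ |M| * (k : ℝ) ^ 2 := by gcongr; exact le_abs_self M
      _ < τ.im ^ 2 := by nlinarith
      _ ≤ 4 * n * τ.im ^ 2 := by nlinarith [sq_nonneg τ.im]
  · rintro ⟨M, hM⟩
    refine ⟨4 * n * M ^ 2 / k ^ 2, fun τ hτ => hM τ ?_⟩
    rw [e, div_mul_cancel₀ _ hk'.ne', mul_lt_mul_iff_right₀ (by positivity)] at hτ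
    exact lt_of_le_of_lt (le_abs_self M) (abs_lt_of_sq_lt_sq hτ τ.im_pos.le)

/-- Isotropy makes the pairing with the section a perfect square, `-an(τ - b/a)²`. The horoball
condition thus compares `|τ - b/a|⁴` with `(Im τ)²`, and its square root is the equation of a disk
tangent to the real axis at `b/a`. -/
theorem containsHoroball_rat (h : S.IsPolarization n H) {a b c : ℤ} (ha : a ≠ 0)
    (habc : a * c = n * b ^ 2) {W : Set ℍ} :
    S.ContainsHoroball n H (S.latVec H a b c) W ↔ ∃ r : ℝ, 0 < r ∧
      ∀ τ : ℍ, dist (τ : ℂ) (((b / a : ℚ) : ℂ) + r * Complex.I) < r → τ ∈ W := by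
  have hn : (0 : ℝ) < n := by exact_mod_cast h.n_pos
  have ha' : (a : ℂ) ≠ 0 := by exact_mod_cast ha
  have ha2 : (0 : ℝ) < (a : ℝ) ^ 2 := by positivity
  have e : ∀ τ : ℍ, ‖latticeForm mukaiGram (S.extVec H 1 τ (n * (τ : ℂ) ^ 2) : MukaiIndex → ℂ)
      (castVec (S.latVec H a b c : MukaiIndex → ℤ))‖ ^ 2 =
        (a : ℝ) ^ 2 * n ^ 2 * (‖(τ : ℂ) - (b / a : ℚ)‖ ^ 2) ^ 2 := fun τ => by
    have e1 : (2 * n * (τ : ℂ) * b - 1 * c - n * (τ : ℂ) ^ 2 * a : ℂ) =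
        -(a * n * ((τ : ℂ) - (b / a : ℚ)) ^ 2) := by
      have habc' : (a : ℂ) * c = n * b ^ 2 := by exact_mod_cast habc
      push_cast
      field_simp
      linear_combination -habc'
    rw [h.form_extVec_latVec, e1, norm_neg, norm_mul, norm_mul, norm_pow, Complex.norm_intCast,
      Complex.norm_natCast, mul_pow, mul_pow, sq_abs]
  constructor
  · rintro ⟨M, hM⟩
    -- With `K = |M|a²n` any radius at most `1/√K` works. The choice `1/(K + 1)` needs only `K ≤ (K
    -- + 1)²` and also makes sense for `K = 0`.
    refine ⟨(|M| * a ^ 2 * n + 1)⁻¹, by positivity, fun τ hτ => hM τ ?_⟩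
    rw [dist_tangent_disk_lt_iff _ _ (by positivity)] at hτ
    rw [e]
    have hd : 0 ≤ ‖(τ : ℂ) - (b / a : ℚ)‖ ^ 2 := by positivity
    generalize ‖(τ : ℂ) - (b / a : ℚ)‖ ^ 2 = d at hd hτ ⊢
    have hK : 0 ≤ |M| * (a : ℝ) ^ 2 * n := by positivity
    have hMK : M * ((a : ℝ) ^ 2 * n ^ 2 * d ^ 2) ≤ n * (|M| * a ^ 2 * n * d ^ 2) := by
      calc M * ((a : ℝ) ^ 2 * n ^ 2 * d ^ 2) ≤ |M| * ((a : ℝ) ^ 2 * n ^ 2 * d ^ 2) := by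
            gcongr; exact le_abs_self M
        _ = _ := by ring
    generalize |M| * (a : ℝ) ^ 2 * n = K at hK hMK hτ
    have hd1 : (K + 1) * d < 2 * τ.im := by
      rw [mul_assoc, mul_left_comm, inv_mul_eq_div, lt_div_iff₀ (by linarith)] at hτ
      linarith
    have hd2 : ((K + 1) * d) ^ 2 < (2 * τ.im) ^ 2 :=
      pow_lt_pow_left₀ hd1 (by positivity) two_ne_zero
    have hd3 : K * d ^ 2 ≤ ((K + 1) * d) ^ 2 := by
      rw [mul_pow]
      gcongr
      nlinarith
    have : n * (K * d ^ 2) < n * (2 * τ.im) ^ 2 := by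
      gcongr
      linarith
    linarith
  · rintro ⟨r, hr, hM⟩
    -- For this `M` the horoball is exactly the disk of radius `r`.
    refine ⟨1 / (a ^ 2 * n * r ^ 2), fun τ hτ => hM τ ?_⟩
    rw [dist_tangent_disk_lt_iff _ _ hr]
    rw [e] at hτ
    refine lt_of_pow_lt_pow_left₀ 2 (mul_pos (mul_pos two_pos hr) τ.im_pos).le ?_
    have e2 : 1 / (a ^ 2 * n * r ^ 2) * ((a : ℝ) ^ 2 * n ^ 2 *
        (‖(τ : ℂ) - (b / a : ℚ)‖ ^ 2) ^ 2) = n / r ^ 2 * (‖(τ : ℂ) - (b / a : ℚ)‖ ^ 2) ^ 2 := by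
      field_simp
    rw [e2, div_mul_eq_mul_div, div_lt_iff₀ (by positivity)] at hτ
    refine lt_of_mul_lt_mul_left (a := (n : ℝ)) ?_ hn.le
    linarith

end IsPolarization

end MarkedK3

theorem continuousOn_iff_comp_homeomorph {X Y Z : Type*} [TopologicalSpace X] [TopologicalSpace Y]
    [TopologicalSpace Z] (e : X ≃ₜ Y) {f : Y → Z} {U : Set Y} :
    ContinuousOn f U ↔ ContinuousOn (f ∘ e) (e ⁻¹' U) := by
  refine ⟨fun hf => hf.comp e.continuous.continuousOn fun _ hx => hx, fun hf => ?_⟩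
  have := hf.comp (s := U) e.symm.continuous.continuousOn fun x hx => by
    rwa [Set.mem_preimage, e.apply_symm_apply]
  exact this.congr fun x _ => by simp

/-! ### Extension to the cusps and passage to the quotients -/

namespace MarkedK3.IsPolarization

variable {S : MarkedK3} {n : ℕ} {H : S.NS}

theorem tube_mem_OmegaStar (h : S.IsPolarization n H) (x : HStar) :
    S.tube n H x.1 ∈ S.OmegaPlus ∨ S.tube n H x.1 ∈ S.isotropicLines := by
  rcases x.cases with ⟨τ, rfl⟩ | ⟨q, rfl⟩ | rfl
  · exact Or.inl (h.upperHomeo τ).2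
  · exact Or.inr (h.mem_isotropicLines_iff.2 (Or.inr ⟨q, rfl⟩))
  · exact Or.inr (h.mem_isotropicLines_iff.2 (Or.inl rfl))

/-- The extension of the tube domain realization to the rational boundary points. -/
def starEquiv (h : S.IsPolarization n H) : HStar ≃ S.OmegaStar :=
  Equiv.ofBijective (fun x => ⟨S.tube n H x.1, h.tube_mem_OmegaStar x⟩)
    ⟨fun x y e => Subtype.ext (h.tube_injective (congrArg Subtype.val e)), by
      rintro ⟨p, hp | hp⟩
      · obtain ⟨τ, rfl⟩ := h.exists_eq_tube hp
        exact ⟨HStar.ofUpper τ, rfl⟩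
      · rcases h.mem_isotropicLines_iff.1 hp with rfl | ⟨q, rfl⟩
        · exact ⟨HStar.inf, rfl⟩
        · exact ⟨HStar.ofRat q, rfl⟩⟩

theorem coe_starEquiv (h : S.IsPolarization n H) (x : HStar) :
    (h.starEquiv x).1 = S.tube n H x.1 := rfl

theorem starEquiv_mem_isotropicLines (h : S.IsPolarization n H) (x : HStar) :
    (h.starEquiv x).1 ∈ S.isotropicLines ↔ x = HStar.inf ∨ ∃ q : ℚ, x = HStar.ofRat q := by
  rw [h.mem_isotropicLines_iff, coe_starEquiv]
  refine or_congr ?_ (exists_congr fun q => ?_)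
  · rw [h.tube_injective.eq_iff]
    exact ⟨fun e => Subtype.ext e, fun e => congrArg Subtype.val e⟩
  · rw [h.tube_injective.eq_iff]
    exact ⟨fun e => Subtype.ext e, fun e => congrArg Subtype.val e⟩

/-- On the interior the tube homeomorphism applies. At a cusp, the neighbourhood condition for each
lattice vector spanning the line is equivalent to the one for half planes or tangent disks, so it
does not matter which spanning vector is used. -/
theorem isOpen_starEquiv_preimage_iff (h : S.IsPolarization n H) {U : Set S.OmegaStar} :
    IsOpen (h.starEquiv ⁻¹' U) ↔ IsOpen U := by
  have h1 : IsOpen (HStar.ofUpper ⁻¹' (h.starEquiv ⁻¹' U)) ↔ IsOpen (S.ofOmega ⁻¹' U) :=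
    h.upperHomeo.isOpen_preimage (s := S.ofOmega ⁻¹' U)
  refine and_congr h1 ⟨?_, fun hU => ⟨fun hinf => ?_, fun q hq => ?_⟩⟩
  · rintro ⟨hinf, hrat⟩ x hx l hl h0 e
    refine (h.containsHoroball_iff (W := S.ofOmega ⁻¹' U)).2 ?_
    rcases h.isotropic_cases hl h0 with ⟨k, hk, rfl⟩ | ⟨a, b, c, ha, habc, rfl⟩
    · rw [h.latticeLine_infty hl] at e
      rw [h.containsHoroball_infty hk]
      refine hinf ?_
      rwa [Set.mem_preimage, show h.starEquiv HStar.inf = x from Subtype.ext e.symm]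
    · rw [h.latticeLine_coe ha habc hl] at e
      rw [h.containsHoroball_rat ha habc]
      refine hrat _ ?_
      rwa [Set.mem_preimage, show h.starEquiv (HStar.ofRat _) = x from Subtype.ext e.symm]
  · have hl := h.latVec_ne_zero (a := 0) (b := 0) (c := 1) (by simp)
    have := hU _ hinf _ hl (by rw [h.form_latVec]; simp) (h.latticeLine_infty hl).symm
    exact (h.containsHoroball_infty one_ne_zero).1
      ((h.containsHoroball_iff (W := S.ofOmega ⁻¹' U)).1 this)
  · obtain ⟨l, hl, h0, e⟩ := (h.starEquiv_mem_isotropicLines (HStar.ofRat q)).2 (Or.inr ⟨q, rfl⟩)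
    have h2 := (h.containsHoroball_iff (W := S.ofOmega ⁻¹' U)).1 (hU _ hq l hl h0 e)
    rcases h.isotropic_cases hl h0 with ⟨k, hk, rfl⟩ | ⟨a, b, c, ha, habc, rfl⟩
    · rw [h.latticeLine_infty hl] at e
      exact absurd (h.tube_injective (h.coe_starEquiv _ ▸ e)).symm (OnePoint.infty_ne_coe _)
    · rw [h.latticeLine_coe ha habc hl] at e
      have hq' : q = b / a := by
        exact_mod_cast OnePoint.coe_eq_coe.1 (h.tube_injective e)
      rw [hq']
      exact (h.containsHoroball_rat ha habc).1 h2

/-- The extension of the tube domain realization to the rational boundary points, as a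
homeomorphism. -/
def starHomeo (h : S.IsPolarization n H) : HStar ≃ₜ S.OmegaStar :=
  h.starEquiv.toHomeomorph fun _ => h.isOpen_starEquiv_preimage_iff

/-- The extension of the tube domain realization to the rational boundary points. -/
def starIso (h : S.IsPolarization n H) : HStar.hol.Iso S.omegaStarHol where
  toHomeo := h.starHomeo
  hol_iff U hU f := by
    exact and_congr (continuousOn_iff_comp_homeomorph h.starHomeo)
      (h.upperIso.hol_iff (S.ofOmega ⁻¹' U) hU.1 (f ∘ S.ofOmega))

/-- The tube domain realization, its extension to the rational boundary points, the isomorphism of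
the quotients, and its extension to the compactifications. -/
theorem exists_isos (h : S.IsPolarization n H) :
    ∃ (T : upperHol.Iso S.omegaHol) (Tc : HStar.hol.Iso S.omegaStarHol)
      (Φ : (frickeCurve n).Iso S.kahlerModuli) (Φc : (frickeCurveCpt n).Iso S.kahlerModuliCpt),
      (∀ τ : ℍ, (T.toHomeo τ).1 = S.tube n H ((τ : ℂ) : OnePoint ℂ)) ∧
      (∀ x : HStar, (Tc.toHomeo x).1 = S.tube n H x.1) ∧
      (∀ τ : ℍ, Tc.toHomeo (HStar.ofUpper τ) = S.ofOmega (T.toHomeo τ)) ∧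
      (∀ x : HStar, (Tc.toHomeo x).1 ∈ S.isotropicLines ↔
        (x = HStar.inf ∨ ∃ q : ℚ, x = HStar.ofRat q)) ∧
      (∀ τ : ℍ, Φ.toHomeo (Quotient.mk (MulAction.orbitRel (frickeGroup n) ℍ) τ) =
        Quotient.mk S.omegaSetoid (T.toHomeo τ)) ∧
      ∀ x : HStar, Φc.toHomeo (Quotient.mk (HStar.frickeSetoid n) x) =
        Quotient.mk S.omegaStarSetoid (Tc.toHomeo x) := by
  obtain ⟨Ψ, hsurj, -, -, hequiv⟩ := h.exists_frickeGroup_hom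
  -- Orbits correspond because the tube map is injective and equivariant and every element of
  -- `Γ(S)⁺` comes from the Fricke group. Stated on the whole sphere, this serves the open and the
  -- compactified quotient alike.
  have key : ∀ x y : OnePoint ℂ, (∃ γ ∈ frickeGroup n, slToGL γ • x = y) ↔
      ∃ g ∈ S.GamPlus, S.act g (S.tube n H x) = S.tube n H y := by
    intro x y
    constructor
    · rintro ⟨γ, hγ, rfl⟩
      exact ⟨_, (Ψ (⟨γ, hγ⟩, 1)).2, (hequiv ⟨γ, hγ⟩ 1 x).symm⟩
    · rintro ⟨g, hg, e⟩
      obtain ⟨⟨γ, ε⟩, hγ⟩ := hsurj ⟨g, hg⟩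
      refine ⟨γ, γ.2, h.tube_injective ?_⟩
      rw [hequiv γ ε, hγ, e]
  have hstar : ∀ x y : HStar, HStar.frickeSetoid n x y ↔
      S.omegaStarSetoid (h.starHomeo x) (h.starHomeo y) := fun x y => key x.1 y.1
  have hupper : ∀ x y : ℍ, MulAction.orbitRel (frickeGroup n) ℍ x y ↔
      S.omegaSetoid (h.upperHomeo x) (h.upperHomeo y) := by
    intro x y
    -- In `MulAction.orbitRel` the group element moves the second point to the first, opposite to
    -- the convention of the other setoids.
    rw [Setoid.comm']
    refine Iff.trans ?_ (key (x : ℂ) (y : ℂ))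
    constructor
    · rintro ⟨γ, hγ⟩
      refine ⟨γ, γ.2, ?_⟩
      rw [← coe_smul_upperHalfPlane]
      exact congrArg (fun τ : ℍ => ((τ : ℂ) : OnePoint ℂ)) hγ
    · rintro ⟨γ, hγ, e⟩
      rw [← coe_smul_upperHalfPlane, OnePoint.coe_eq_coe] at e
      exact ⟨⟨γ, hγ⟩, UpperHalfPlane.ext e⟩
  exact ⟨h.upperIso, h.starIso, h.upperIso.quotient hupper, h.starIso.quotient hstar,
    fun _ => rfl, fun _ => rfl, fun _ => rfl, h.starEquiv_mem_isotropicLines, fun _ => rfl,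
    fun _ => rfl⟩

end MarkedK3.IsPolarization

end

theorem proposition5p4 (S : MarkedK3) (n : ℕ) (H : S.NS)
    (hNS : Submodule.span ℤ {H} = ⊤)
    (hdeg : latticeForm k3Gram (H : K3Index → ℤ) (H : K3Index → ℤ) = 2 * n)
    (hample : 0 < latticeForm k3Gram (H : K3Index → ℤ) S.ample) :
    -- the isometry group in terms of the normalizer of the Eichler order
    (∃ Ψ : eichlerNormalizer n × ℤˣ →* isometryGroup mukaiGram S.extNS,
      Function.Surjective Ψ ∧
      (∀ γ ε, Ψ (γ, ε) = 1 ↔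
        (∃ c : ℚ, ((γ : GL (Fin 2) ℚ) : Matrix (Fin 2) (Fin 2) ℚ) = c • 1) ∧ ε = 1) ∧
      (∀ (γ : eichlerNormalizer n) (ε : ℤˣ), S.IsAdjoint n H
        (Matrix.GeneralLinearGroup.map (algebraMap ℚ ℂ) (γ : GL (Fin 2) ℚ)) ε (Ψ (γ, ε))) ∧
      ∀ γ ε, Ψ (γ, ε) ∈ S.GamPlus ↔ (γ : GL (Fin 2) ℚ) ∈ frickeGroupRat n) ∧
    -- `Γ(S)⁺` in terms of the Fricke group, and the equivariance of the tube domain map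
    (∃ Ψ : frickeGroup n × ℤˣ →* S.GamPlus,
      Function.Surjective Ψ ∧
      (∀ γ ε, Ψ (γ, ε) = 1 ↔ ((γ : SL(2, ℝ)) = 1 ∨ (γ : SL(2, ℝ)) = -1) ∧ ε = 1) ∧
      (∀ (γ : frickeGroup n) (ε : ℤˣ), S.IsAdjoint n H (slToGL γ) ε (Ψ (γ, ε))) ∧
      ∀ (γ : frickeGroup n) (ε : ℤˣ) (x : OnePoint ℂ),
        S.tube n H (slToGL γ • x) = S.act (Ψ (γ, ε)) (S.tube n H x)) ∧
    -- the tube domain realization, its extension to the rational boundary points, the isomorphism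
    -- of the quotients, and its extension to the compactifications
    ∃ (T : upperHol.Iso S.omegaHol) (Tc : HStar.hol.Iso S.omegaStarHol)
      (Φ : (frickeCurve n).Iso S.kahlerModuli) (Φc : (frickeCurveCpt n).Iso S.kahlerModuliCpt),
      (∀ τ : ℍ, (T.toHomeo τ).1 = S.tube n H ((τ : ℂ) : OnePoint ℂ)) ∧
      (∀ x : HStar, (Tc.toHomeo x).1 = S.tube n H x.1) ∧
      (∀ τ : ℍ, Tc.toHomeo (HStar.ofUpper τ) = S.ofOmega (T.toHomeo τ)) ∧
      (∀ x : HStar, (Tc.toHomeo x).1 ∈ S.isotropicLines ↔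
        (x = HStar.inf ∨ ∃ q : ℚ, x = HStar.ofRat q)) ∧
      (∀ τ : ℍ, Φ.toHomeo (Quotient.mk (MulAction.orbitRel (frickeGroup n) ℍ) τ) =
        Quotient.mk S.omegaSetoid (T.toHomeo τ)) ∧
      ∀ x : HStar, Φc.toHomeo (Quotient.mk (HStar.frickeSetoid n) x) =
        Quotient.mk S.omegaStarSetoid (Tc.toHomeo x) := by
  have h : S.IsPolarization n H := ⟨hNS, hdeg, hample⟩
  exact ⟨h.exists_eichlerNormalizer_hom, h.exists_frickeGroup_hom, h.exists_isos⟩
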